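/- Notation. Vectors of $\mathbb R^3$ are column vectors, $S^2\subset\mathbb R^3$ is the unit sphere, and $\mathcal C_0=\{(x,t)\in\mathbb R^{3,1}: t=|x|\}$ is the future null cone (away from its vertex) with polar coordinates $(\rho,\zeta)\in\mathbb R^+\times S^2$, $(x,t)=(\rho\zeta,\rho)$, and induced degenerate metric $ds^2_{\mathcal C_0}=\rho^2|d\zeta|^2$. A quasi-sphere of radius $r>0$ is a smooth orientation preserving embedding $\phi:S^2\to\mathcal C_0$ with $\phi^*(ds^2_{\mathcal C_0})=r^2|d\theta|^2$. Let $\Omega\subset\mathbb R\times\mathbb R^+$ be open, with coordinates $(z,r)$. A $C^\infty$ map $\Phi:\Omega\times S^2\to\mathbb R\times\mathcal C_0$ is quasi-spherical if for each $(z,r)\in\Omega$ it restricts to a quasi-sphere of radius $r$ in $\{z\}\times\mathcal C_0$. Let $$ds^2_{SF}=-2U\,dz(d\rho+V\,dz)+|\rho\,d\zeta+\Gamma\,dz|^2$$ be a shear-free NQS metric on a set $D\subset\mathbb R\times\mathcal C_0$, where $U>0$, $V$ are real functions and $\Gamma$ is $\mathbb R^3$-valued with $\zeta^T\Gamma=0$.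 For $w,\theta\in\mathbb R^3$ put $b=\sqrt{1+|w|^2}$, $W=I+\frac1{b+1}ww^T$, $f=b+\theta^Tw$, $A=I-f^{-1}(\theta+\frac1{b+1}w)w^T$, $\Theta=I-\theta\theta^T$, and for a $3\times3$ matrix $S$ put $*S=(\tfrac12\epsilon_{ijk}S_{jk})_i$. Proposition. Let $\Phi:\Omega\times S^2\to D$ be a $C^\infty$ quasi-spherical map. Then there are $w\in C^\infty(\Omega,\mathbb R^3)$ and $R\in C^\infty(\Omega,SO(3))$ such that, with $w,R$ evaluated at $(z,r)$, $$\Phi(z,r,\theta)=(z,\rho,\zeta),\qquad \rho=rf,\qquad \zeta=f^{-1}R(w+W\theta).$$ Write $\tilde U=U\circ\Phi$, $\tilde V=V\circ\Phi$, $\tilde\Gamma=\Gamma\circ\Phi$, and, for $(i,x)=(0,z)$ and $(i,x)=(1,r)$, $$S_i=WR^{-1}R_{,x}W,\qquad s_i=*S_i+\tfrac1{b+1}w_{,x}\times w,\qquad t_i=b^{-1}S_iw+W^{-1}w_{,x}.$$ Define functions $u$, $h$ and vectors $\beta$, $\gamma$ (which are angular: $\theta^T\beta=\theta^T\gamma=0$)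 by $$u=\tilde Uf(1+r\theta^Tt_1),\qquad h=\tilde U\big(\tilde V+rf\theta^Tt_0+\tfrac12\tilde U|\Theta w|^2-fw^TR^T\tilde\Gamma\big),$$ $$\beta=r\Theta t_1+r\,\theta\times s_1,\qquad \gamma=r\Theta t_0+r\,\theta\times s_0+A^{-1}R^T\tilde\Gamma-\tilde U\Theta w.$$ Then on $\Omega\times S^2$ $$\Phi^*(ds^2_{SF})=|r\,d\theta+\beta\,dr+\gamma\,dz|^2-2u\,dr\,dz-2h\,dz^2.$$ Moreover, at each point, real numbers $u',v'$ and angular vectors $\beta',\gamma'$ satisfy $\Phi^*(ds^2_{SF})=-2u'\,dz(dr+v'\,dz)+|r\,d\theta+\beta'\,dr+\gamma'\,dz|^2$ if and only if $u'=u$, $u'v'=h$, $\beta'=\beta$, $\gamma'=\gamma$; that is, the NQS parameters of the pullback metric are given by these formulas, with $uv=h$. Finally, suppose $r|t_1|<1$ on $\Omega$. Then $u>0$, and $\Phi$ is a local diffeomorphism on $\Omega\times S^2$; if in addition every slice $\{r:(z,r)\in\Omega\}$ is an interval (possibly empty), then $\Phi$ is a diffeomorphism of $\Omega\times S^2$ onto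 an open subset of $\mathbb R\times\mathcal C_0$. -/

import Mathlib

open Set
open scoped Manifold ContDiff Matrix

noncomputable section

namespace NQS

/-- The unit sphere `S²` in Euclidean 3-space, with Mathlib's smooth structure. -/
abbrev S2 : Type := Metric.sphere (0 : EuclideanSpace ℝ (Fin 3)) 1

/-- `ℝ × ℝ × S²` with points `((z, r), θ)`. The part `r > 0` is `ℝ × 𝒞₀` in polar coordinates,
where `𝒞₀ = {(x, t) : t = |x|, x ≠ 0}` is the future null cone of Minkowski space without its
vertex: `(r, θ)` stands for the point `(x, t) = (rθ, r)`. On `𝒞₀` the Minkowski metric induces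
`r²|dθ|²`. -/
abbrev Pt : Type := (ℝ × ℝ) × S2

/-- The model with corners of `Pt`. -/
abbrev IPt : ModelWithCorners ℝ ((ℝ × ℝ) × EuclideanSpace ℝ (Fin 2))
    (ModelProd (ℝ × ℝ) (EuclideanSpace ℝ (Fin 2))) :=
  𝓘(ℝ, ℝ × ℝ).prod (𝓡 2)

/-- The direction cosines `(θ₁, θ₂, θ₃)` of a point of `S²`. Vectors of `ℝ³` are column vectors
`Fin 3 → ℝ`, and lengths are always expressed through the dot product. -/
def vec (θ : S2) : Fin 3 → ℝ := WithLp.ofLp (θ : EuclideanSpace ℝ (Fin 3))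

/-- The Euclidean length. -/
def len (x : Fin 3 → ℝ) : ℝ := Real.sqrt (x ⬝ᵥ x)

/-! ### Coordinate differentials and the metrics -/

/-- The coordinate 1-form `dz` on `Pt`. -/
def dz (p : Pt) (ξ : TangentSpace IPt p) : ℝ :=
  mfderiv IPt 𝓘(ℝ, ℝ) (fun x : Pt => x.1.1) p ξ

/-- The coordinate 1-form `dr` on `Pt`. -/
def dr (p : Pt) (ξ : TangentSpace IPt p) : ℝ :=
  mfderiv IPt 𝓘(ℝ, ℝ) (fun x : Pt => x.1.2) p ξ

/-- The `ℝ³`-valued 1-form `dθ` on `Pt`. -/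
def dtheta (p : Pt) (ξ : TangentSpace IPt p) : Fin 3 → ℝ :=
  mfderiv IPt 𝓘(ℝ, Fin 3 → ℝ) (fun x : Pt => vec x.2) p ξ

/-- The line element `-2 u dz (dr + v dz) + |r dθ + β dr + γ dz|²` at the point `p`, as a quadratic
form in the tangent vector `ξ`; `u`, `v`, `β`, `γ` are the values of the parameters at `p`. -/
def nqsForm (u v : ℝ) (β γ : Fin 3 → ℝ) (p : Pt) (ξ : TangentSpace IPt p) : ℝ :=
  -2 * u * dz p ξ * (dr p ξ + v * dz p ξ)
    + (p.1.2 • dtheta p ξ + dr p ξ • β + dz p ξ • γ)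
        ⬝ᵥ (p.1.2 • dtheta p ξ + dr p ξ • β + dz p ξ • γ)

/-- `U`, `V`, `Γ` are the parameters of a shear-free NQS metric
`-2 U dz (dr + V dz) + |r dθ + Γ dz|²` on `D ⊆ ℝ × 𝒞₀`: `U > 0` and `Γ` is angular
(`V` is an arbitrary real function). -/
structure IsShearFreeNQS (D : Set Pt) (U : Pt → ℝ) (Γ : Pt → Fin 3 → ℝ) : Prop where
  radius_pos : ∀ p ∈ D, 0 < p.1.2
  U_pos : ∀ p ∈ D, 0 < U p
  angular : ∀ p ∈ D, vec p.2 ⬝ᵥ Γ p = 0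

/-- The pullback `Φ^*(ds²_SF)` of `ds²_SF = -2 U dz (dr + V dz) + |r dθ + Γ dz|²`, evaluated at the
tangent vector `ξ` at `p`. -/
def pullbackSF (Φ : Pt → Pt) (U V : Pt → ℝ) (Γ : Pt → Fin 3 → ℝ) (p : Pt)
    (ξ : TangentSpace IPt p) : ℝ :=
  nqsForm (U (Φ p)) (V (Φ p)) 0 (Γ (Φ p)) (Φ p) (mfderiv IPt IPt Φ p ξ)

/-! ### Quasi-spherical maps -/

/-- The differential of an `S²`-valued map on `S²`, read in `ℝ³`. -/
def dvec (ζ : S2 → S2) (θ : S2) (ξ : TangentSpace (𝓡 2) θ) : Fin 3 → ℝ :=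
  mfderiv (𝓡 2) 𝓘(ℝ, Fin 3 → ℝ) (fun x : S2 => vec (ζ x)) θ ξ

/-- `φ = (ρ, ζ) : S² → 𝒞₀` (in polar coordinates) is a quasi-sphere of radius `r`: an orientation
preserving smooth embedding with `φ^*(ρ²|dζ|²) = r²|dθ|²`. The orientation of `S²` at `θ` is given
by `det(θ, ξ, η) > 0`. Since `φ(S²)` is a surface transverse to the generators of `𝒞₀`, it is
oriented in the same way relative to the outward generator direction `ζ`. -/
structure IsQuasiSphere (r : ℝ) (φ : S2 → ℝ × S2) : Prop where
  radius_pos : ∀ θ, 0 < (φ θ).1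
  embedding : Manifold.IsSmoothEmbedding (𝓡 2) (𝓘(ℝ, ℝ).prod (𝓡 2)) ∞ φ
  isometric : ∀ (θ : S2) (ξ : TangentSpace (𝓡 2) θ),
    (φ θ).1 ^ 2 * (dvec (fun x => (φ x).2) θ ξ ⬝ᵥ dvec (fun x => (φ x).2) θ ξ)
      = r ^ 2 * (dvec id θ ξ ⬝ᵥ dvec id θ ξ)
  orientation : ∀ (θ : S2) (ξ η : TangentSpace (𝓡 2) θ),
    0 < vec θ ⬝ᵥ (dvec id θ ξ ⨯₃ dvec id θ η) →
    0 < vec (φ θ).2 ⬝ᵥ (dvec (fun x => (φ x).2) θ ξ ⨯₃ dvec (fun x => (φ x).2) θ η)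

/-- `Φ : Ω × S² → ℝ × 𝒞₀` is quasi-spherical: for each `(z, r) ∈ Ω` it restricts to a quasi-sphere
of radius `r` in the cone `{z} × 𝒞₀`. -/
def IsQuasiSpherical (Ω : Set (ℝ × ℝ)) (Φ : Pt → Pt) : Prop :=
  ∀ q ∈ Ω, (∀ θ : S2, (Φ (q, θ)).1.1 = q.1) ∧
    IsQuasiSphere q.2 (fun θ : S2 => ((Φ (q, θ)).1.2, (Φ (q, θ)).2))

/-! ### Boosts and rotations -/

/-- `b = √(1 + |w|²)`. -/
def boostB (w : Fin 3 → ℝ) : ℝ := Real.sqrt (1 + w ⬝ᵥ w)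

/-- `W = I + (b + 1)⁻¹ w wᵀ`. -/
def boostW (w : Fin 3 → ℝ) : Matrix (Fin 3) (Fin 3) ℝ :=
  1 + (1 / (boostB w + 1)) • Matrix.vecMulVec w w

/-- `f = b + θᵀ w`. -/
def fFac (w θ : Fin 3 → ℝ) : ℝ := boostB w + θ ⬝ᵥ w

/-- `A = I - f⁻¹ (θ + (b + 1)⁻¹ w) wᵀ`. -/
def matA (w θ : Fin 3 → ℝ) : Matrix (Fin 3) (Fin 3) ℝ :=
  1 - (fFac w θ)⁻¹ • Matrix.vecMulVec (θ + (boostB w + 1)⁻¹ • w) w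

/-- The tangential projection `Θ = I - θ θᵀ`. -/
def proj (θ : Fin 3 → ℝ) : Matrix (Fin 3) (Fin 3) ℝ := 1 - Matrix.vecMulVec θ θ

/-- `(*S)ᵢ = ½ εᵢⱼₖ Sⱼₖ`. -/
def starVec (S : Matrix (Fin 3) (Fin 3) ℝ) : Fin 3 → ℝ :=
  ![(S 1 2 - S 2 1) / 2, (S 2 0 - S 0 2) / 2, (S 0 1 - S 1 0) / 2]

/-- `S = W R⁻¹ Ṙ W`, for a derivative `R'` of `R`. -/
def matS (w : Fin 3 → ℝ) (R R' : Matrix (Fin 3) (Fin 3) ℝ) : Matrix (Fin 3) (Fin 3) ℝ :=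
  boostW w * R⁻¹ * R' * boostW w

/-- `s = *S + (b + 1)⁻¹ ẇ × w`. -/
def vecS (w w' : Fin 3 → ℝ) (R R' : Matrix (Fin 3) (Fin 3) ℝ) : Fin 3 → ℝ :=
  starVec (matS w R R') + (1 / (boostB w + 1)) • (w' ⨯₃ w)

/-- `t = b⁻¹ S w + W⁻¹ ẇ`. -/
def vecT (w w' : Fin 3 → ℝ) (R R' : Matrix (Fin 3) (Fin 3) ℝ) : Fin 3 → ℝ :=
  (boostB w)⁻¹ • (matS w R R' *ᵥ w) + (boostW w)⁻¹ *ᵥ w'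

section Params

variable (w : ℝ × ℝ → Fin 3 → ℝ) (R : ℝ × ℝ → Matrix (Fin 3) (Fin 3) ℝ)

/-- `w_{,z}`. -/
def wz (q : ℝ × ℝ) : Fin 3 → ℝ := fun i => deriv (fun z => w (z, q.2) i) q.1

/-- `w_{,r}`. -/
def wr (q : ℝ × ℝ) : Fin 3 → ℝ := fun i => deriv (fun r => w (q.1, r) i) q.2

/-- `R_{,z}`. -/
def Rz (q : ℝ × ℝ) : Matrix (Fin 3) (Fin 3) ℝ :=
  Matrix.of fun i j => deriv (fun z => R (z, q.2) i j) q.1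

/-- `R_{,r}`. -/
def Rr (q : ℝ × ℝ) : Matrix (Fin 3) (Fin 3) ℝ :=
  Matrix.of fun i j => deriv (fun r => R (q.1, r) i j) q.2

/-- `s₀`. -/
def s0 (q : ℝ × ℝ) : Fin 3 → ℝ := vecS (w q) (wz w q) (R q) (Rz R q)

/-- `t₀`. -/
def t0 (q : ℝ × ℝ) : Fin 3 → ℝ := vecT (w q) (wz w q) (R q) (Rz R q)

/-- `s₁`. -/
def s1 (q : ℝ × ℝ) : Fin 3 → ℝ := vecS (w q) (wr w q) (R q) (Rr R q)

/-- `t₁`. -/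
def t1 (q : ℝ × ℝ) : Fin 3 → ℝ := vecT (w q) (wr w q) (R q) (Rr R q)

/-- `w ∈ C^∞(Ω, ℝ³)` and `R ∈ C^∞(Ω, SO(3))`. -/
def IsSmoothBoostRotation (Ω : Set (ℝ × ℝ)) : Prop :=
  ContDiffOn ℝ ∞ w Ω ∧ (∀ i j, ContDiffOn ℝ ∞ (fun q => R q i j) Ω) ∧
    ∀ q ∈ Ω, R q ∈ Matrix.specialOrthogonalGroup (Fin 3) ℝ

/-- `Φ(z, r, θ) = (z, r f, f⁻¹ R (w + W θ))` on `Ω × S²`, with `w`, `R` evaluated at `(z, r)`. -/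
def IsDescribedBy (Ω : Set (ℝ × ℝ)) (Φ : Pt → Pt) : Prop :=
  ∀ q ∈ Ω, ∀ θ : S2,
    (Φ (q, θ)).1 = (q.1, q.2 * fFac (w q) (vec θ)) ∧
    vec (Φ (q, θ)).2 =
      (fFac (w q) (vec θ))⁻¹ • (R q *ᵥ (w q + boostW (w q) *ᵥ vec θ))

/-- `Ũ f (1 + r θᵀt₁)`. -/
def uPar (Φ : Pt → Pt) (U : Pt → ℝ) (p : Pt) : ℝ :=
  U (Φ p) * fFac (w p.1) (vec p.2) * (1 + p.1.2 * (vec p.2 ⬝ᵥ t1 w R p.1))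

/-- `Ũ (Ṽ + r f θᵀt₀ + ½ Ũ |Θw|² - f wᵀ Rᵀ Γ̃)`. -/
def uvPar (Φ : Pt → Pt) (U V : Pt → ℝ) (Γ : Pt → Fin 3 → ℝ) (p : Pt) : ℝ :=
  U (Φ p) * (V (Φ p) + p.1.2 * fFac (w p.1) (vec p.2) * (vec p.2 ⬝ᵥ t0 w R p.1)
    + 1 / 2 * U (Φ p) * ((proj (vec p.2) *ᵥ w p.1) ⬝ᵥ (proj (vec p.2) *ᵥ w p.1))
    - fFac (w p.1) (vec p.2) * (w p.1 ⬝ᵥ ((R p.1)ᵀ *ᵥ Γ (Φ p))))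

/-- `r Θ t₁ + r θ × s₁`. -/
def betaPar (p : Pt) : Fin 3 → ℝ :=
  p.1.2 • (proj (vec p.2) *ᵥ t1 w R p.1) + p.1.2 • (vec p.2 ⨯₃ s1 w R p.1)

/-- `r Θ t₀ + r θ × s₀ + A⁻¹ Rᵀ Γ̃ - Ũ Θ w`. -/
def gammaPar (Φ : Pt → Pt) (U : Pt → ℝ) (Γ : Pt → Fin 3 → ℝ) (p : Pt) : Fin 3 → ℝ :=
  p.1.2 • (proj (vec p.2) *ᵥ t0 w R p.1) + p.1.2 • (vec p.2 ⨯₃ s0 w R p.1)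
    + (matA (w p.1) (vec p.2))⁻¹ *ᵥ ((R p.1)ᵀ *ᵥ Γ (Φ p))
    - U (Φ p) • (proj (vec p.2) *ᵥ w p.1)

end Params

/-- `Φ` restricts to a diffeomorphism of `S` onto an open set. -/
def IsDiffeoOntoOpen (Φ : Pt → Pt) (S : Set Pt) : Prop :=
  ContMDiffOn IPt IPt ∞ Φ S ∧ IsOpen (Φ '' S) ∧
    ∃ Ψ : Pt → Pt, ContMDiffOn IPt IPt ∞ Ψ (Φ '' S) ∧ ∀ p ∈ S, Ψ (Φ p) = p

end NQS

end

/-! The isometry condition says that `θ ↦ ζ` is a conformal map of the round sphere with factor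
`r/ρ`. What has to be shown is that, with `f = ρ/r`, both `f` and `fζ` are affine functions of `θ`;
then `(ρ, ζ)` is the restriction of a Lorentz transformation to the light cone.

For this, let `v(z)` be `ζ` in the stereographic coordinate `z` and put `N = (v_x + i v_y)/|v_x|²`.
Its component `N_k` is the gradient of the coordinate function `v_k` for the pulled-back round
metric. Gradients of linear functions on the sphere are conformal fields, so `N` is entire; as `ρ`
is bounded on the compact sphere, `N` grows at most quadratically and is a quadratic polynomial.
Moreover `N·N = 0` and `N × N' = iN`. Hence `N₀ - iN₁ = P²`, `N₂ = PQ`, `-(N₀ + iN₁) = Q²` with `P`,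
`Q` affine in `z` (`exists_spinor`). Up to the divisor `1 + |z|²`, `f` and `fζ` are Hermitian forms
in `(P, Q)`, which makes them affine in `θ` (`IsConformalParam.exists_affine`). An affine map `θ ↦ m
+ Mθ` with these properties satisfies `MᵀM = I + wwᵀ = W²`, so that `M = RW` with `R` a rotation and
`m = Rw` (`exists_boost_rotation`). The values of `Φ` at `±e_j` determine `w` and `R` explicitly,
which gives their smoothness in `(z, r)`.

For the pullback, put `η = dθ + Θt + θ × s`, where `s`, `t` are now the combinations of `s_i`, `t_i`
with coefficients `dz`, `dr`. Two identities suffice: `A⁻¹Rᵀ(f dζ) = η` (`matAinv_mulVec_zetaDeriv`)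
and `df = f θᵀt + wᵀη` (`fFacDeriv_eq`). Since `A⁻¹Rᵀ` is isometric from the tangent plane at `ζ` to
that at `θ`, the metric becomes a square in `η` plus terms in `dz`, and completing the square
absorbs the term `wᵀη` (`pullback_form`).

If `ζ` does not vary, then `η = 0`, so at fixed `z` one has `dρ = f(1 + r θᵀt₁)dr`, which is
positive for `dr > 0` when `r|t₁| < 1`. Infinitesimally this makes the differential of `Φ`
injective; along a whole ray of the cone it makes `ρ` strictly increasing in `r`, hence `Φ`
injective when the slices are intervals. -/

noncomputable section

namespace NQS

/-! ### Conformal parametrisations of the sphere and a holomorphic vector. -/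

section

open Complex Filter Topology

/-- An entire function of at most quadratic growth is a quadratic polynomial. -/
theorem exists_quadratic_of_entire {h : ℂ → ℂ} (hd : Differentiable ℂ h) {C : ℝ}
    (hC : ∀ z, ‖h z‖ ≤ C * (1 + ‖z‖ ^ 2)) :
    ∃ c₀ c₁ c₂ : ℂ, ∀ z, h z = c₀ + c₁ * z + c₂ * z ^ 2 := by
  have key : ∀ n, 3 ≤ n → iteratedDeriv n h 0 = 0 := by
    intro n hn
    -- This is Cauchy's bound for the derivative of order `n` on the circle of radius `R`.
    have hlim : Tendsto (fun R : ℝ => n.factorial * (C * (1 + R ^ 2)) / R ^ n) atTop (𝓝 0) := by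
      have e : ∀ᶠ R : ℝ in atTop,
          (n.factorial * C) * (R⁻¹ ^ n + R⁻¹ ^ (n - 2)) = n.factorial * (C * (1 + R ^ 2)) / R ^ n := by
        filter_upwards [eventually_gt_atTop 0] with R hR
        obtain ⟨m, rfl⟩ : ∃ m, n = m + 2 := ⟨n - 2, by omega⟩
        simp only [Nat.add_sub_cancel]
        simp only [pow_add, inv_pow]
        field_simp
      refine Tendsto.congr' e ?_
      have h1 : Tendsto (fun R : ℝ => R⁻¹ ^ n) atTop (𝓝 0) := by
        simpa [show n ≠ 0 by omega] using (tendsto_inv_atTop_zero (𝕜 := ℝ)).pow n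
      have h2 : Tendsto (fun R : ℝ => R⁻¹ ^ (n - 2)) atTop (𝓝 0) := by
        simpa [show n - 2 ≠ 0 by omega] using (tendsto_inv_atTop_zero (𝕜 := ℝ)).pow (n - 2)
      simpa using (h1.add h2).const_mul (n.factorial * C : ℝ)
    have hle : ‖iteratedDeriv n h 0‖ ≤ 0 := by
      refine ge_of_tendsto hlim ?_
      filter_upwards [eventually_gt_atTop 0] with R hR
      refine norm_iteratedDeriv_le_of_forall_mem_sphere_norm_le n hR hd.diffContOnCl ?_
      intro z hz
      have : ‖z‖ = R := by simpa using hz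
      simpa [this] using hC z
    simpa using hle
  refine ⟨iteratedDeriv 0 h 0, iteratedDeriv 1 h 0, (2 : ℂ)⁻¹ * iteratedDeriv 2 h 0, fun z => ?_⟩
  rw [← taylorSeries_eq_of_entire' 0 z hd, tsum_eq_sum (s := Finset.range 3)]
  · simp [Finset.sum_range_succ]
  · intro n hn
    rw [key n (by simpa using hn)]
    simp

/-- The differential of an immersion `ℂ → S² ⊂ ℝ³`, in the form of the `ℂ³`-valued function
`(v_x + i v_y) / |v_x|²`. -/
def inverseDifferential (v : ℂ → Fin 3 → ℝ) (z : ℂ) (k : Fin 3) : ℂ :=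
  ((fderiv ℝ v z 1 k : ℂ) + I * (fderiv ℝ v z I k : ℂ)) /
    ((fderiv ℝ v z 1 ⬝ᵥ fderiv ℝ v z 1 : ℝ) : ℂ)

/-- A conformal, orientation preserving parametrisation of (a part of) the unit sphere. Seen from
outside the stereographic coordinate is negatively oriented. -/
structure IsConformalParam (v : ℂ → Fin 3 → ℝ) : Prop where
  contDiff : ContDiff ℝ ∞ v
  unit : ∀ z, v z ⬝ᵥ v z = 1
  orth : ∀ z, fderiv ℝ v z 1 ⬝ᵥ v z = 0
  immersed : ∀ z, 0 < fderiv ℝ v z 1 ⬝ᵥ fderiv ℝ v z 1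
  rot : ∀ z, fderiv ℝ v z I = fderiv ℝ v z 1 ⨯₃ v z

theorem hasLineDerivAt_apply {v : ℂ → Fin 3 → ℝ} {z : ℂ} (hv : DifferentiableAt ℝ v z) (u : ℂ)
    (k : Fin 3) : HasDerivAt (fun t : ℝ => v (z + t • u) k) (fderiv ℝ v z u k) 0 :=
  (hasDerivAt_pi.1 (hv.hasFDerivAt.hasLineDerivAt u)) k

/-- The vectors `X` and `X ⨯₃ v` form an orthogonal frame of the tangent plane, both of length
`|X|`. The tangential part of `H` is `H + |X|²v`, and `H ⨯₃ v` is this part turned by a right angle;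
both are expanded in the frame. In the application `X = v_x` and `H = v_xx`. -/
theorem cauchyRiemann_algebra {v X H : Fin 3 → ℝ} (h1 : v ⬝ᵥ v = 1) (h2 : X ⬝ᵥ v = 0)
    (h3 : H ⬝ᵥ v = -(X ⬝ᵥ X)) (k : Fin 3) :
    (X ⬝ᵥ X) * (H ⨯₃ v) k = X k * (X ⬝ᵥ (H ⨯₃ v)) + (X ⨯₃ v) k * (X ⬝ᵥ H) ∧
    (X ⬝ᵥ X) * (H k + (X ⬝ᵥ X) * v k) = X k * (X ⬝ᵥ H) - (X ⨯₃ v) k * (X ⬝ᵥ (H ⨯₃ v)) := by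
  simp only [dotProduct, Fin.sum_univ_three] at h1 h2 h3 ⊢
  rw [cross_apply, cross_apply]
  fin_cases k <;> simp <;> constructor <;> grind

theorem cross_fderiv_algebra {v X H : Fin 3 → ℝ} (h1 : v ⬝ᵥ v = 1) (h2 : X ⬝ᵥ v = 0)
    (h3 : H ⬝ᵥ v = -(X ⬝ᵥ X)) (k : Fin 3) :
    ((H ⨯₃ v) ⨯₃ v) k + (X ⨯₃ (X ⨯₃ v)) k = - H k - 2 * (X ⬝ᵥ X) * v k := by
  simp only [dotProduct, Fin.sum_univ_three] at h1 h2 h3 ⊢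
  simp only [cross_apply]
  fin_cases k <;> simp <;> grind

theorem hasDerivAt_dotProduct {ι : Type*} [Fintype ι] {a b : ℝ → ι → ℝ} {a' b' : ι → ℝ} {t : ℝ}
    (ha : ∀ k, HasDerivAt (fun s => a s k) (a' k) t)
    (hb : ∀ k, HasDerivAt (fun s => b s k) (b' k) t) :
    HasDerivAt (fun s => a s ⬝ᵥ b s) (a' ⬝ᵥ b t + a t ⬝ᵥ b') t := by
  have : HasDerivAt (fun s => ∑ k, a s k * b s k) (∑ k, (a' k * b t k + a t k * b' k)) t :=
    HasDerivAt.fun_sum fun k _ => (ha k).mul (hb k)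
  simpa [dotProduct, Finset.sum_add_distrib] using this

theorem hasDerivAt_cross {a b : ℝ → Fin 3 → ℝ} {a' b' : Fin 3 → ℝ} {t : ℝ}
    (ha : ∀ k, HasDerivAt (fun s => a s k) (a' k) t)
    (hb : ∀ k, HasDerivAt (fun s => b s k) (b' k) t) (k : Fin 3) :
    HasDerivAt (fun s => (a s ⨯₃ b s) k) ((a' ⨯₃ b t + a t ⨯₃ b') k) t := by
  simp only [cross_apply]
  fin_cases k
  · exact (((ha 1).mul (hb 2)).sub ((ha 2).mul (hb 1))).congr_deriv (by simp; ring)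
  · exact (((ha 2).mul (hb 0)).sub ((ha 0).mul (hb 2))).congr_deriv (by simp; ring)
  · exact (((ha 0).mul (hb 1)).sub ((ha 1).mul (hb 0))).congr_deriv (by simp; ring)

namespace IsConformalParam

variable {v : ℂ → Fin 3 → ℝ} (hv : IsConformalParam v)

/-- The second derivative `v_xx`. -/
def dxx (v : ℂ → Fin 3 → ℝ) (z : ℂ) : Fin 3 → ℝ := fderiv ℝ (fun z => fderiv ℝ v z 1) z 1

include hv

theorem contDiff_fderiv_apply (u : ℂ) : ContDiff ℝ ∞ (fun z => fderiv ℝ v z u) :=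
  (hv.contDiff.fderiv_right (m := ∞) (by simp)).clm_apply contDiff_const

theorem differentiable : Differentiable ℝ v := hv.contDiff.differentiable (by simp)

theorem differentiable_fderiv_apply (u : ℂ) : Differentiable ℝ (fun z => fderiv ℝ v z u) :=
  (hv.contDiff_fderiv_apply u).differentiable (by simp)

theorem lineDeriv (z u : ℂ) (k : Fin 3) :
    HasDerivAt (fun t : ℝ => v (z + t • u) k) (fderiv ℝ v z u k) 0 :=
  hasLineDerivAt_apply (hv.differentiable z) u k

theorem fderiv_fderiv_apply (z u u' : ℂ) :
    fderiv ℝ (fun z => fderiv ℝ v z u) z u' = fderiv ℝ (fun z => fderiv ℝ v z u') z u := by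
  have hd : DifferentiableAt ℝ (fderiv ℝ v) z :=
    (hv.contDiff.fderiv_right (m := ∞) (by simp)).differentiable (by simp) z
  have hs : IsSymmSndFDerivAt ℝ v z := hv.contDiff.contDiffAt.isSymmSndFDerivAt (by
    rw [minSmoothness_of_isRCLikeNormedField]; exact WithTop.coe_le_coe.2 le_top)
  rw [fderiv_clm_apply hd (by fun_prop), fderiv_clm_apply hd (by fun_prop)]
  simpa using hs u' u

theorem lineDeriv_rot (z u : ℂ) (k : Fin 3) :
    HasDerivAt (fun t : ℝ => fderiv ℝ v (z + t • u) I k)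
      ((fderiv ℝ (fun z => fderiv ℝ v z 1) z u ⨯₃ v z
        + fderiv ℝ v z 1 ⨯₃ fderiv ℝ v z u) k) 0 := by
  simp only [hv.rot]
  simpa using hasDerivAt_cross
    (hasLineDerivAt_apply (hv.differentiable_fderiv_apply 1 z) u) (hv.lineDeriv z u) k

theorem fderiv_rot (z u : ℂ) :
    fderiv ℝ (fun z => fderiv ℝ v z I) z u = fderiv ℝ (fun z => fderiv ℝ v z 1) z u ⨯₃ v z
        + fderiv ℝ v z 1 ⨯₃ fderiv ℝ v z u := by
  ext k
  exact (hasLineDerivAt_apply (hv.differentiable_fderiv_apply I z) u k).unique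
    (hv.lineDeriv_rot z u k)

theorem dxx_dot (z : ℂ) : dxx v z ⬝ᵥ v z = -(fderiv ℝ v z 1 ⬝ᵥ fderiv ℝ v z 1) := by
  have h := hasDerivAt_dotProduct
    (hasLineDerivAt_apply (hv.differentiable_fderiv_apply 1 z) 1) (hv.lineDeriv z 1)
  simp only [hv.orth] at h
  have := h.unique (hasDerivAt_const _ _)
  simp at this
  unfold dxx
  linarith

/-- By symmetry `v_xy` is the `x`-derivative of `v_y = v_x × v`, in which the term `v_x × v_x` drops
out. -/
theorem dxy (z : ℂ) : fderiv ℝ (fun z => fderiv ℝ v z 1) z I = dxx v z ⨯₃ v z := by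
  rw [hv.fderiv_fderiv_apply, hv.fderiv_rot, cross_self, add_zero, dxx]

/-- This is the harmonic map equation `v_xx + v_yy = -2|v_x|²v`, which a conformal map to the sphere
satisfies. -/
theorem dyy (z : ℂ) (k : Fin 3) : fderiv ℝ (fun z => fderiv ℝ v z I) z I k =
    - dxx v z k - 2 * (fderiv ℝ v z 1 ⬝ᵥ fderiv ℝ v z 1) * v z k := by
  rw [hv.fderiv_rot, hv.dxy, hv.rot, Pi.add_apply,
    cross_fderiv_algebra (hv.unit z) (hv.orth z) (hv.dxx_dot z)]

theorem inverseDifferential_differentiable_real (k : Fin 3) :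
    Differentiable ℝ (fun z => inverseDifferential v z k) := by
  have h1 := fun z => differentiableAt_pi.1 (hv.differentiable_fderiv_apply 1 z)
  have h2 := fun z => differentiableAt_pi.1 (hv.differentiable_fderiv_apply I z)
  have hne : ∀ z, ((fderiv ℝ v z 1 ⬝ᵥ fderiv ℝ v z 1 : ℝ) : ℂ) ≠ 0 := fun z => by
    exact_mod_cast (hv.immersed z).ne'
  intro z
  unfold inverseDifferential
  refine DifferentiableAt.mul ?_ (DifferentiableAt.inv ?_ (hne z))
  · exact ((ofRealCLM.differentiableAt.comp z (h1 z k))).add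
      ((differentiableAt_const _).mul (ofRealCLM.differentiableAt.comp z (h2 z k)))
  · refine ofRealCLM.differentiableAt.comp z ?_
    exact DifferentiableAt.fun_sum (u := Finset.univ)
      (A := fun i z => fderiv ℝ v z 1 i * fderiv ℝ v z 1 i) fun i _ => (h1 z i).mul (h1 z i)

theorem fderiv_inverseDifferential (z u : ℂ) (k : Fin 3) :
    fderiv ℝ (fun z => inverseDifferential v z k) z u =
      (((fderiv ℝ (fun z => fderiv ℝ v z 1) z u k : ℂ)
        + I * (fderiv ℝ (fun z => fderiv ℝ v z I) z u k : ℂ)) *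
        ((fderiv ℝ v z 1 ⬝ᵥ fderiv ℝ v z 1 : ℝ) : ℂ) -
      ((fderiv ℝ v z 1 k : ℂ) + I * (fderiv ℝ v z I k : ℂ)) *
        ((2 * (fderiv ℝ v z 1 ⬝ᵥ fderiv ℝ (fun z => fderiv ℝ v z 1) z u) : ℝ) : ℂ)) /
        ((fderiv ℝ v z 1 ⬝ᵥ fderiv ℝ v z 1 : ℝ) : ℂ) ^ 2 := by
  have h1 := hasLineDerivAt_apply (hv.differentiable_fderiv_apply 1 z) u
  have h2 := hasLineDerivAt_apply (hv.differentiable_fderiv_apply I z) u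
  have h3 := hasDerivAt_dotProduct h1 h1
  have hne : ((fderiv ℝ v z 1 ⬝ᵥ fderiv ℝ v z 1 : ℝ) : ℂ) ≠ 0 := by
    exact_mod_cast (hv.immersed z).ne'
  have h4 := ((h1 k).ofReal_comp.add ((h2 k).ofReal_comp.const_mul I)).div h3.ofReal_comp
    (by simpa using hne)
  have h5 := ((hv.inverseDifferential_differentiable_real k z).hasFDerivAt.hasLineDerivAt u)
  refine (HasDerivAt.unique h5 h4).trans ?_
  simp only [zero_smul, add_zero, Pi.add_apply]
  rw [dotProduct_comm (fderiv ℝ (fun z => fderiv ℝ v z 1) z u), ← two_mul]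

/-- Read as a complex number, the `k`-th component is the gradient of `v_k` for the metric
`|v_x|²|dz|²`. Linear functions on the round sphere have conformal gradients, and conformal fields
in the plane are holomorphic. The proof checks the Cauchy–Riemann equation in the frame `v_x`,
`v_y`. -/
theorem inverseDifferential_differentiable (k : Fin 3) :
    Differentiable ℂ (fun z => inverseDifferential v z k) := by
  intro z
  refine differentiableAt_complex_iff_differentiableAt_real.2
    ⟨hv.inverseDifferential_differentiable_real k z, ?_⟩
  have hne : ((fderiv ℝ v z 1 ⬝ᵥ fderiv ℝ v z 1 : ℝ) : ℂ) ≠ 0 := by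
    exact_mod_cast (hv.immersed z).ne'
  obtain ⟨e1, e2⟩ := cauchyRiemann_algebra (hv.unit z) (hv.orth z) (hv.dxx_dot z) k
  have hdxx : fderiv ℝ (fun z => fderiv ℝ v z 1) z 1 = dxx v z := rfl
  rw [hv.fderiv_inverseDifferential, hv.fderiv_inverseDifferential, hv.dyy, hv.dxy, smul_eq_mul,
    hv.fderiv_rot z 1, cross_self, add_zero, hv.rot z, hdxx]
  generalize fderiv ℝ v z 1 ⬝ᵥ fderiv ℝ v z 1 = l at *
  generalize (fderiv ℝ v z 1 ⨯₃ v z) k = Yk at *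
  generalize (dxx v z ⨯₃ v z) k = HVk at *
  generalize fderiv ℝ v z 1 k = Xk at *
  generalize fderiv ℝ v z 1 ⬝ᵥ dxx v z ⨯₃ v z = m at *
  generalize fderiv ℝ v z 1 ⬝ᵥ dxx v z = n at *
  generalize dxx v z k = Hk at *
  generalize v z k = vk at *
  apply_fun ((↑) : ℝ → ℂ) at e1 e2
  push_cast at *
  rw [← mul_div_assoc]
  congr 1
  linear_combination (norm := (ring_nf; simp only [I_sq]; ring)) 2 * e1 - 2 * I * e2

end IsConformalParam

end

/-! ### The null curve `N` and its factorisation by spinors. -/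

section

open Complex Filter Topology

/-- With `Y = X ⨯₃ v` and `K = H ⨯₃ v` these are the real and imaginary parts of `(X + iY) × (H +
iK) = i|X|²(X + iY)`. -/
theorem cross_dxx_algebra {v X H : Fin 3 → ℝ} (h1 : v ⬝ᵥ v = 1) (h2 : X ⬝ᵥ v = 0)
    (h3 : H ⬝ᵥ v = -(X ⬝ᵥ X)) (k : Fin 3) :
    (X ⨯₃ H) k - ((X ⨯₃ v) ⨯₃ (H ⨯₃ v)) k = -(X ⬝ᵥ X) * (X ⨯₃ v) k ∧
    (X ⨯₃ (H ⨯₃ v)) k + ((X ⨯₃ v) ⨯₃ H) k = (X ⬝ᵥ X) * X k := by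
  simp only [dotProduct, Fin.sum_univ_three] at h1 h2 h3 ⊢
  simp only [cross_apply]
  fin_cases k <;> simp <;> constructor <;> grind

theorem rot_dot_algebra {v X : Fin 3 → ℝ} (h1 : v ⬝ᵥ v = 1) (h2 : X ⬝ᵥ v = 0) :
    (X ⨯₃ v) ⬝ᵥ (X ⨯₃ v) = X ⬝ᵥ X ∧ X ⬝ᵥ (X ⨯₃ v) = 0 := by
  simp only [dotProduct, Fin.sum_univ_three] at h1 h2 ⊢
  simp only [cross_apply]
  simp; constructor <;> grind

/-- With `Y = X ⨯₃ v` and `n = X + iY`, the numbers `X₀ + Y₁` and `Y₀ - X₁` are the real and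
imaginary parts of `n₀ - i n₁`. The four identities give the moduli of `n₀ ∓ i n₁` and the product
of `n₂` with the conjugate of `n₀ - i n₁`, that is, the stereographic position of `v`. -/
theorem stereographic_algebra {v X : Fin 3 → ℝ} (h1 : v ⬝ᵥ v = 1) (h2 : X ⬝ᵥ v = 0) :
    (X 0 + (X ⨯₃ v) 1) ^ 2 + ((X ⨯₃ v) 0 - X 1) ^ 2 = (X ⬝ᵥ X) * (1 - v 2) ^ 2 ∧
    (X 0 - (X ⨯₃ v) 1) ^ 2 + ((X ⨯₃ v) 0 + X 1) ^ 2 = (X ⬝ᵥ X) * (1 + v 2) ^ 2 ∧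
    X 2 * (X 0 + (X ⨯₃ v) 1) + (X ⨯₃ v) 2 * ((X ⨯₃ v) 0 - X 1)
      = (X ⬝ᵥ X) * (1 - v 2) * v 0 ∧
    (X ⨯₃ v) 2 * (X 0 + (X ⨯₃ v) 1) - X 2 * ((X ⨯₃ v) 0 - X 1)
      = (X ⬝ᵥ X) * (1 - v 2) * v 1 := by
  simp only [dotProduct, Fin.sum_univ_three] at h1 h2 ⊢
  simp only [cross_apply]
  simp; refine ⟨?_, ?_, ?_, ?_⟩ <;> grind

namespace IsConformalParam

variable {v : ℂ → Fin 3 → ℝ} (hv : IsConformalParam v)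

include hv

theorem deriv_inverseDifferential (z : ℂ) (k : Fin 3) :
    deriv (fun z => inverseDifferential v z k) z =
      (((dxx v z k : ℂ) + I * ((dxx v z ⨯₃ v z) k : ℂ)) *
        ((fderiv ℝ v z 1 ⬝ᵥ fderiv ℝ v z 1 : ℝ) : ℂ) -
      ((fderiv ℝ v z 1 k : ℂ) + I * (fderiv ℝ v z I k : ℂ)) *
        ((2 * (fderiv ℝ v z 1 ⬝ᵥ dxx v z) : ℝ) : ℂ)) /
        ((fderiv ℝ v z 1 ⬝ᵥ fderiv ℝ v z 1 : ℝ) : ℂ) ^ 2 := by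
  have hdxx : fderiv ℝ (fun z => fderiv ℝ v z 1) z 1 = dxx v z := rfl
  have h := (hv.inverseDifferential_differentiable k z).fderiv_restrictScalars ℝ
  have h' : deriv (fun z => inverseDifferential v z k) z
      = fderiv ℝ (fun z => inverseDifferential v z k) z 1 := by
    rw [h]; simp
  rw [h', hv.fderiv_inverseDifferential, hv.fderiv_rot z 1, cross_self, add_zero, hdxx]

/-- Differentiating the divisor `|v_x|²` only adds a multiple of `N` to `N'`, and this is lost in
the cross product; the rest is `cross_dxx_algebra`. The relation later normalises the Wronskian of
the spinor components. -/
theorem cross_deriv (z : ℂ) :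
    (fun k => inverseDifferential v z k) ⨯₃ (fun k => deriv (fun z => inverseDifferential v z k) z)
      = I • (fun k => inverseDifferential v z k) := by
  have hne : ((fderiv ℝ v z 1 ⬝ᵥ fderiv ℝ v z 1 : ℝ) : ℂ) ≠ 0 := by
    exact_mod_cast (hv.immersed z).ne'
  have e := fun k => cross_dxx_algebra (hv.unit z) (hv.orth z) (hv.dxx_dot z) k
  simp only [hv.deriv_inverseDifferential]
  simp only [inverseDifferential, hv.rot]
  generalize fderiv ℝ v z 1 ⬝ᵥ fderiv ℝ v z 1 = l at *
  generalize (fderiv ℝ v z 1 ⨯₃ v z) = Y at *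
  generalize (dxx v z ⨯₃ v z) = K at *
  generalize fderiv ℝ v z 1 = X at *
  generalize X ⬝ᵥ dxx v z = n at *
  generalize dxx v z = H at *
  have e0 := e 0
  have e1 := e 1
  have e2 := e 2
  simp only [cross_apply] at e0 e1 e2
  simp at e0 e1 e2
  obtain ⟨a0, b0⟩ := e0
  obtain ⟨a1, b1⟩ := e1
  obtain ⟨a2, b2⟩ := e2
  apply_fun ((↑) : ℝ → ℂ) at a0 b0 a1 b1 a2 b2
  push_cast at *
  simp only [cross_apply]
  ext k
  fin_cases k <;> simp <;> field_simp
  · linear_combination (norm := (ring_nf; simp only [I_sq]; ring)) l * a0 + I * l * b0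
  · linear_combination (norm := (ring_nf; simp only [I_sq]; ring)) l * a1 + I * l * b1
  · linear_combination (norm := (ring_nf; simp only [I_sq]; ring)) l * a2 + I * l * b2

/-- `v_x` and `v_y` are orthogonal and of equal length, so `v_x + i v_y` is a null vector of `ℂ³`.
-/
theorem sum_sq_inverseDifferential (z : ℂ) :
    inverseDifferential v z 0 ^ 2 + inverseDifferential v z 1 ^ 2
      + inverseDifferential v z 2 ^ 2 = 0 := by
  have hne : ((fderiv ℝ v z 1 ⬝ᵥ fderiv ℝ v z 1 : ℝ) : ℂ) ≠ 0 := by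
    exact_mod_cast (hv.immersed z).ne'
  obtain ⟨e1, e2⟩ := rot_dot_algebra (hv.unit z) (hv.orth z)
  simp only [inverseDifferential, hv.rot]
  rw [div_pow, div_pow, div_pow, ← add_div, ← add_div, div_eq_zero_iff]
  left
  simp only [dotProduct, Fin.sum_univ_three] at e1 e2
  apply_fun ((↑) : ℝ → ℂ) at e1 e2
  push_cast at *
  linear_combination (norm := (ring_nf; simp only [I_sq]; ring)) -e1 + 2 * I * e2

end IsConformalParam

theorem coeff_eq_zero {a b c d e : ℂ}
    (h : ∀ z, a + b * z + c * z ^ 2 + d * z ^ 3 + e * z ^ 4 = 0) :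
    a = 0 ∧ b = 0 ∧ c = 0 ∧ d = 0 ∧ e = 0 := by
  have h0 := h 0
  have h1 := h 1
  have h2 := h (-1)
  have h3 := h 2
  have h4 := h (-2)
  ring_nf at h0 h1 h2 h3 h4
  refine ⟨?_, ?_, ?_, ?_, ?_⟩ <;> grind

/-- Three quadratic polynomials `a`, `b`, `c` with `b² = ac`, `b'a - ba' = a` and `c'b - cb' = c`
are `P²`, `PQ`, `Q²` for affine functions `P`, `Q`. -/
theorem exists_spinor {a₀ a₁ a₂ b₀ b₁ b₂ c₀ c₁ c₂ : ℂ}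
    (hne : ¬ (a₀ = 0 ∧ a₁ = 0 ∧ a₂ = 0))
    (h : ∀ z : ℂ, (b₀ + b₁ * z + b₂ * z ^ 2) ^ 2
      = (a₀ + a₁ * z + a₂ * z ^ 2) * (c₀ + c₁ * z + c₂ * z ^ 2))
    (hab : ∀ z : ℂ, (b₁ + 2 * b₂ * z) * (a₀ + a₁ * z + a₂ * z ^ 2)
      - (b₀ + b₁ * z + b₂ * z ^ 2) * (a₁ + 2 * a₂ * z) = a₀ + a₁ * z + a₂ * z ^ 2) :
    ∃ p₀ p₁ q₀ q₁ : ℂ, ∀ z, (p₀ + p₁ * z) ^ 2 = a₀ + a₁ * z + a₂ * z ^ 2 ∧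
      (p₀ + p₁ * z) * (q₀ + q₁ * z) = b₀ + b₁ * z + b₂ * z ^ 2 ∧
      (q₀ + q₁ * z) ^ 2 = c₀ + c₁ * z + c₂ * z ^ 2 := by
  obtain ⟨e0, e1, e2, e3, e4⟩ := coeff_eq_zero (a := b₀ ^ 2 - a₀ * c₀)
    (b := 2 * b₀ * b₁ - a₀ * c₁ - a₁ * c₀)
    (c := b₁ ^ 2 + 2 * b₀ * b₂ - a₀ * c₂ - a₁ * c₁ - a₂ * c₀)
    (d := 2 * b₁ * b₂ - a₁ * c₂ - a₂ * c₁) (e := b₂ ^ 2 - a₂ * c₂)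
    (fun z => by linear_combination h z)
  obtain ⟨f0, f1, f2, -, -⟩ := coeff_eq_zero (a := b₁ * a₀ - b₀ * a₁ - a₀)
    (b := 2 * b₂ * a₀ - 2 * b₀ * a₂ - a₁) (c := b₂ * a₁ - b₁ * a₂ - a₂) (d := 0) (e := 0)
    (fun z => by linear_combination hab z)
  -- The polynomial `a` has no simple zero: `b` would vanish there too, since `b² = ac`, and then
  -- `b'a - ba'` would vanish to second order while `a` does not.
  have hdisc : a₁ ^ 2 = 4 * a₀ * a₂ := by grind
  suffices ∃ p₀ p₁ q₀ q₁ : ℂ, p₀ ^ 2 = a₀ ∧ 2 * p₀ * p₁ = a₁ ∧ p₁ ^ 2 = a₂ ∧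
      p₀ * q₀ = b₀ ∧ p₀ * q₁ + p₁ * q₀ = b₁ ∧ p₁ * q₁ = b₂ ∧
      q₀ ^ 2 = c₀ ∧ 2 * q₀ * q₁ = c₁ ∧ q₁ ^ 2 = c₂ by
    obtain ⟨p₀, p₁, q₀, q₁, h1, h2, h3, h4, h5, h6, h7, h8, h9⟩ := this
    refine ⟨p₀, p₁, q₀, q₁, fun z => ⟨?_, ?_, ?_⟩⟩
    · linear_combination h1 + z * h2 + z ^ 2 * h3
    · linear_combination h4 + z * h5 + z ^ 2 * h6
    · linear_combination h7 + z * h8 + z ^ 2 * h9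
  -- If `a₀ = 0`, then `a = a₂z²` and `P = pz` with `p² = a₂`; otherwise `P = p + (a₁/2p)z` with `p²
  -- = a₀`. In both cases `Q` comes from comparing coefficients in `PQ = b`.
  by_cases ha : a₀ = 0
  · have ha1 : a₁ = 0 := by grind
    have ha2 : a₂ ≠ 0 := by grind
    obtain ⟨p, hp⟩ := IsAlgClosed.exists_eq_mul_self a₂
    have hp0 : p ≠ 0 := by grind
    refine ⟨0, p, b₁ / p, b₂ / p, ?_, ?_, ?_, ?_, ?_, ?_, ?_, ?_, ?_⟩ <;> field_simp <;> grind
  · obtain ⟨p, hp⟩ := IsAlgClosed.exists_eq_mul_self a₀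
    have hp0 : p ≠ 0 := by grind
    refine ⟨p, a₁ / (2 * p), b₀ / p, (b₁ - a₁ / (2 * p) * (b₀ / p)) / p,
      ?_, ?_, ?_, ?_, ?_, ?_, ?_, ?_, ?_⟩ <;> field_simp <;> grind

end

/-! ### Liouville's theorem: the image is affine in the point of the sphere. -/

section

open Complex Filter Topology

/-- Inverse stereographic projection from the north pole. -/
def stereo (z : ℂ) : Fin 3 → ℝ :=
  ![2 * z.re / (1 + normSq z), 2 * z.im / (1 + normSq z), (normSq z - 1) / (1 + normSq z)]

theorem one_add_normSq_pos (z : ℂ) : 0 < 1 + normSq z := by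
  have := normSq_nonneg z
  linarith

/-- Divided by `1 + |z|²`, the functions `1`, `|z|²`, `Re z`, `Im z` span the same space as `1` and
the three coordinates of the sphere. -/
theorem exists_affine_stereo (α β γ δ : ℝ) : ∃ (m : ℝ) (a : Fin 3 → ℝ), ∀ z : ℂ,
    (α + β * normSq z + γ * z.re + δ * z.im) / (1 + normSq z) = m + a ⬝ᵥ stereo z := by
  refine ⟨(α + β) / 2, ![γ / 2, δ / 2, (β - α) / 2], fun z => ?_⟩
  have := (one_add_normSq_pos z).ne'
  simp [stereo, dotProduct, Fin.sum_univ_three]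
  field_simp
  ring

/-- The part of Liouville's theorem that expresses a conformal map through two affine functions. -/
theorem IsConformalParam.exists_affine_spinor {v : ℂ → Fin 3 → ℝ} (hv : IsConformalParam v)
    {g : ℂ → ℝ} (hg : ∀ z, 0 < g z) {C : ℝ} (hC : ∀ z, g z ≤ C)
    (hl : ∀ z, (fderiv ℝ v z 1 ⬝ᵥ fderiv ℝ v z 1) * (g z * (1 + normSq z)) ^ 2 = 4) :
    ∃ p₀ p₁ q₀ q₁ : ℂ, ∀ z,
      normSq (p₀ + p₁ * z) = g z * (1 + normSq z) * (1 - v z 2) / 2 ∧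
      normSq (q₀ + q₁ * z) = g z * (1 + normSq z) * (1 + v z 2) / 2 ∧
      (q₀ + q₁ * z) * (starRingEnd ℂ) (p₀ + p₁ * z)
        = ((g z * (1 + normSq z) / 2 : ℝ) : ℂ) * (v z 0 + I * v z 1) := by
  -- Since `v_x` and `v_y` have equal length, `|N_k|² ≤ 2/|v_x|²`, while `hl` says that `4/|v_x|²`
  -- is the square of `g(1 + |z|²)`.
  have hbound : ∀ k z, ‖inverseDifferential v z k‖ ≤ C * (1 + ‖z‖ ^ 2) := by
    intro k z
    have hpos := one_add_normSq_pos z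
    have h1 : ‖inverseDifferential v z k‖ ≤ g z * (1 + normSq z) := by
      refine abs_le_of_sq_le_sq' ?_ (mul_nonneg (hg z).le hpos.le) |>.2
      rw [← normSq_eq_norm_sq, inverseDifferential, normSq_div, normSq_ofReal, mul_comm I,
        normSq_add_mul_I]
      have hX := hv.immersed z
      have hl := hl z
      have hY : fderiv ℝ v z I ⬝ᵥ fderiv ℝ v z I = fderiv ℝ v z 1 ⬝ᵥ fderiv ℝ v z 1 := by
        rw [hv.rot]; exact (rot_dot_algebra (hv.unit z) (hv.orth z)).1
      have h3 : fderiv ℝ v z 1 k ^ 2 ≤ fderiv ℝ v z 1 ⬝ᵥ fderiv ℝ v z 1 := by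
        rw [sq]
        exact Finset.single_le_sum (f := fun i => fderiv ℝ v z 1 i * fderiv ℝ v z 1 i)
          (fun i _ => mul_self_nonneg _) (Finset.mem_univ k)
      have h4 : fderiv ℝ v z I k ^ 2 ≤ fderiv ℝ v z I ⬝ᵥ fderiv ℝ v z I := by
        rw [sq]
        exact Finset.single_le_sum (f := fun i => fderiv ℝ v z I i * fderiv ℝ v z I i)
          (fun i _ => mul_self_nonneg _) (Finset.mem_univ k)
      rw [hY] at h4
      generalize fderiv ℝ v z 1 ⬝ᵥ fderiv ℝ v z 1 = l at *
      rw [div_le_iff₀ (by positivity)]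
      calc _ ≤ l + l := add_le_add h3 h4
        _ ≤ 4 * l := by linarith
        _ = _ := by rw [← hl]; ring
    rw [← normSq_eq_norm_sq]
    exact h1.trans (mul_le_mul_of_nonneg_right (hC z) hpos.le)
  have hquad := fun k => exists_quadratic_of_entire (hv.inverseDifferential_differentiable k)
    (hbound k)
  choose c₀ c₁ c₂ hc using hquad
  have hderiv : ∀ k z, deriv (fun z => inverseDifferential v z k) z = c₁ k + 2 * c₂ k * z := by
    intro k z
    have : (fun z => inverseDifferential v z k) = fun z => c₀ k + c₁ k * z + c₂ k * z ^ 2 :=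
      funext (hc k)
    rw [this]
    refine HasDerivAt.deriv ?_
    have h := ((hasDerivAt_const z (c₀ k)).add ((hasDerivAt_id z).const_mul (c₁ k))).add
      ((hasDerivAt_pow 2 z).const_mul (c₂ k))
    refine h.congr_deriv ?_
    simp; ring
  have hpt : ∀ z,
      normSq (inverseDifferential v z 0 - I * inverseDifferential v z 1)
        = (g z * (1 + normSq z) * (1 - v z 2) / 2) ^ 2 ∧
      normSq (inverseDifferential v z 0 + I * inverseDifferential v z 1)
        = (g z * (1 + normSq z) * (1 + v z 2) / 2) ^ 2 ∧
      inverseDifferential v z 2 * (starRingEnd ℂ)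
        (inverseDifferential v z 0 - I * inverseDifferential v z 1)
        = (((g z * (1 + normSq z) / 2) ^ 2 * (1 - v z 2) : ℝ) : ℂ) * (v z 0 + I * v z 1) := by
    intro z
    have hX := hv.immersed z
    have hl := hl z
    obtain ⟨e1, e2, e3, e4⟩ := stereographic_algebra (hv.unit z) (hv.orth z)
    simp only [inverseDifferential, hv.rot]
    generalize fderiv ℝ v z 1 ⬝ᵥ fderiv ℝ v z 1 = l at *
    generalize (fderiv ℝ v z 1 ⨯₃ v z) = Y at *
    generalize fderiv ℝ v z 1 = X at *
    generalize g z * (1 + normSq z) = G at *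
    have hl' : (G / 2) ^ 2 = 1 / l := by field_simp; linarith
    refine ⟨?_, ?_, ?_⟩
    · have : ((X 0 : ℂ) + I * Y 0) / l - I * (((X 1 : ℂ) + I * Y 1) / l)
          = (((X 0 + Y 1 : ℝ) : ℂ) + ((Y 0 - X 1 : ℝ) : ℂ) * I) / (l : ℂ) := by
        push_cast
        ring_nf; simp only [I_sq]; ring
      rw [this, normSq_div, normSq_ofReal, normSq_add_mul_I, e1,
        show (G * (1 - v z 2) / 2) ^ 2 = (G / 2) ^ 2 * (1 - v z 2) ^ 2 by ring, hl']
      field_simp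
    · have : ((X 0 : ℂ) + I * Y 0) / l + I * (((X 1 : ℂ) + I * Y 1) / l)
          = (((X 0 - Y 1 : ℝ) : ℂ) + ((Y 0 + X 1 : ℝ) : ℂ) * I) / (l : ℂ) := by
        push_cast
        ring_nf; simp only [I_sq]; ring
      rw [this, normSq_div, normSq_ofReal, normSq_add_mul_I, e2,
        show (G * (1 + v z 2) / 2) ^ 2 = (G / 2) ^ 2 * (1 + v z 2) ^ 2 by ring, hl']
      field_simp
    · rw [hl']
      have hne : (l : ℂ) ≠ 0 := by exact_mod_cast hX.ne'
      apply_fun ((↑) : ℝ → ℂ) at e3 e4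
      push_cast at e3 e4
      simp only [map_sub, map_div₀, map_add, map_mul, conj_I, conj_ofReal]
      push_cast
      field_simp
      linear_combination (norm := (ring_nf; simp only [I_sq, I_pow_three]; ring)) e3 + I * e4
  have hsum := hv.sum_sq_inverseDifferential
  have hcross := hv.cross_deriv
  simp only [cross_apply, hderiv] at hcross
  simp only [hc] at hpt hsum hcross
  have hv2 : ∀ z, v z 2 ^ 2 ≤ 1 := by
    intro z
    have := hv.unit z
    simp only [dotProduct, Fin.sum_univ_three] at this
    nlinarith [mul_self_nonneg (v z 0), mul_self_nonneg (v z 1)]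
  -- Here `a = N₀ - iN₁`, `b = N₂`, `c = -(N₀ + iN₁)`. Then `b² = ac` is the nullity of `N`, and
  -- `b'a - ba' = a` combines the first two components of `N × N' = iN`.
  obtain ⟨p₀, p₁, q₀, q₁, hpq⟩ := exists_spinor (a₀ := c₀ 0 - I * c₀ 1) (a₁ := c₁ 0 - I * c₁ 1)
    (a₂ := c₂ 0 - I * c₂ 1) (b₀ := c₀ 2) (b₁ := c₁ 2) (b₂ := c₂ 2)
    (c₀ := -(c₀ 0 + I * c₀ 1)) (c₁ := -(c₁ 0 + I * c₁ 1)) (c₂ := -(c₂ 0 + I * c₂ 1))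
    (by
      -- If `a` vanished identically, `v` would stay at the north pole and nullity would give `N₂ =
      -- 0`; then `N × N' = iN` gives `N₀ = 0` at the origin, and so `N₁ = 0` there, against the
      -- modulus of `N₀ + iN₁`.
      rintro ⟨z0, z1, z2⟩
      have ha : ∀ z, v z 2 = 1 := by
        intro z
        have h := (hpt z).1
        rw [show c₀ 0 + c₁ 0 * z + c₂ 0 * z ^ 2 - I * (c₀ 1 + c₁ 1 * z + c₂ 1 * z ^ 2) = 0 by
          linear_combination z0 + z * z1 + z ^ 2 * z2, map_zero] at h
        have h := pow_eq_zero_iff (two_ne_zero) |>.1 h.symm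
        have := (mul_pos (hg z) (one_add_normSq_pos z)).ne'
        have h5 : g z * (1 + normSq z) * (1 - v z 2) = 0 := by linarith
        have := (mul_eq_zero.1 h5).resolve_left this
        linarith
      have hcc : ∀ z, c₀ 0 + c₁ 0 * z + c₂ 0 * z ^ 2 = I * (c₀ 1 + c₁ 1 * z + c₂ 1 * z ^ 2) := by
        intro z
        linear_combination z0 + z * z1 + z ^ 2 * z2
      have hb : ∀ z, c₀ 2 + c₁ 2 * z + c₂ 2 * z ^ 2 = 0 := by
        intro z
        have h := hsum z
        rw [hcc z] at h
        have : (c₀ 2 + c₁ 2 * z + c₂ 2 * z ^ 2) ^ 2 = 0 := by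
          linear_combination (norm := (ring_nf; simp only [I_sq]; ring)) h
        exact pow_eq_zero_iff (two_ne_zero) |>.1 this
      obtain ⟨k0, k1, k2, -, -⟩ := coeff_eq_zero (a := c₀ 2) (b := c₁ 2) (c := c₂ 2)
        (d := 0) (e := 0) (fun z => by linear_combination hb z)
      have hx := congrFun (hcross 0) 0
      simp [k0, k1, k2] at hx
      have hy := hcc 0
      simp only [mul_zero, add_zero, ne_eq, OfNat.ofNat_ne_zero, not_false_eq_true, zero_pow] at hy
      have hc1 : c₀ 1 = 0 := by
        have : I * c₀ 1 = 0 := by rw [← hy, hx]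
        simpa using this
      have h2 := (hpt 0).2.1
      simp [hx, hc1, ha] at h2
      have := pow_eq_zero_iff two_ne_zero |>.1 h2.symm
      exact (hg 0).ne' (by linarith))
    (fun z => by
      linear_combination (norm := (ring_nf; simp only [I_sq]; ring)) hsum z)
    (fun z => by
      have h0 := congrFun (hcross z) 0
      have h1 := congrFun (hcross z) 1
      simp at h0 h1
      linear_combination (norm := (ring_nf; simp only [I_sq]; ring)) -h1 - I * h0)
  refine ⟨p₀, p₁, q₀, q₁, fun z => ?_⟩
  obtain ⟨h1, h2, h3⟩ := hpq z
  obtain ⟨n1, n2, n3⟩ := hpt z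
  have hG : 0 < g z * (1 + normSq z) := mul_pos (hg z) (one_add_normSq_pos z)
  have hva := abs_le.1 ((sq_le_one_iff_abs_le_one _).1 (hv2 z))
  rw [show c₀ 0 + c₁ 0 * z + c₂ 0 * z ^ 2 - I * (c₀ 1 + c₁ 1 * z + c₂ 1 * z ^ 2)
    = (p₀ + p₁ * z) ^ 2 by rw [h1]; ring] at n1 n3
  rw [show c₀ 0 + c₁ 0 * z + c₂ 0 * z ^ 2 + I * (c₀ 1 + c₁ 1 * z + c₂ 1 * z ^ 2)
    = -(q₀ + q₁ * z) ^ 2 by rw [h3]; ring, normSq_neg] at n2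
  rw [← h2] at n3
  rw [map_pow] at n1 n2
  generalize p₀ + p₁ * z = P at *
  generalize q₀ + q₁ * z = Q at *
  generalize g z * (1 + normSq z) = G at *
  have k1 : normSq P = G * (1 - v z 2) / 2 :=
    (pow_left_inj₀ (normSq_nonneg _) (by nlinarith [hva.2]) two_ne_zero).1 n1
  have k2 : normSq Q = G * (1 + v z 2) / 2 :=
    (pow_left_inj₀ (normSq_nonneg _) (by nlinarith [hva.1]) two_ne_zero).1 n2
  refine ⟨k1, k2, ?_⟩
  -- `n3` is the required identity multiplied by `|P|²`. Where `P = 0` the point `v` is the north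
  -- pole and both sides vanish.
  by_cases hP : P = 0
  · have hv21 : v z 2 = 1 := by
      rw [hP, map_zero] at k1
      have : G * (1 - v z 2) = 0 := by linarith
      have := (mul_eq_zero.1 this).resolve_left hG.ne'
      linarith
    have hu := hv.unit z
    simp only [dotProduct, Fin.sum_univ_three, hv21] at hu
    have hv0 : v z 0 = 0 := by nlinarith
    have hv1 : v z 1 = 0 := by nlinarith
    simp [hP, hv0, hv1]
  · have hPP : P * (starRingEnd ℂ) P = ((G * (1 - v z 2) / 2 : ℝ) : ℂ) := by
      rw [mul_conj, k1]
    have hne : P * (starRingEnd ℂ) P ≠ 0 := mul_ne_zero hP (by simpa using hP)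
    refine mul_left_cancel₀ hne ?_
    rw [map_pow] at n3
    have hn : ((1 : ℂ) - v z 2) * G / 2 = P * (starRingEnd ℂ) P := by rw [hPP]; push_cast; ring
    push_cast at n3 ⊢
    linear_combination n3 + ((G : ℂ) / 2) * (v z 0 + I * v z 1) * hn

/-- The spinor gives `g = (|P|² + |Q|²)/(1 + |z|²)`, and the components of `gv` are `2 Re(QP̄)`, `2
Im(QP̄)` and `|Q|² - |P|²` over the same divisor. Each numerator is a combination of `1`, `|z|²`,
`Re z`, `Im z`, because `P` and `Q` are affine. -/
theorem IsConformalParam.exists_affine {v : ℂ → Fin 3 → ℝ} (hv : IsConformalParam v)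
    {g : ℂ → ℝ} (hg : ∀ z, 0 < g z) {C : ℝ} (hC : ∀ z, g z ≤ C)
    (hl : ∀ z, (fderiv ℝ v z 1 ⬝ᵥ fderiv ℝ v z 1) * (g z * (1 + normSq z)) ^ 2 = 4) :
    ∃ (b : ℝ) (w m : Fin 3 → ℝ) (M : Matrix (Fin 3) (Fin 3) ℝ), ∀ z,
      g z = b + w ⬝ᵥ stereo z ∧ g z • v z = m + M *ᵥ stereo z := by
  obtain ⟨p₀, p₁, q₀, q₁, h⟩ := hv.exists_affine_spinor hg hC hl
  have e : ∀ s t u x : ℂ, ∃ (b : ℝ) (w : Fin 3 → ℝ), ∀ z,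
      ((s + t * z) * (starRingEnd ℂ) (u + x * z)).re / (1 + normSq z) = b + w ⬝ᵥ stereo z := by
    intro s t u x
    obtain ⟨b, w, hb⟩ := exists_affine_stereo (s * (starRingEnd ℂ) u).re
      (t * (starRingEnd ℂ) x).re (t * (starRingEnd ℂ) u + s * (starRingEnd ℂ) x).re
      (I * t * (starRingEnd ℂ) u - I * s * (starRingEnd ℂ) x).re
    refine ⟨b, w, fun z => ?_⟩
    rw [← hb]
    congr 1
    simp [normSq_apply]
    ring
  obtain ⟨bp, wp, hp⟩ := e p₀ p₁ p₀ p₁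
  obtain ⟨bq, wq, hq⟩ := e q₀ q₁ q₀ q₁
  obtain ⟨b0, w0, h0⟩ := e (2 * q₀) (2 * q₁) p₀ p₁
  -- The factor `-I` turns the real part in `e` into an imaginary part.
  obtain ⟨b1, w1, h1⟩ := e (-I * (2 * q₀)) (-I * (2 * q₁)) p₀ p₁
  refine ⟨bp + bq, wp + wq, ![b0, b1, bq - bp], Matrix.of ![w0, w1, wq - wp], fun z => ?_⟩
  have hpos := (one_add_normSq_pos z).ne'
  obtain ⟨k1, k2, k3⟩ := h z
  have hp := hp z
  have hq := hq z
  have h0 := h0 z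
  have h1 := h1 z
  rw [mul_conj, ofReal_re, k1] at hp
  rw [mul_conj, ofReal_re, k2] at hq
  rw [show 2 * q₀ + 2 * q₁ * z = 2 * (q₀ + q₁ * z) by ring, mul_assoc, k3] at h0
  rw [show -I * (2 * q₀) + -I * (2 * q₁) * z = -I * (2 * (q₀ + q₁ * z)) by ring, mul_assoc,
    mul_assoc, k3] at h1
  simp at h0 h1
  constructor
  · rw [add_dotProduct]
    field_simp at hp hq ⊢
    linarith
  · ext k
    fin_cases k
    · simp
      rw [← h0]; field_simp
    · simp
      rw [← h1]; field_simp
    · simp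
      field_simp at hp hq
      linarith

end

/-! ### Boosts, and affine maps of the sphere into the light cone. -/

section

theorem dotProduct_self_nonneg' (w : Fin 3 → ℝ) : 0 ≤ w ⬝ᵥ w :=
  Finset.sum_nonneg fun i _ => mul_self_nonneg (w i)

theorem boostB_sq (w : Fin 3 → ℝ) : boostB w ^ 2 = 1 + w ⬝ᵥ w :=
  Real.sq_sqrt (by have := dotProduct_self_nonneg' w; linarith)

theorem boostB_pos (w : Fin 3 → ℝ) : 0 < boostB w :=
  Real.sqrt_pos.2 (by have := dotProduct_self_nonneg' w; linarith)

theorem dotProduct_self_eq (w : Fin 3 → ℝ) : w ⬝ᵥ w = boostB w ^ 2 - 1 := by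
  rw [boostB_sq]; ring

/-- The explicit inverse of `boostW`. -/
def boostWinv (w : Fin 3 → ℝ) : Matrix (Fin 3) (Fin 3) ℝ :=
  1 - (1 / (boostB w * (boostB w + 1))) • Matrix.vecMulVec w w

theorem boostW_transpose (w : Fin 3 → ℝ) : (boostW w)ᵀ = boostW w := by
  simp [boostW, Matrix.transpose_vecMulVec]

theorem boostWinv_transpose (w : Fin 3 → ℝ) : (boostWinv w)ᵀ = boostWinv w := by
  simp [boostWinv, Matrix.transpose_vecMulVec]

theorem boostW_mulVec (w x : Fin 3 → ℝ) :
    boostW w *ᵥ x = x + (w ⬝ᵥ x / (boostB w + 1)) • w := by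
  ext i
  simp [boostW, Matrix.add_mulVec, Matrix.smul_mulVec, Matrix.vecMulVec_mulVec]
  ring

theorem boostWinv_mulVec (w x : Fin 3 → ℝ) :
    boostWinv w *ᵥ x = x - (w ⬝ᵥ x / (boostB w * (boostB w + 1))) • w := by
  ext i
  have := (boostB_pos w).ne'
  simp [boostWinv, Matrix.sub_mulVec, Matrix.smul_mulVec, Matrix.vecMulVec_mulVec]
  field_simp

theorem boostW_mulVec_self (w : Fin 3 → ℝ) : boostW w *ᵥ w = boostB w • w := by
  have := boostB_pos w
  rw [boostW_mulVec, dotProduct_self_eq]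
  ext i
  simp
  field_simp
  ring

theorem boostW_mul_boostWinv (w : Fin 3 → ℝ) : boostW w * boostWinv w = 1 := by
  have := boostB_pos w
  refine Matrix.ext_iff_mulVec.2 fun x => ?_
  rw [← Matrix.mulVec_mulVec, Matrix.one_mulVec, boostWinv_mulVec, Matrix.mulVec_sub,
    Matrix.mulVec_smul, boostW_mulVec_self, boostW_mulVec]
  ext i
  simp
  field_simp
  ring

theorem boostW_inv (w : Fin 3 → ℝ) : (boostW w)⁻¹ = boostWinv w :=
  Matrix.inv_eq_right_inv (boostW_mul_boostWinv w)

theorem boostWinv_mul_boostW (w : Fin 3 → ℝ) : boostWinv w * boostW w = 1 :=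
  mul_eq_one_comm.1 (boostW_mul_boostWinv w)

theorem boostW_mul_self (w : Fin 3 → ℝ) : boostW w * boostW w = 1 + Matrix.vecMulVec w w := by
  have := boostB_pos w
  refine Matrix.ext_iff_mulVec.2 fun x => ?_
  rw [← Matrix.mulVec_mulVec, boostW_mulVec w x, Matrix.mulVec_add,
    Matrix.mulVec_smul, boostW_mulVec_self, boostW_mulVec]
  ext i
  simp [Matrix.add_mulVec, Matrix.vecMulVec_mulVec]
  field_simp
  ring

theorem boostW_det (w : Fin 3 → ℝ) : (boostW w).det = boostB w := by
  have := boostB_pos w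
  have h := boostB_sq w
  simp only [dotProduct, Fin.sum_univ_three] at h
  rw [Matrix.det_fin_three]
  simp [boostW, Matrix.vecMulVec_apply]
  field_simp
  grind

theorem dotProduct_cross_mulVec (M : Matrix (Fin 3) (Fin 3) ℝ) (x y z : Fin 3 → ℝ) :
    (M *ᵥ x) ⬝ᵥ ((M *ᵥ y) ⨯₃ (M *ᵥ z)) = M.det * (x ⬝ᵥ (y ⨯₃ z)) := by
  simp [Matrix.mulVec, dotProduct, cross_apply, Fin.sum_univ_three, Matrix.det_fin_three]
  ring

theorem abs_lt_boostB (w : Fin 3 → ℝ) (i : Fin 3) : |w i| < boostB w := by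
  refine abs_lt_of_sq_lt_sq ?_ (boostB_pos w).le
  rw [boostB_sq, sq]
  have := Finset.single_le_sum (f := fun i => w i * w i) (fun i _ => mul_self_nonneg _)
    (Finset.mem_univ i)
  simp only [dotProduct]
  linarith

theorem fFac_pos {w θ : Fin 3 → ℝ} (hθ : θ ⬝ᵥ θ = 1) : 0 < fFac w θ := by
  have h1 : |θ ⬝ᵥ w| < boostB w := by
    refine abs_lt_of_sq_lt_sq ?_ (boostB_pos w).le
    have : (θ ⬝ᵥ w) ^ 2 ≤ (θ ⬝ᵥ θ) * (w ⬝ᵥ w) := by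
      simp only [dotProduct, ← sq]
      exact Finset.sum_mul_sq_le_sq_mul_sq _ _ _
    rw [boostB_sq, hθ] at *
    linarith
  have := (abs_lt.1 h1).1
  unfold fFac
  linarith

/-- The two equations are the even and odd parts in `θ` of the null condition, obtained by comparing
`θ` with `-θ`. -/
theorem dotProduct_of_null {b : ℝ} {w m : Fin 3 → ℝ} {M : Matrix (Fin 3) (Fin 3) ℝ}
    (hnull : ∀ θ : Fin 3 → ℝ, θ ⬝ᵥ θ = 1 → (m + M *ᵥ θ) ⬝ᵥ (m + M *ᵥ θ) = (b + w ⬝ᵥ θ) ^ 2)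
    {θ : Fin 3 → ℝ} (hθ : θ ⬝ᵥ θ = 1) :
    m ⬝ᵥ m + (M *ᵥ θ) ⬝ᵥ (M *ᵥ θ) = b ^ 2 + (w ⬝ᵥ θ) ^ 2 ∧ m ⬝ᵥ (M *ᵥ θ) = b * (w ⬝ᵥ θ) := by
  have h1 := hnull θ hθ
  have h2 := hnull (-θ) (by simpa using hθ)
  rw [Matrix.mulVec_neg] at h2
  simp only [add_dotProduct, dotProduct_add, dotProduct_neg, neg_dotProduct,
    dotProduct_comm (M *ᵥ θ) m] at h1 h2
  constructor <;> linarith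

theorem gram_of_null {b : ℝ} {w m : Fin 3 → ℝ} {M : Matrix (Fin 3) (Fin 3) ℝ}
    (hnull : ∀ θ : Fin 3 → ℝ, θ ⬝ᵥ θ = 1 → (m + M *ᵥ θ) ⬝ᵥ (m + M *ᵥ θ) = (b + w ⬝ᵥ θ) ^ 2) :
    Mᵀ * M = (b ^ 2 - m ⬝ᵥ m) • (1 : Matrix (Fin 3) (Fin 3) ℝ) + Matrix.vecMulVec w w := by
  have h := fun x y z hx => (dotProduct_of_null hnull (θ := ![x, y, z]) hx).1
  have e0 := h 1 0 0 (by simp [dotProduct, Fin.sum_univ_three])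
  have e1 := h 0 1 0 (by simp [dotProduct, Fin.sum_univ_three])
  have e2 := h 0 0 1 (by simp [dotProduct, Fin.sum_univ_three])
  -- The basis vectors give the diagonal of the Gram matrix; the rational unit vectors built from 3,
  -- 4, 5 give its off-diagonal entries.
  have e3 := h (3/5) (4/5) 0 (by simp [dotProduct, Fin.sum_univ_three]; norm_num)
  have e4 := h (3/5) 0 (4/5) (by simp [dotProduct, Fin.sum_univ_three]; norm_num)
  have e5 := h 0 (3/5) (4/5) (by simp [dotProduct, Fin.sum_univ_three]; norm_num)
  clear h hnull
  generalize m ⬝ᵥ m = s at *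
  simp [Matrix.mulVec, dotProduct, Fin.sum_univ_three] at e0 e1 e2 e3 e4 e5
  ext i j
  fin_cases i <;> fin_cases j <;> simp [Matrix.mul_apply, Fin.sum_univ_three,
      Matrix.vecMulVec_apply] <;> linarith

theorem transpose_mulVec_of_null {b : ℝ} {w m : Fin 3 → ℝ} {M : Matrix (Fin 3) (Fin 3) ℝ}
    (hnull : ∀ θ : Fin 3 → ℝ, θ ⬝ᵥ θ = 1 → (m + M *ᵥ θ) ⬝ᵥ (m + M *ᵥ θ) = (b + w ⬝ᵥ θ) ^ 2) :
    Mᵀ *ᵥ m = b • w := by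
  have h := fun x y z hx => (dotProduct_of_null hnull (θ := ![x, y, z]) hx).2
  have e0 := h 1 0 0 (by simp [dotProduct, Fin.sum_univ_three])
  have e1 := h 0 1 0 (by simp [dotProduct, Fin.sum_univ_three])
  have e2 := h 0 0 1 (by simp [dotProduct, Fin.sum_univ_three])
  clear h hnull
  simp [Matrix.mulVec, dotProduct, Fin.sum_univ_three] at e0 e1 e2
  ext i
  fin_cases i <;> simp [Matrix.mulVec, dotProduct, Fin.sum_univ_three] <;> linarith

/-- An affine map that takes the sphere into the light cone and is infinitesimally isometric is a
boost followed by a rotation. -/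
theorem exists_boost_rotation {b : ℝ} {w m : Fin 3 → ℝ} {M : Matrix (Fin 3) (Fin 3) ℝ}
    (hpos : ∀ θ : Fin 3 → ℝ, θ ⬝ᵥ θ = 1 → 0 < b + w ⬝ᵥ θ)
    (hnull : ∀ θ : Fin 3 → ℝ, θ ⬝ᵥ θ = 1 → (m + M *ᵥ θ) ⬝ᵥ (m + M *ᵥ θ) = (b + w ⬝ᵥ θ) ^ 2)
    (hiso : (M *ᵥ ![1, 0, 0]) ⬝ᵥ (M *ᵥ ![1, 0, 0]) = w 0 ^ 2 + 1)
    (horient : (m + M *ᵥ ![0, 0, -1]) ⬝ᵥ ((M *ᵥ ![1, 0, 0]) ⨯₃ (M *ᵥ ![0, 1, 0])) < 0) :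
    b = boostB w ∧ M * (boostW w)⁻¹ ∈ Matrix.specialOrthogonalGroup (Fin 3) ℝ ∧
      m = (M * (boostW w)⁻¹) *ᵥ w := by
  have hbp := boostB_pos w
  have hmm : m ⬝ᵥ m = b ^ 2 - 1 := by
    have e0 := (dotProduct_of_null hnull (θ := ![1, 0, 0])
      (by simp [dotProduct, Fin.sum_univ_three])).1
    rw [hiso] at e0
    simp [dotProduct, Fin.sum_univ_three] at e0 ⊢
    linarith
  have hMM : Mᵀ * M = boostW w * boostW w := by
    rw [boostW_mul_self, gram_of_null hnull, hmm]
    simp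
  have hMm : Mᵀ *ᵥ m = b • w := transpose_mulVec_of_null hnull
  rw [boostW_inv]
  set R := M * boostWinv w with hR
  have hRW : M = R * boostW w := by
    rw [hR, mul_assoc, boostWinv_mul_boostW, mul_one]
  have hRR : Rᵀ * R = 1 := by
    rw [hR, Matrix.transpose_mul, boostWinv_transpose]
    calc boostWinv w * Mᵀ * (M * boostWinv w) = boostWinv w * (Mᵀ * M) * boostWinv w := by
          simp only [mul_assoc]
      _ = (boostWinv w * boostW w) * (boostW w * boostWinv w) := by
          rw [hMM]; simp only [mul_assoc]
      _ = 1 := by rw [boostWinv_mul_boostW, boostW_mul_boostWinv, one_mul]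
  have hm : m = (b / boostB w) • R *ᵥ w := by
    have h1 : Rᵀ *ᵥ m = (b / boostB w) • w := by
      have : Rᵀ = boostWinv w * Mᵀ := by rw [hR, Matrix.transpose_mul, boostWinv_transpose]
      rw [this, ← Matrix.mulVec_mulVec, hMm, Matrix.mulVec_smul, boostWinv_mulVec,
        dotProduct_self_eq]
      ext i
      simp
      field_simp
      ring
    rw [← Matrix.mulVec_smul, ← h1, Matrix.mulVec_mulVec, mul_eq_one_comm.1 hRR,
      Matrix.one_mulVec]
  have hRw : (R *ᵥ w) ⬝ᵥ (R *ᵥ w) = w ⬝ᵥ w := by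
    rw [Matrix.dotProduct_mulVec, Matrix.vecMul_mulVec, hRR, Matrix.vecMul_one]
  have hb0 : 0 < b := by
    have h1 := hpos ![1, 0, 0] (by simp [dotProduct, Fin.sum_univ_three])
    have h2 := hpos ![-1, 0, 0] (by simp [dotProduct, Fin.sum_univ_three])
    simp [dotProduct, Fin.sum_univ_three] at h1 h2
    linarith
  -- The length of `m` is computed twice: `b² - 1` from the null condition, and `(b/B)²(B² - 1)`
  -- with `B = boostB w` from `hm`.
  have hb : b = boostB w := by
    rw [hm] at hmm
    simp only [smul_dotProduct, dotProduct_smul, hRw, dotProduct_self_eq, smul_eq_mul] at hmm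
    field_simp at hmm
    have : b ^ 2 = boostB w ^ 2 := by linarith
    exact (pow_left_inj₀ hb0.le hbp.le two_ne_zero).1 this
  rw [hb, div_self hbp.ne', one_smul] at hm
  refine ⟨hb, ?_, hm⟩
  rw [Matrix.mem_specialOrthogonalGroup_iff, Matrix.mem_orthogonalGroup_iff']
  refine ⟨hRR, ?_⟩
  have hdet : R.det * R.det = 1 := by
    have := congrArg Matrix.det hRR
    simpa using this
  -- With `m` in the range of `M`, the triple product in `horient` becomes `det M` times an explicit
  -- factor, in all `det R · (w₂ - B)`. As `|w₂| < B`, its sign gives `det R > 0`.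
  have hw : m + M *ᵥ ![0, 0, -1] = M *ᵥ ((boostB w)⁻¹ • w + ![0, 0, -1]) := by
    have hMw : M *ᵥ w = boostB w • m := by
      conv_lhs => rw [hRW]
      rw [← Matrix.mulVec_mulVec, boostW_mulVec_self, Matrix.mulVec_smul, ← hm]
    rw [Matrix.mulVec_add, Matrix.mulVec_smul, hMw, smul_smul, inv_mul_cancel₀ hbp.ne', one_smul]
  rw [hw, dotProduct_cross_mulVec, hRW, Matrix.det_mul, boostW_det] at horient
  have hneg : ((boostB w)⁻¹ • w + ![0, 0, -1]) ⬝ᵥ (![1, 0, 0] ⨯₃ ![0, 1, 0])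
      = (boostB w)⁻¹ * (w 2 - boostB w) := by
    simp [cross_apply, dotProduct, Fin.sum_univ_three]
    field_simp
    ring
  rw [hneg, show R.det * boostB w * ((boostB w)⁻¹ * (w 2 - boostB w))
    = R.det * (w 2 - boostB w) by field_simp] at horient
  have := (abs_lt.1 (abs_lt_boostB w 2)).2
  have hdetpos : 0 < R.det := by nlinarith
  nlinarith

end

/-! ### The sphere and its stereographic parametrisation. -/

section

open Complex Filter Topology

theorem vec_dot_self (θ : S2) : vec θ ⬝ᵥ vec θ = 1 := by
  have h : ‖(θ : EuclideanSpace ℝ (Fin 3))‖ = 1 := by simp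
  have h2 := EuclideanSpace.real_norm_sq_eq (θ : EuclideanSpace ℝ (Fin 3))
  rw [h] at h2
  simp only [vec, dotProduct, ← sq]
  linarith

/-- The point of `S²` with given direction cosines. -/
def toS2 (x : Fin 3 → ℝ) (hx : x ⬝ᵥ x = 1) : S2 :=
  ⟨WithLp.toLp 2 x, by
    have h2 := EuclideanSpace.real_norm_sq_eq (WithLp.toLp 2 x)
    simp only [dotProduct, ← sq] at hx
    rw [mem_sphere_zero_iff_norm]
    exact (pow_left_inj₀ (norm_nonneg _) zero_le_one two_ne_zero).1 (by rw [h2, hx, one_pow])⟩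

@[simp] theorem vec_toS2 (x : Fin 3 → ℝ) (hx : x ⬝ᵥ x = 1) : vec (toS2 x hx) = x := rfl

theorem vec_injective : Function.Injective vec := fun _ _ h =>
  Subtype.ext (WithLp.ofLp_injective 2 h)

theorem fact_finrank : Fact (Module.finrank ℝ (EuclideanSpace ℝ (Fin 3)) = 2 + 1) :=
  ⟨finrank_euclideanSpace_fin⟩

theorem contMDiff_vec : ContMDiff (𝓡 2) 𝓘(ℝ, Fin 3 → ℝ) ∞ vec :=
  haveI := fact_finrank
  (PiLp.contDiff_ofLp (𝕜 := ℝ) (n := ∞) (p := 2)).contMDiff.comp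
    (contMDiff_coe_sphere (E := EuclideanSpace ℝ (Fin 3)))

theorem contMDiff_toS2 {E : Type*} [NormedAddCommGroup E] [NormedSpace ℝ E]
    {H : Type*} [TopologicalSpace H] {J : ModelWithCorners ℝ E H} {N : Type*} [TopologicalSpace N]
    [ChartedSpace H N] [IsManifold J ∞ N] {f : N → Fin 3 → ℝ} (hf : ContMDiff J 𝓘(ℝ, Fin 3 → ℝ) ∞ f)
    (h1 : ∀ x, f x ⬝ᵥ f x = 1) : ContMDiff J (𝓡 2) ∞ fun x => toS2 (f x) (h1 x) :=
  haveI := fact_finrank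
  ContMDiff.codRestrict_sphere (E := EuclideanSpace ℝ (Fin 3))
    ((PiLp.contDiff_toLp (𝕜 := ℝ) (n := ∞) (p := 2)).contMDiff.comp hf) _

theorem stereo_dot_self (z : ℂ) : stereo z ⬝ᵥ stereo z = 1 := by
  have := (one_add_normSq_pos z).ne'
  simp [stereo, dotProduct, Fin.sum_univ_three]
  field_simp
  simp [normSq_apply]
  ring

theorem contDiff_normSq : ContDiff ℝ ∞ normSq := by
  have : (normSq : ℂ → ℝ) = fun z => reCLM z * reCLM z + imCLM z * imCLM z := by
    ext z; simp [normSq_apply]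
  rw [this]
  fun_prop

theorem contDiff_stereo : ContDiff ℝ ∞ stereo := by
  have h1 : ContDiff ℝ ∞ (fun z : ℂ => 1 + normSq z) := contDiff_const.add contDiff_normSq
  have h2 : ∀ z : ℂ, 1 + normSq z ≠ 0 := fun z => (one_add_normSq_pos z).ne'
  rw [contDiff_pi]
  intro i
  fin_cases i
  · exact (contDiff_const.mul reCLM.contDiff).div h1 h2
  · exact (contDiff_const.mul imCLM.contDiff).div h1 h2
  · exact (contDiff_normSq.sub contDiff_const).div h1 h2

/-- Inverse stereographic projection as a map into `S²`. -/
def stereoS2 (z : ℂ) : S2 := toS2 (stereo z) (stereo_dot_self z)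

theorem contMDiff_stereoS2 : ContMDiff 𝓘(ℝ, ℂ) (𝓡 2) ∞ stereoS2 :=
  contMDiff_toS2 contDiff_stereo.contMDiff stereo_dot_self

theorem fderiv_stereo (z u : ℂ) : fderiv ℝ stereo z u =
    ![2 * (u.re * (1 + normSq z) - 2 * z.re * (z.re * u.re + z.im * u.im)) / (1 + normSq z) ^ 2,
      2 * (u.im * (1 + normSq z) - 2 * z.im * (z.re * u.re + z.im * u.im)) / (1 + normSq z) ^ 2,
      4 * (z.re * u.re + z.im * u.im) / (1 + normSq z) ^ 2] := by
  have hd : DifferentiableAt ℝ stereo z := contDiff_stereo.differentiable (by simp) z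
  have h2 := (one_add_normSq_pos z).ne'
  have hre : HasDerivAt (fun t : ℝ => (z + t • u).re) u.re 0 := by
    simpa using ((hasDerivAt_id (0 : ℝ)).mul_const u.re).const_add z.re
  have him : HasDerivAt (fun t : ℝ => (z + t • u).im) u.im 0 := by
    simpa using ((hasDerivAt_id (0 : ℝ)).mul_const u.im).const_add z.im
  have hn : HasDerivAt (fun t : ℝ => normSq (z + t • u)) (2 * (z.re * u.re + z.im * u.im)) 0 := by
    simp only [normSq_apply]
    refine ((hre.mul hre).add (him.mul him)).congr_deriv ?_
    simp; ring
  have h3 : HasDerivAt (fun t : ℝ => 1 + normSq (z + t • u)) (2 * (z.re * u.re + z.im * u.im)) 0 :=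
    hn.const_add 1
  have h2' : 1 + normSq (z + (0 : ℝ) • u) ≠ 0 := by simpa using h2
  ext k
  refine (hasLineDerivAt_apply hd u k).unique ?_
  fin_cases k
  · refine ((hre.const_mul 2).div h3 h2').congr_deriv ?_
    simp; ring
  · refine ((him.const_mul 2).div h3 h2').congr_deriv ?_
    simp; ring
  · refine ((hn.sub_const 1).div h3 h2').congr_deriv ?_
    simp; ring

theorem fderiv_stereo_dot (z : ℂ) :
    fderiv ℝ stereo z 1 ⬝ᵥ fderiv ℝ stereo z 1 = 4 / (1 + normSq z) ^ 2 ∧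
    fderiv ℝ stereo z I ⬝ᵥ fderiv ℝ stereo z I = 4 / (1 + normSq z) ^ 2 ∧
    fderiv ℝ stereo z 1 ⬝ᵥ fderiv ℝ stereo z I = 0 ∧
    0 < stereo z ⬝ᵥ (fderiv ℝ stereo z I ⨯₃ fderiv ℝ stereo z 1) := by
  have h2 := (one_add_normSq_pos z).ne'
  have h3 := one_add_normSq_pos z
  simp only [fderiv_stereo, stereo]
  refine ⟨?_, ?_, ?_, ?_⟩
  · simp [dotProduct, Fin.sum_univ_three]
    field_simp
    simp [normSq_apply]
    ring
  · simp [dotProduct, Fin.sum_univ_three]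
    field_simp
    simp [normSq_apply]
    ring
  · simp [dotProduct, Fin.sum_univ_three]
    field_simp
    rw [normSq_apply]
    ring
  · have : ∀ a : ℝ, a = 4 / (1 + normSq z) ^ 2 → 0 < a := fun a ha => by rw [ha]; positivity
    apply this
    simp [dotProduct, Fin.sum_univ_three, cross_apply]
    field_simp
    simp [normSq_apply]
    ring

/-- A tangent vector orthogonal to `X` and of the same length is `±(X ⨯₃ v)`, and the orientation
selects the sign. The equality is obtained from `|Y - X ⨯₃ v|² = 0`. -/
theorem eq_cross_of_orthogonal {v X Y : Fin 3 → ℝ} {l : ℝ} (h1 : v ⬝ᵥ v = 1) (h2 : X ⬝ᵥ v = 0)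
    (h3 : Y ⬝ᵥ v = 0) (hX : X ⬝ᵥ X = l) (hY : Y ⬝ᵥ Y = l) (hXY : X ⬝ᵥ Y = 0)
    (hl : 0 < l) (ho : 0 < v ⬝ᵥ (Y ⨯₃ X)) : Y = X ⨯₃ v := by
  have e1 : Y ⬝ᵥ (X ⨯₃ v) = v ⬝ᵥ (Y ⨯₃ X) := triple_product_permutation _ _ _ |>.symm
  have e2 : (X ⨯₃ v) ⬝ᵥ (X ⨯₃ v) = l := by rw [(rot_dot_algebra h1 h2).1, hX]
  have e3 : (Y ⬝ᵥ (X ⨯₃ v)) ^ 2 = l ^ 2 := by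
    simp only [dotProduct, Fin.sum_univ_three] at h1 h2 h3 hX hY hXY ⊢
    simp only [cross_apply]
    clear e1 e2 ho
    simp
    grind
  have e4 : Y ⬝ᵥ (X ⨯₃ v) = l := (pow_left_inj₀ (by rw [e1]; exact ho.le) hl.le two_ne_zero).1 e3
  have e5 : (Y - X ⨯₃ v) ⬝ᵥ (Y - X ⨯₃ v) = 0 := by
    simp only [sub_dotProduct, dotProduct_sub, hY, e2, e4, dotProduct_comm (X ⨯₃ v) Y]
    ring
  exact sub_eq_zero.1 (dotProduct_self_eq_zero.1 e5)

theorem exists_stereoS2 {θ : S2} (h : vec θ 2 ≠ 1) : ∃ z, stereoS2 z = θ := by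
  have hu := vec_dot_self θ
  simp only [dotProduct, Fin.sum_univ_three] at hu
  have h' : 1 - vec θ 2 ≠ 0 := fun h0 => h (by linarith)
  refine ⟨⟨vec θ 0 / (1 - vec θ 2), vec θ 1 / (1 - vec θ 2)⟩, vec_injective ?_⟩
  have hn : normSq ⟨vec θ 0 / (1 - vec θ 2), vec θ 1 / (1 - vec θ 2)⟩
      = (1 + vec θ 2) / (1 - vec θ 2) := by
    rw [normSq_mk]
    field_simp
    linear_combination hu
  have hs : 1 + (1 + vec θ 2) / (1 - vec θ 2) = 2 / (1 - vec θ 2) := by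
    field_simp; ring
  rw [stereoS2, vec_toS2, stereo, hn, hs]
  ext k
  fin_cases k
  · simp; field_simp
  · simp; field_simp
  · simp; field_simp; ring

/-- Two continuous functions on `S²` that agree on the image of the stereographic
parametrisation are equal. -/
theorem eq_of_eq_stereoS2 {F : Type*} [TopologicalSpace F] [T2Space F] {a b : S2 → F}
    (ha : Continuous a) (hb : Continuous b) (h : ∀ z, a (stereoS2 z) = b (stereoS2 z)) : a = b := by
  -- This curve on the sphere meets the omitted north pole only at `t = 0`, so continuity along it
  -- carries the equality to the pole.
  have hunit : ∀ t : ℝ, ![2 * t / (1 + t ^ 2), 0, (1 - t ^ 2) / (1 + t ^ 2)] ⬝ᵥ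
      ![2 * t / (1 + t ^ 2), 0, (1 - t ^ 2) / (1 + t ^ 2)] = 1 := by
    intro t
    have : 1 + t ^ 2 ≠ 0 := by positivity
    simp [dotProduct, Fin.sum_univ_three]
    field_simp
    ring
  have hsmooth : ContDiff ℝ ∞ fun t : ℝ =>
      ![2 * t / (1 + t ^ 2), 0, (1 - t ^ 2) / (1 + t ^ 2)] := by
    have hne : ∀ t : ℝ, 1 + t ^ 2 ≠ 0 := fun t => by positivity
    rw [contDiff_pi]
    intro i
    fin_cases i
    · exact (by fun_prop : ContDiff ℝ ∞ fun t : ℝ => 2 * t).div (by fun_prop) hne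
    · exact contDiff_const
    · exact (by fun_prop : ContDiff ℝ ∞ fun t : ℝ => 1 - t ^ 2).div (by fun_prop) hne
  have hc : Continuous fun t : ℝ => toS2 _ (hunit t) :=
    (contMDiff_toS2 hsmooth.contMDiff hunit).continuous
  have key : ∀ t, a (toS2 _ (hunit t)) = b (toS2 _ (hunit t)) := by
    refine congrFun (Continuous.ext_on (dense_compl_singleton (0 : ℝ)) (ha.comp hc) (hb.comp hc) ?_)
    intro t ht
    obtain ⟨z, hz⟩ := exists_stereoS2 (θ := toS2 _ (hunit t)) (by
      have : 1 + t ^ 2 ≠ 0 := by positivity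
      simp
      field_simp
      intro h0
      have : t ^ 2 = 0 := by linarith
      exact ht (by simpa using this))
    simp only [← hz, h]
  ext θ
  by_cases hθ : vec θ 2 = 1
  · have e := key 0
    have : toS2 _ (hunit 0) = θ := by
      apply vec_injective
      have hu := vec_dot_self θ
      simp only [dotProduct, Fin.sum_univ_three, hθ] at hu
      have h0 : vec θ 0 = 0 := by nlinarith
      have h1 : vec θ 1 = 0 := by nlinarith
      ext k
      fin_cases k <;> simp [h0, h1, hθ]
    rwa [this] at e
  · obtain ⟨z, rfl⟩ := exists_stereoS2 hθ
    exact h z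

end

/-! ### Quasi-spheres are boosts followed by rotations. -/

section

open Complex Filter Topology

theorem contMDiff_vec_snd {r : ℝ} {φ : S2 → ℝ × S2} (h : IsQuasiSphere r φ) :
    ContMDiff (𝓡 2) 𝓘(ℝ, Fin 3 → ℝ) ∞ fun x => vec (φ x).2 :=
  contMDiff_vec.comp (contMDiff_snd.comp h.embedding.contMDiff)

theorem fderiv_comp_stereoS2 {f : S2 → Fin 3 → ℝ} (hf : ContMDiff (𝓡 2) 𝓘(ℝ, Fin 3 → ℝ) ∞ f)
    (z u : ℂ) : fderiv ℝ (fun z => f (stereoS2 z)) z u =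
      mfderiv (𝓡 2) 𝓘(ℝ, Fin 3 → ℝ) f (stereoS2 z) (mfderiv 𝓘(ℝ, ℂ) (𝓡 2) stereoS2 z u) := by
  have h := mfderiv_comp_apply z ((hf.mdifferentiable (by simp)) (stereoS2 z))
    ((contMDiff_stereoS2.mdifferentiable (by simp)) z) u
  rw [← h, mfderiv_eq_fderiv]
  rfl

/-- The stereographic parametrisation of a quasi-sphere. -/
theorem IsQuasiSphere.isConformalParam {r : ℝ} (hr : 0 < r) {φ : S2 → ℝ × S2}
    (h : IsQuasiSphere r φ) :
    IsConformalParam (fun z => vec (φ (stereoS2 z)).2) ∧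
    ∀ z, (fderiv ℝ (fun z => vec (φ (stereoS2 z)).2) z 1
        ⬝ᵥ fderiv ℝ (fun z => vec (φ (stereoS2 z)).2) z 1)
      * ((φ (stereoS2 z)).1 / r * (1 + normSq z)) ^ 2 = 4 := by
  have hsm := contMDiff_vec_snd h
  set v : ℂ → Fin 3 → ℝ := fun z => vec (φ (stereoS2 z)).2 with hv
  have hcd : ContDiff ℝ ∞ v := contMDiff_iff_contDiff.1 (hsm.comp contMDiff_stereoS2)
  have hD : ∀ z u, fderiv ℝ v z u
      = dvec (fun x => (φ x).2) (stereoS2 z) (mfderiv 𝓘(ℝ, ℂ) (𝓡 2) stereoS2 z u) :=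
    fun z u => fderiv_comp_stereoS2 hsm z u
  have hS : ∀ z u, fderiv ℝ stereo z u
      = dvec id (stereoS2 z) (mfderiv 𝓘(ℝ, ℂ) (𝓡 2) stereoS2 z u) :=
    fun z u => fderiv_comp_stereoS2 contMDiff_vec z u
  have hiso : ∀ z u, (φ (stereoS2 z)).1 ^ 2 * (fderiv ℝ v z u ⬝ᵥ fderiv ℝ v z u)
      = r ^ 2 * (fderiv ℝ stereo z u ⬝ᵥ fderiv ℝ stereo z u) := fun z u => by
    rw [hD, hS]; exact h.isometric _ _
  have hunit : ∀ z, v z ⬝ᵥ v z = 1 := fun z => vec_dot_self _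
  have horth : ∀ z u, fderiv ℝ v z u ⬝ᵥ v z = 0 := by
    intro z u
    have hl := hasLineDerivAt_apply (hcd.differentiable (by simp) z) u
    have h1 := hasDerivAt_dotProduct hl hl
    simp only [hunit] at h1
    have h2 := h1.unique (hasDerivAt_const _ _)
    simp only [zero_smul, add_zero, dotProduct_comm (v z)] at h2
    linarith
  have hρ := fun z => h.radius_pos (stereoS2 z)
  have h11 : ∀ z, (fderiv ℝ v z 1 ⬝ᵥ fderiv ℝ v z 1)
      * ((φ (stereoS2 z)).1 / r * (1 + normSq z)) ^ 2 = 4 := by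
    intro z
    have := (one_add_normSq_pos z).ne'
    have e := hiso z 1
    rw [(fderiv_stereo_dot z).1] at e
    field_simp at e ⊢
    linarith
  have hII : ∀ z, fderiv ℝ v z I ⬝ᵥ fderiv ℝ v z I = fderiv ℝ v z 1 ⬝ᵥ fderiv ℝ v z 1 := by
    intro z
    have e := hiso z I
    rw [(fderiv_stereo_dot z).2.1, ← (fderiv_stereo_dot z).1, ← hiso] at e
    exact mul_left_cancel₀ (pow_pos (hρ z) 2).ne' e
  -- Polarisation: the isometry condition in the direction `1 + I` minus those in the directions `1`
  -- and `I`.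
  have h1I : ∀ z, fderiv ℝ v z 1 ⬝ᵥ fderiv ℝ v z I = 0 := by
    intro z
    have e := hiso z (1 + I)
    have e1 := hiso z 1
    have e2 := hiso z I
    simp only [map_add, add_dotProduct, dotProduct_add] at e
    rw [dotProduct_comm (fderiv ℝ stereo z I), (fderiv_stereo_dot z).2.2.1,
      dotProduct_comm (fderiv ℝ v z I)] at e
    have : (φ (stereoS2 z)).1 ^ 2 * (fderiv ℝ v z 1 ⬝ᵥ fderiv ℝ v z I) = 0 := by linarith
    exact (mul_eq_zero.1 this).resolve_left (pow_pos (hρ z) 2).ne'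
  have hpos : ∀ z, 0 < fderiv ℝ v z 1 ⬝ᵥ fderiv ℝ v z 1 := by
    intro z
    have e := h11 z
    by_contra hc
    have : 0 ≤ ((φ (stereoS2 z)).1 / r * (1 + normSq z)) ^ 2 := sq_nonneg _
    nlinarith
  refine ⟨⟨hcd, hunit, fun z => horth z 1, hpos, fun z => ?_⟩, h11⟩
  refine eq_cross_of_orthogonal (hunit z) (horth z 1) (horth z I) rfl (hII z) (h1I z) (hpos z) ?_
  -- The pair is taken in the order `I`, `1` because the stereographic coordinate reverses the
  -- orientation.
  have ho := h.orientation (stereoS2 z) (mfderiv 𝓘(ℝ, ℂ) (𝓡 2) stereoS2 z I)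
    (mfderiv 𝓘(ℝ, ℂ) (𝓡 2) stereoS2 z (1 : ℂ))
  rw [← hD, ← hD, ← hS, ← hS] at ho
  exact ho (fderiv_stereo_dot z).2.2.2

theorem dot_cross_cross_self {y X : Fin 3 → ℝ} (h1 : y ⬝ᵥ y = 1) (h2 : X ⬝ᵥ y = 0) :
    y ⬝ᵥ (X ⨯₃ (X ⨯₃ y)) = -(X ⬝ᵥ X) := by
  simp only [dotProduct, Fin.sum_univ_three] at h1 h2 ⊢
  simp [cross_apply]
  grind

/-- A quasi-sphere is a boost followed by a rotation. -/
theorem IsQuasiSphere.exists_boost_rotation {r : ℝ} (hr : 0 < r) {φ : S2 → ℝ × S2}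
    (h : IsQuasiSphere r φ) :
    ∃ (w : Fin 3 → ℝ) (R : Matrix (Fin 3) (Fin 3) ℝ),
      R ∈ Matrix.specialOrthogonalGroup (Fin 3) ℝ ∧
      ∀ θ, (φ θ).1 = r * fFac w (vec θ) ∧
        vec (φ θ).2 = (fFac w (vec θ))⁻¹ • (R *ᵥ (w + boostW w *ᵥ vec θ)) := by
  obtain ⟨hcp, hl⟩ := h.isConformalParam hr
  have hcont1 : Continuous fun θ => (φ θ).1 :=
    continuous_fst.comp h.embedding.contMDiff.continuous
  have hcontv : Continuous fun θ => vec (φ θ).2 := (contMDiff_vec_snd h).continuous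
  obtain ⟨C, hC⟩ : ∃ C, ∀ θ, (φ θ).1 / r ≤ C := by
    obtain ⟨C, hC⟩ := (isCompact_range (hcont1.div_const r)).bddAbove
    exact ⟨C, fun θ => hC ⟨θ, rfl⟩⟩
  have hgpos : ∀ θ, 0 < (φ θ).1 / r := fun θ => div_pos (h.radius_pos θ) hr
  obtain ⟨b, w, m, M, haff⟩ := hcp.exists_affine (g := fun z => (φ (stereoS2 z)).1 / r)
    (fun z => hgpos _) (fun z => hC _) hl
  have hf : ∀ θ, (φ θ).1 / r = b + w ⬝ᵥ vec θ := by
    refine congrFun (eq_of_eq_stereoS2 (hcont1.div_const r) ?_ fun z => (haff z).1)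
    exact continuous_const.add (Continuous.dotProduct continuous_const contMDiff_vec.continuous)
  have hfv : ∀ θ, ((φ θ).1 / r) • vec (φ θ).2 = m + M *ᵥ vec θ := by
    refine congrFun (eq_of_eq_stereoS2 ((hcont1.div_const r).smul hcontv) ?_ fun z => (haff z).2)
    exact continuous_const.add (Continuous.matrix_mulVec continuous_const contMDiff_vec.continuous)
  have hkey := NQS.exists_boost_rotation (b := b) (w := w) (m := m) (M := M)
    (fun θ hθ => by
      have h1 := hf (toS2 θ hθ)
      rw [vec_toS2] at h1
      rw [← h1]
      exact hgpos _)
    (fun θ hθ => by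
      have h1 := hf (toS2 θ hθ)
      have h2 := hfv (toS2 θ hθ)
      rw [vec_toS2] at h1 h2
      rw [← h1, ← h2, smul_dotProduct, dotProduct_smul, vec_dot_self]
      simp [sq])
  have hX : ∀ u : ℂ, fderiv ℝ stereo 0 u = ![2 * u.re, 2 * u.im, 0] := by
    intro u
    rw [fderiv_stereo]
    simp
  set v : ℂ → Fin 3 → ℝ := fun z => vec (φ (stereoS2 z)).2 with hv
  -- This is the product rule for `g v = m + M stereo` at `z = 0`, the south pole, where the
  -- derivatives of `stereo` are twice the first two basis vectors. It gives the lengths and the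
  -- orientation that the algebraic lemma asks for.
  have hd : ∀ u : ℂ, M *ᵥ fderiv ℝ stereo 0 u
      = (w ⬝ᵥ fderiv ℝ stereo 0 u) • v 0 + (b + w ⬝ᵥ stereo 0) • fderiv ℝ v 0 u := by
    intro u
    have hs := hasLineDerivAt_apply (contDiff_stereo.differentiable (by simp) 0) u
    have hvl := hcp.lineDeriv 0 u
    have hw : HasDerivAt (fun t : ℝ => b + w ⬝ᵥ stereo (0 + t • u))
        (w ⬝ᵥ fderiv ℝ stereo 0 u) 0 := by
      refine ((hasDerivAt_dotProduct (fun k => hasDerivAt_const _ (w k)) hs).const_add b).congr_deriv ?_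
      simp [dotProduct]
    ext k
    have h1 := hw.mul (hvl k)
    have h2 : HasDerivAt (fun t : ℝ => (m + M *ᵥ stereo (0 + t • u)) k)
        ((M *ᵥ fderiv ℝ stereo 0 u) k) 0 := by
      refine ((hasDerivAt_dotProduct (fun j => hasDerivAt_const _ (M k j)) hs).const_add
        (m k)).congr_deriv ?_
      simp [dotProduct, Matrix.mulVec]
    have e : (fun t : ℝ => (m + M *ᵥ stereo (0 + t • u)) k)
        = fun t : ℝ => (b + w ⬝ᵥ stereo (0 + t • u)) * v (0 + t • u) k := by
      ext t
      rw [← (haff _).2, ← (haff _).1]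
      rfl
    rw [e] at h2
    refine (h2.unique h1).trans ?_
    simp
  have hg0 : 0 < b + w ⬝ᵥ stereo 0 := by
    rw [← (haff 0).1]; exact hgpos _
  have hl0 : (fderiv ℝ v 0 1 ⬝ᵥ fderiv ℝ v 0 1) * (b + w ⬝ᵥ stereo 0) ^ 2 = 4 := by
    have := hl 0
    rw [(haff 0).1] at this
    simpa using this
  have hM0 : M *ᵥ ![1, 0, 0] = (1 / 2 : ℝ) • M *ᵥ fderiv ℝ stereo 0 1 := by
    rw [hX, ← Matrix.mulVec_smul]; simp
  have hM1 : M *ᵥ ![0, 1, 0] = (1 / 2 : ℝ) • M *ᵥ fderiv ℝ stereo 0 I := by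
    rw [hX, ← Matrix.mulVec_smul]; simp
  have hM2 : m + M *ᵥ ![0, 0, -1] = (b + w ⬝ᵥ stereo 0) • v 0 := by
    rw [← (haff 0).1, (haff 0).2]
    simp [stereo]
  have hunit := hcp.unit 0
  have horth := hcp.orth 0
  have hpos := hcp.immersed 0
  have hw0 : w ⬝ᵥ fderiv ℝ stereo 0 1 = 2 * w 0 := by
    rw [hX]; simp [dotProduct, Fin.sum_univ_three]; ring
  obtain ⟨hb, hR, hm⟩ := hkey
    (by
      rw [hM0, hd, hw0]
      simp only [smul_dotProduct, dotProduct_smul, add_dotProduct, dotProduct_add, hunit, horth,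
        dotProduct_comm (v 0) (fderiv ℝ v 0 1), smul_eq_mul]
      linear_combination (1 / 4) * hl0)
    (by
      rw [hM2, hM0, hM1, hd, hd, hcp.rot]
      generalize w ⬝ᵥ fderiv ℝ stereo 0 1 = c1
      generalize w ⬝ᵥ fderiv ℝ stereo 0 I = c2
      generalize b + w ⬝ᵥ stereo 0 = g at *
      generalize fderiv ℝ v 0 1 = X at *
      generalize v 0 = y at *
      have : (g • y) ⬝ᵥ (((1 / 2 : ℝ) • (c1 • y + g • X)) ⨯₃ ((1 / 2 : ℝ) • (c2 • y + g • X ⨯₃ y)))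
          = - (g ^ 3 * (X ⬝ᵥ X) / 4) := by
        have e := dot_cross_cross_self hunit horth
        simp only [map_smul, map_add, LinearMap.smul_apply, LinearMap.add_apply, dotProduct_smul,
          smul_dotProduct, dotProduct_add, cross_self, dotProduct_zero, dot_self_cross,
          dot_cross_self, e, smul_eq_mul]
        ring
      rw [this]
      have : 0 < g ^ 3 * (X ⬝ᵥ X) / 4 := by positivity
      linarith)
  refine ⟨w, M * (boostW w)⁻¹, hR, fun θ => ?_⟩
  have e1 : (φ θ).1 / r = fFac w (vec θ) := by
    rw [hf, fFac, hb, dotProduct_comm]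
  constructor
  · rw [← e1]; field_simp
  · have e2 := hfv θ
    rw [e1] at e2
    rw [Matrix.mulVec_add, ← hm, Matrix.mulVec_mulVec, mul_assoc, boostW_inv,
      boostWinv_mul_boostW, mul_one, ← e2, smul_smul, inv_mul_cancel₀, one_smul]
    exact (fFac_pos (vec_dot_self θ)).ne'

end

/-! ### The matrix `A` and the first variation of a boosted point. -/

section

/-- The explicit inverse of `matA`. -/
def matAinv (w θ : Fin 3 → ℝ) : Matrix (Fin 3) (Fin 3) ℝ :=
  1 + Matrix.vecMulVec (θ + (boostB w + 1)⁻¹ • w) w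

theorem matAinv_mulVec (w θ x : Fin 3 → ℝ) :
    matAinv w θ *ᵥ x = x + (w ⬝ᵥ x) • (θ + (boostB w + 1)⁻¹ • w) := by
  ext i
  simp [matAinv, Matrix.add_mulVec, Matrix.vecMulVec_mulVec]

theorem matA_mulVec (w θ x : Fin 3 → ℝ) :
    matA w θ *ᵥ x = x - ((fFac w θ)⁻¹ * (w ⬝ᵥ x)) • (θ + (boostB w + 1)⁻¹ • w) := by
  ext i
  simp [matA, Matrix.sub_mulVec, Matrix.smul_mulVec, Matrix.vecMulVec_mulVec]
  ring

theorem matA_inv {w θ : Fin 3 → ℝ} (hθ : θ ⬝ᵥ θ = 1) : (matA w θ)⁻¹ = matAinv w θ := by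
  refine Matrix.inv_eq_right_inv (Matrix.ext_iff_mulVec.2 fun x => ?_)
  have hb := (boostB_pos w).ne'
  have hb1 : boostB w + 1 ≠ 0 := by have := boostB_pos w; positivity
  have hf := (fFac_pos (w := w) hθ).ne'
  have hw : w ⬝ᵥ (θ + (boostB w + 1)⁻¹ • w) = fFac w θ - 1 := by
    rw [dotProduct_add, dotProduct_smul, dotProduct_self_eq, dotProduct_comm, fFac, smul_eq_mul]
    field_simp
    ring
  rw [← Matrix.mulVec_mulVec, matAinv_mulVec, matA_mulVec, dotProduct_add, dotProduct_smul, hw,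
    Matrix.one_mulVec, smul_eq_mul]
  ext i
  simp
  field_simp
  ring

theorem proj_mulVec (θ x : Fin 3 → ℝ) : proj θ *ᵥ x = x - (θ ⬝ᵥ x) • θ := by
  ext i
  simp [proj, Matrix.sub_mulVec, Matrix.vecMulVec_mulVec]

/-- `A⁻¹` is isometric from the tangent space at `ζ` to that at `θ`. -/
theorem matAinv_of_tangent {w θ x : Fin 3 → ℝ} (hθ : θ ⬝ᵥ θ = 1)
    (hx : (w + boostW w *ᵥ θ) ⬝ᵥ x = 0) :
    θ ⬝ᵥ (matAinv w θ *ᵥ x) = 0 ∧ w ⬝ᵥ (matAinv w θ *ᵥ x) = fFac w θ * (w ⬝ᵥ x) ∧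
      (matAinv w θ *ᵥ x) ⬝ᵥ (matAinv w θ *ᵥ x) = x ⬝ᵥ x := by
  have hb1 : boostB w + 1 ≠ 0 := by have := boostB_pos w; positivity
  have hww := dotProduct_self_eq w
  rw [boostW_mulVec] at hx
  simp only [matAinv_mulVec, fFac]
  simp only [add_dotProduct, dotProduct_add, smul_dotProduct, dotProduct_smul, smul_eq_mul, hθ,
    dotProduct_comm x, dotProduct_comm θ w, hww] at hx ⊢
  generalize w ⬝ᵥ x = c at *
  generalize w ⬝ᵥ θ = d at *
  generalize boostB w = b at *
  have e : θ ⬝ᵥ x = -(c + d / (b + 1) * c) := by linarith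
  rw [e]
  generalize x ⬝ᵥ x = k at *
  refine ⟨?_, ?_, ?_⟩
  · field_simp; ring
  · field_simp; ring
  · field_simp; ring

theorem skew_mulVec {S : Matrix (Fin 3) (Fin 3) ℝ} (hS : Sᵀ = -S) (x : Fin 3 → ℝ) :
    S *ᵥ x = x ⨯₃ starVec S := by
  have h : ∀ i j, S j i = - S i j := fun i j => by
    have := congrFun (congrFun hS i) j
    simpa using this
  have h0 : S 0 0 = 0 := by linarith [h 0 0]
  have h1 : S 1 1 = 0 := by linarith [h 1 1]
  have h2 : S 2 2 = 0 := by linarith [h 2 2]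
  ext i
  fin_cases i <;> simp [Matrix.mulVec, dotProduct, Fin.sum_univ_three, cross_apply, starVec,
    h0, h1, h2, h 0 1, h 0 2, h 1 2] <;> ring

/-- `RᵀR'` is recovered from `S`. -/
theorem skew_boost {w : Fin 3 → ℝ} {R R' : Matrix (Fin 3) (Fin 3) ℝ} (hR : Rᵀ * R = 1)
    (hR' : (Rᵀ * R')ᵀ = -(Rᵀ * R')) (x : Fin 3 → ℝ) :
    matS w R R' *ᵥ x = x ⨯₃ starVec (matS w R R') ∧
    (Rᵀ * R') *ᵥ (boostW w *ᵥ x) = boostWinv w *ᵥ (x ⨯₃ starVec (matS w R R')) := by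
  have hinv : R⁻¹ = Rᵀ := Matrix.inv_eq_left_inv hR
  have hS : matS w R R' = boostW w * (Rᵀ * R') * boostW w := by
    rw [matS, hinv]; simp only [mul_assoc]
  have hSk : (matS w R R')ᵀ = - matS w R R' := by
    rw [hS, Matrix.transpose_mul, Matrix.transpose_mul, hR', boostW_transpose]
    simp only [mul_neg, neg_mul, mul_assoc]
  have h1 := skew_mulVec hSk x
  refine ⟨h1, ?_⟩
  rw [← h1, hS, Matrix.mulVec_mulVec, Matrix.mulVec_mulVec, ← mul_assoc, ← mul_assoc,
    boostWinv_mul_boostW, one_mul]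

/-- The derivative of `f`. -/
def fFacDeriv (w w' θ τ : Fin 3 → ℝ) : ℝ := (w ⬝ᵥ w') / boostB w + (τ ⬝ᵥ w + θ ⬝ᵥ w')

/-- The derivative of `w + Wθ`. -/
def boostDeriv (w w' θ τ : Fin 3 → ℝ) : Fin 3 → ℝ :=
  w' + (τ + (((w' ⬝ᵥ θ + w ⬝ᵥ τ) * (boostB w + 1) - (w ⬝ᵥ θ) * ((w ⬝ᵥ w') / boostB w))
    / (boostB w + 1) ^ 2) • w + (w ⬝ᵥ θ / (boostB w + 1)) • w')

/-- The angular displacement `τ + Θt + θ × s`. -/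
def angularRate (w w' θ τ : Fin 3 → ℝ) (R R' : Matrix (Fin 3) (Fin 3) ℝ) : Fin 3 → ℝ :=
  τ + proj θ *ᵥ vecT w w' R R' + θ ⨯₃ vecS w w' R R'

/-- This identifies the image of the radial direction, so that the term from differentiating `f⁻¹`
in `ζ = f⁻¹R(w + Wθ)` can be cancelled. -/
theorem matAinv_mulVec_boost (w θ : Fin 3 → ℝ) :
    matAinv w θ *ᵥ (w + boostW w *ᵥ θ) = fFac w θ • (w + boostB w • θ) := by
  have hb1 : boostB w + 1 ≠ 0 := by have := boostB_pos w; positivity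
  have hww := dotProduct_self_eq w
  rw [matAinv_mulVec, boostW_mulVec, fFac]
  simp only [dotProduct_add, dotProduct_smul, hww, dotProduct_comm θ w, smul_eq_mul]
  ext i
  simp
  generalize w ⬝ᵥ θ = d at *
  generalize boostB w = b at *
  field_simp
  ring

/-- Writing `w + Wθ = W(b⁻¹w + θ)`, the rotational part becomes `W⁻¹((b⁻¹w + θ) × *S)`. After `A⁻¹`
everything splits into the angular rate and a multiple of `w + bθ`, which by `matAinv_mulVec_boost`
is radial. -/
theorem matAinv_mulVec_boostDeriv {w w' θ τ : Fin 3 → ℝ} {R R' : Matrix (Fin 3) (Fin 3) ℝ}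
    (hR : Rᵀ * R = 1) (hR' : (Rᵀ * R')ᵀ = -(Rᵀ * R')) :
    matAinv w θ *ᵥ ((Rᵀ * R') *ᵥ (w + boostW w *ᵥ θ) + boostDeriv w w' θ τ)
      = angularRate w w' θ τ R R' + fFacDeriv w w' θ τ • (w + boostB w • θ) := by
  have hb := (boostB_pos w).ne'
  have hb1 : boostB w + 1 ≠ 0 := by have := boostB_pos w; positivity
  have hww := dotProduct_self_eq w
  obtain ⟨hσ, -⟩ := skew_boost (w := w) hR hR' w
  have hN : w + boostW w *ᵥ θ = boostW w *ᵥ ((boostB w)⁻¹ • w + θ) := by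
    rw [Matrix.mulVec_add, Matrix.mulVec_smul, boostW_mulVec_self, smul_smul, inv_mul_cancel₀ hb,
      one_smul]
  rw [hN, (skew_boost hR hR' _).2, angularRate, proj_mulVec, vecT, vecS, hσ, boostW_inv]
  generalize starVec (matS w R R') = σ
  have hdot : θ ⬝ᵥ (w ⨯₃ σ) = - (w ⬝ᵥ (θ ⨯₃ σ)) := by
    simp [cross_apply, dotProduct, Fin.sum_univ_three]; ring
  have htriple : θ ⨯₃ (w' ⨯₃ w) = (w ⬝ᵥ θ) • w' - (w' ⬝ᵥ θ) • w := by
    ext i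
    fin_cases i <;> simp [cross_apply, dotProduct, Fin.sum_univ_three] <;> ring
  rw [matAinv_mulVec, boostWinv_mulVec, boostWinv_mulVec, boostDeriv, fFacDeriv]
  simp only [map_add, map_smul, LinearMap.add_apply, LinearMap.smul_apply, htriple, dotProduct_add,
    dotProduct_smul, dotProduct_sub, hww, smul_eq_mul, dot_self_cross, dotProduct_comm θ w,
    dotProduct_comm τ w, dotProduct_comm θ w', hdot]
  ext i
  simp only [Pi.add_apply, Pi.smul_apply, Pi.sub_apply, smul_eq_mul]
  generalize w ⬝ᵥ (θ ⨯₃ σ) = a1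
  generalize w ⬝ᵥ w' = a2
  generalize w ⬝ᵥ τ = a3
  generalize w' ⬝ᵥ θ = a4
  generalize w ⬝ᵥ θ = a5
  generalize (w ⨯₃ σ) i = a6
  generalize (θ ⨯₃ σ) i = a7
  generalize boostB w = b at *
  field_simp
  ring

/-- The change of `f` is separated into a part depending only on `t` and a part that sees the motion
only through the angular rate. The latter is what completing the square absorbs. -/
theorem fFacDeriv_eq {w w' θ τ : Fin 3 → ℝ} {R R' : Matrix (Fin 3) (Fin 3) ℝ}
    (hR : Rᵀ * R = 1) (hR' : (Rᵀ * R')ᵀ = -(Rᵀ * R')) :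
    fFacDeriv w w' θ τ = fFac w θ * (θ ⬝ᵥ vecT w w' R R') + w ⬝ᵥ angularRate w w' θ τ R R' := by
  have hb := (boostB_pos w).ne'
  have hb1 : boostB w + 1 ≠ 0 := by have := boostB_pos w; positivity
  have hww := dotProduct_self_eq w
  obtain ⟨hσ, -⟩ := skew_boost (w := w) hR hR' w
  rw [angularRate, proj_mulVec, vecT, vecS, hσ, boostW_inv]
  generalize starVec (matS w R R') = σ
  have hdot : θ ⬝ᵥ (w ⨯₃ σ) = - (w ⬝ᵥ (θ ⨯₃ σ)) := by
    simp [cross_apply, dotProduct, Fin.sum_univ_three]; ring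
  have htriple : θ ⨯₃ (w' ⨯₃ w) = (w ⬝ᵥ θ) • w' - (w' ⬝ᵥ θ) • w := by
    ext i
    fin_cases i <;> simp [cross_apply, dotProduct, Fin.sum_univ_three] <;> ring
  rw [boostWinv_mulVec, fFacDeriv, fFac]
  simp only [map_add, map_smul, htriple, dotProduct_add,
    dotProduct_smul, dotProduct_sub, hww, smul_eq_mul, dot_self_cross, dotProduct_comm θ w,
    dotProduct_comm τ w, dotProduct_comm θ w', hdot]
  generalize w ⬝ᵥ (θ ⨯₃ σ) = a1
  generalize w ⬝ᵥ w' = a2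
  generalize w ⬝ᵥ τ = a3
  generalize w' ⬝ᵥ θ = a4
  generalize w ⬝ᵥ θ = a5
  generalize boostB w = b at *
  field_simp
  ring

/-- The derivative of `ζ = f⁻¹R(w + Wθ)`. -/
def zetaDeriv (w w' θ τ : Fin 3 → ℝ) (R R' : Matrix (Fin 3) (Fin 3) ℝ) : Fin 3 → ℝ :=
  (fFac w θ)⁻¹ • (R' *ᵥ (w + boostW w *ᵥ θ) + R *ᵥ boostDeriv w w' θ τ)
    - (fFacDeriv w w' θ τ / fFac w θ ^ 2) • (R *ᵥ (w + boostW w *ᵥ θ))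

/-- Normalising by `f` subtracts `(df/f)(w + Wθ)`, whose image under `A⁻¹` is exactly the radial
term of `matAinv_mulVec_boostDeriv`. -/
theorem matAinv_mulVec_zetaDeriv {w w' θ τ : Fin 3 → ℝ} {R R' : Matrix (Fin 3) (Fin 3) ℝ}
    (hθ : θ ⬝ᵥ θ = 1) (hR : Rᵀ * R = 1) (hR' : (Rᵀ * R')ᵀ = -(Rᵀ * R')) :
    matAinv w θ *ᵥ (Rᵀ *ᵥ (fFac w θ • zetaDeriv w w' θ τ R R'))
      = angularRate w w' θ τ R R' := by
  have hf := (fFac_pos (w := w) hθ).ne'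
  have e : Rᵀ *ᵥ (fFac w θ • zetaDeriv w w' θ τ R R')
      = ((Rᵀ * R') *ᵥ (w + boostW w *ᵥ θ) + boostDeriv w w' θ τ)
        - (fFacDeriv w w' θ τ / fFac w θ) • (w + boostW w *ᵥ θ) := by
    rw [zetaDeriv, smul_sub, smul_smul, smul_smul, mul_inv_cancel₀ hf, one_smul, Matrix.mulVec_sub,
      Matrix.mulVec_smul, Matrix.mulVec_add, Matrix.mulVec_mulVec, Matrix.mulVec_mulVec,
      Matrix.mulVec_mulVec, hR, Matrix.one_mulVec, Matrix.one_mulVec]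
    congr 2
    field_simp
  rw [e, Matrix.mulVec_sub, Matrix.mulVec_smul, matAinv_mulVec_boostDeriv hR hR',
    matAinv_mulVec_boost, smul_smul, div_mul_cancel₀ _ hf, add_sub_cancel_right]

end

/-! ### The pullback at one point: completing the square. -/

section

theorem boost_dot_self {w θ : Fin 3 → ℝ} (hθ : θ ⬝ᵥ θ = 1) :
    (w + boostW w *ᵥ θ) ⬝ᵥ (w + boostW w *ᵥ θ) = fFac w θ ^ 2 := by
  have hb1 : boostB w + 1 ≠ 0 := by have := boostB_pos w; positivity
  have hww := dotProduct_self_eq w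
  rw [boostW_mulVec, fFac]
  simp only [dotProduct_add, add_dotProduct, smul_dotProduct, dotProduct_smul, hww, hθ,
    dotProduct_comm θ w, smul_eq_mul]
  field_simp
  ring

/-- Half the derivative of `|w + Wθ|² = f²`, for a variation `τ` that keeps `|θ| = 1` to first
order. -/
theorem boost_dot_boostDeriv {w w' θ τ : Fin 3 → ℝ} (hτ : θ ⬝ᵥ τ = 0) :
    (w + boostW w *ᵥ θ) ⬝ᵥ boostDeriv w w' θ τ = fFac w θ * fFacDeriv w w' θ τ := by
  have hb := (boostB_pos w).ne'
  have hb1 : boostB w + 1 ≠ 0 := by have := boostB_pos w; positivity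
  have hww := dotProduct_self_eq w
  rw [boostW_mulVec, boostDeriv, fFacDeriv, fFac]
  simp only [dotProduct_add, add_dotProduct, smul_dotProduct, dotProduct_smul, hww, hτ,
    dotProduct_comm θ w, dotProduct_comm τ w, dotProduct_comm θ w', smul_eq_mul]
  generalize w ⬝ᵥ w' = a2
  generalize w ⬝ᵥ τ = a3
  generalize w' ⬝ᵥ θ = a4
  generalize w ⬝ᵥ θ = a5
  generalize boostB w = b at *
  field_simp
  ring

theorem skew_dot {K : Matrix (Fin 3) (Fin 3) ℝ} (hK : Kᵀ = -K) (x : Fin 3 → ℝ) :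
    x ⬝ᵥ (K *ᵥ x) = 0 := by
  rw [skew_mulVec hK, dot_self_cross]

/-- The derivative of the unit vector `ζ` is orthogonal to `ζ`; the rotation is removed on both
sides and the positive factor `f⁻¹` is dropped. -/
theorem boost_dot_zetaDeriv {w w' θ τ : Fin 3 → ℝ} {R R' : Matrix (Fin 3) (Fin 3) ℝ}
    (hθ : θ ⬝ᵥ θ = 1) (hτ : θ ⬝ᵥ τ = 0) (hR : Rᵀ * R = 1) (hR' : (Rᵀ * R')ᵀ = -(Rᵀ * R')) :
    (w + boostW w *ᵥ θ) ⬝ᵥ (Rᵀ *ᵥ zetaDeriv w w' θ τ R R') = 0 := by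
  have hf := (fFac_pos (w := w) hθ).ne'
  rw [zetaDeriv, Matrix.mulVec_sub, Matrix.mulVec_smul, Matrix.mulVec_smul, Matrix.mulVec_add,
    Matrix.mulVec_mulVec, Matrix.mulVec_mulVec, Matrix.mulVec_mulVec, hR, Matrix.one_mulVec,
    Matrix.one_mulVec, dotProduct_sub, dotProduct_smul, dotProduct_smul, dotProduct_add,
    skew_dot hR', boost_dot_self hθ, boost_dot_boostDeriv hτ, smul_eq_mul, smul_eq_mul]
  field_simp
  ring

theorem matS_lin (w : Fin 3 → ℝ) (R R₀ R₁ : Matrix (Fin 3) (Fin 3) ℝ) (α β : ℝ) :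
    matS w R (α • R₀ + β • R₁) = α • matS w R R₀ + β • matS w R R₁ := by
  simp [matS, mul_add, add_mul]

theorem starVec_lin (S T : Matrix (Fin 3) (Fin 3) ℝ) (α β : ℝ) :
    starVec (α • S + β • T) = α • starVec S + β • starVec T := by
  ext i
  fin_cases i <;> simp [starVec] <;> ring

/-- Linearity in `(w', R')` turns the rates along `α∂_z + β∂_r` into combinations of `s₀`, `s₁`;
`vecT_lin` does the same for `t₀`, `t₁`. -/
theorem vecS_lin (w w₀ w₁ : Fin 3 → ℝ) (R R₀ R₁ : Matrix (Fin 3) (Fin 3) ℝ) (α β : ℝ) :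
    vecS w (α • w₀ + β • w₁) R (α • R₀ + β • R₁) = α • vecS w w₀ R R₀ + β • vecS w w₁ R R₁ := by
  rw [vecS, matS_lin, starVec_lin, vecS, vecS]
  simp only [map_add, map_smul, LinearMap.add_apply, LinearMap.smul_apply]
  module

theorem vecT_lin (w w₀ w₁ : Fin 3 → ℝ) (R R₀ R₁ : Matrix (Fin 3) (Fin 3) ℝ) (α β : ℝ) :
    vecT w (α • w₀ + β • w₁) R (α • R₀ + β • R₁) = α • vecT w w₀ R R₀ + β • vecT w w₁ R R₁ := by
  rw [vecT, matS_lin, vecT, vecT]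
  simp only [Matrix.add_mulVec, Matrix.smul_mulVec, Matrix.mulVec_add, Matrix.mulVec_smul]
  module

theorem dot_transpose_mulVec {R : Matrix (Fin 3) (Fin 3) ℝ} (hR : Rᵀ * R = 1) (x y : Fin 3 → ℝ) :
    (Rᵀ *ᵥ x) ⬝ᵥ (Rᵀ *ᵥ y) = x ⬝ᵥ y := by
  rw [Matrix.dotProduct_mulVec, Matrix.vecMul_transpose, Matrix.mulVec_mulVec,
    mul_eq_one_comm.1 hR, Matrix.one_mulVec]

theorem dot_proj {θ : Fin 3 → ℝ} (hθ : θ ⬝ᵥ θ = 1) (x : Fin 3 → ℝ) : θ ⬝ᵥ (proj θ *ᵥ x) = 0 := by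
  rw [proj_mulVec, dotProduct_sub, dotProduct_smul, hθ]
  simp

/-- The pointwise form of the pullback of the shear-free metric. -/
theorem pullback_form {w w₀ w₁ θ τ G : Fin 3 → ℝ} {R R₀ R₁ : Matrix (Fin 3) (Fin 3) ℝ}
    (hθ : θ ⬝ᵥ θ = 1) (hτ : θ ⬝ᵥ τ = 0) (hR : Rᵀ * R = 1)
    (hR₀ : (Rᵀ * R₀)ᵀ = -(Rᵀ * R₀)) (hR₁ : (Rᵀ * R₁)ᵀ = -(Rᵀ * R₁))
    (hG : (R *ᵥ (w + boostW w *ᵥ θ)) ⬝ᵥ G = 0) (α β r U V : ℝ) :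
    -2 * U * α * ((β * fFac w θ + r * fFacDeriv w (α • w₀ + β • w₁) θ τ) + V * α)
      + ((r * fFac w θ) • zetaDeriv w (α • w₀ + β • w₁) θ τ R (α • R₀ + β • R₁) + α • G)
        ⬝ᵥ ((r * fFac w θ) • zetaDeriv w (α • w₀ + β • w₁) θ τ R (α • R₀ + β • R₁) + α • G) =
    (r • τ + β • (r • (proj θ *ᵥ vecT w w₁ R R₁) + r • (θ ⨯₃ vecS w w₁ R R₁))
      + α • (r • (proj θ *ᵥ vecT w w₀ R R₀) + r • (θ ⨯₃ vecS w w₀ R R₀)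
        + matAinv w θ *ᵥ (Rᵀ *ᵥ G) - U • (proj θ *ᵥ w)))
      ⬝ᵥ (r • τ + β • (r • (proj θ *ᵥ vecT w w₁ R R₁) + r • (θ ⨯₃ vecS w w₁ R R₁))
      + α • (r • (proj θ *ᵥ vecT w w₀ R R₀) + r • (θ ⨯₃ vecS w w₀ R R₀)
        + matAinv w θ *ᵥ (Rᵀ *ᵥ G) - U • (proj θ *ᵥ w)))
    - 2 * (U * fFac w θ * (1 + r * (θ ⬝ᵥ vecT w w₁ R R₁))) * β * α
    - 2 * (U * (V + r * fFac w θ * (θ ⬝ᵥ vecT w w₀ R R₀)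
      + 1 / 2 * U * ((proj θ *ᵥ w) ⬝ᵥ (proj θ *ᵥ w))
      - fFac w θ * (w ⬝ᵥ (Rᵀ *ᵥ G)))) * α ^ 2 := by
  set w' := α • w₀ + β • w₁ with hw'
  set R' := α • R₀ + β • R₁ with hRR'
  have hR' : (Rᵀ * R')ᵀ = -(Rᵀ * R') := by
    rw [hRR', mul_add, mul_smul_comm, mul_smul_comm, Matrix.transpose_add, Matrix.transpose_smul,
      Matrix.transpose_smul, hR₀, hR₁]
    module
  set x := Rᵀ *ᵥ (fFac w θ • zetaDeriv w w' θ τ R R') with hx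
  have hxN : (w + boostW w *ᵥ θ) ⬝ᵥ x = 0 := by
    rw [hx, Matrix.mulVec_smul, dotProduct_smul, boost_dot_zetaDeriv hθ hτ hR hR', smul_zero]
  have hgN : (w + boostW w *ᵥ θ) ⬝ᵥ (Rᵀ *ᵥ G) = 0 := by
    rw [Matrix.dotProduct_mulVec, Matrix.vecMul_transpose, hG]
  have hη := matAinv_mulVec_zetaDeriv (w := w) (w' := w') (τ := τ) hθ hR hR'
  rw [← hx] at hη
  set η := angularRate w w' θ τ R R' with hηd
  have hηlin : η = τ + proj θ *ᵥ (α • vecT w w₀ R R₀ + β • vecT w w₁ R R₁)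
      + θ ⨯₃ (α • vecS w w₀ R R₀ + β • vecS w w₁ R R₁) := by
    rw [hηd, angularRate, hw', hRR', vecT_lin, vecS_lin]
  have hff := fFacDeriv_eq (w := w) (w' := w') (θ := θ) (τ := τ) hR hR'
  rw [← hηd] at hff
  have ht : vecT w w' R R' = α • vecT w w₀ R R₀ + β • vecT w w₁ R R₁ := by
    rw [hw', hRR', vecT_lin]
  rw [ht] at hff
  obtain ⟨k1, k2, -⟩ := matAinv_of_tangent hθ hgN
  have hxg : (w + boostW w *ᵥ θ) ⬝ᵥ (r • x + α • Rᵀ *ᵥ G) = 0 := by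
    rw [dotProduct_add, dotProduct_smul, dotProduct_smul, hxN, hgN]; simp
  obtain ⟨-, -, e3⟩ := matAinv_of_tangent hθ hxg
  -- Both summands are tangent at `ζ`, where `A⁻¹Rᵀ` preserves lengths.
  have hnorm : ((r * fFac w θ) • zetaDeriv w w' θ τ R R' + α • G)
      ⬝ᵥ ((r * fFac w θ) • zetaDeriv w w' θ τ R R' + α • G)
      = (r • η + α • matAinv w θ *ᵥ (Rᵀ *ᵥ G)) ⬝ᵥ (r • η + α • matAinv w θ *ᵥ (Rᵀ *ᵥ G)) := by
    have h1 : r • η + α • matAinv w θ *ᵥ (Rᵀ *ᵥ G) = matAinv w θ *ᵥ (r • x + α • Rᵀ *ᵥ G) := by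
      rw [Matrix.mulVec_add, Matrix.mulVec_smul, Matrix.mulVec_smul, hη]
    have h2 : r • x + α • Rᵀ *ᵥ G
        = Rᵀ *ᵥ ((r * fFac w θ) • zetaDeriv w w' θ τ R R' + α • G) := by
      rw [Matrix.mulVec_add, Matrix.mulVec_smul, Matrix.mulVec_smul, hx, Matrix.mulVec_smul,
        smul_smul]
    rw [h1, e3, h2, dot_transpose_mulVec hR]
  have hθη : θ ⬝ᵥ η = 0 := by
    rw [← hη]; exact (matAinv_of_tangent hθ hxN).1
  rw [hnorm, hff]
  have hvec : r • τ + β • (r • (proj θ *ᵥ vecT w w₁ R R₁) + r • (θ ⨯₃ vecS w w₁ R R₁))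
      + α • (r • (proj θ *ᵥ vecT w w₀ R R₀) + r • (θ ⨯₃ vecS w w₀ R R₀)
        + matAinv w θ *ᵥ (Rᵀ *ᵥ G) - U • (proj θ *ᵥ w))
      = (r • η + α • matAinv w θ *ᵥ (Rᵀ *ᵥ G)) - (α * U) • (proj θ *ᵥ w) := by
    rw [hηlin]
    simp only [Matrix.mulVec_add, Matrix.mulVec_smul, map_add, map_smul]
    module
  rw [hvec]
  generalize matAinv w θ *ᵥ (Rᵀ *ᵥ G) = κ at *
  -- The cross term of the completed square. Its part `r wᵀη` cancels the one in `dρ`; the part with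
  -- `G` and the square of `αUΘw` go into the coefficient of `α²`.
  have hZ : (r • η + α • κ) ⬝ᵥ (proj θ *ᵥ w)
      = r * (w ⬝ᵥ η) + α * (fFac w θ * (w ⬝ᵥ (Rᵀ *ᵥ G))) := by
    rw [proj_mulVec, dotProduct_sub, dotProduct_smul, dotProduct_comm _ θ, dotProduct_comm _ w]
    simp only [dotProduct_add, dotProduct_smul, hθη, k1, k2, smul_eq_mul]
    ring
  generalize hZ0 : r • η + α • κ = Z at *
  simp only [sub_dotProduct, dotProduct_sub, smul_dotProduct, dotProduct_smul, smul_eq_mul,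
    dotProduct_comm (proj θ *ᵥ w) Z, hZ, dotProduct_add]
  ring

end

/-! ### Derivatives along curves and partial derivatives. -/

section

open Filter Topology

section Curves

variable {w θ : ℝ → Fin 3 → ℝ} {w' θ' : Fin 3 → ℝ} {R : ℝ → Matrix (Fin 3) (Fin 3) ℝ}
  {R' : Matrix (Fin 3) (Fin 3) ℝ} {t : ℝ}

theorem hasDerivAt_boostB (hw : ∀ k, HasDerivAt (fun s => w s k) (w' k) t) :
    HasDerivAt (fun s => boostB (w s)) ((w t ⬝ᵥ w') / boostB (w t)) t := by
  have hb := boostB_pos (w t)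
  have h := ((hasDerivAt_dotProduct hw hw).const_add 1).sqrt (by
    have := dotProduct_self_nonneg' (w t); positivity)
  refine h.congr_deriv ?_
  rw [dotProduct_comm w' (w t), boostB]
  change _ / (2 * boostB (w t)) = _ / boostB (w t)
  field_simp
  ring

theorem hasDerivAt_fFac (hw : ∀ k, HasDerivAt (fun s => w s k) (w' k) t)
    (hθ : ∀ k, HasDerivAt (fun s => θ s k) (θ' k) t) :
    HasDerivAt (fun s => fFac (w s) (θ s)) (fFacDeriv (w t) w' (θ t) θ') t :=
  (hasDerivAt_boostB hw).add (hasDerivAt_dotProduct hθ hw)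

theorem hasDerivAt_boost (hw : ∀ k, HasDerivAt (fun s => w s k) (w' k) t)
    (hθ : ∀ k, HasDerivAt (fun s => θ s k) (θ' k) t) (k : Fin 3) :
    HasDerivAt (fun s => (w s + boostW (w s) *ᵥ θ s) k) (boostDeriv (w t) w' (θ t) θ' k) t := by
  have hb1 : boostB (w t) + 1 ≠ 0 := by have := boostB_pos (w t); positivity
  simp only [boostW_mulVec, Pi.add_apply, Pi.smul_apply, smul_eq_mul]
  refine ((hw k).add ((hθ k).add (((hasDerivAt_dotProduct hw hθ).div
    ((hasDerivAt_boostB hw).add_const 1) hb1).mul (hw k)))).congr_deriv ?_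
  simp [boostDeriv, add_assoc]

theorem hasDerivAt_mulVec {x : ℝ → Fin 3 → ℝ} {x' : Fin 3 → ℝ}
    (hR : ∀ i j, HasDerivAt (fun s => R s i j) (R' i j) t)
    (hx : ∀ k, HasDerivAt (fun s => x s k) (x' k) t) (k : Fin 3) :
    HasDerivAt (fun s => (R s *ᵥ x s) k) ((R' *ᵥ x t + R t *ᵥ x') k) t :=
  hasDerivAt_dotProduct (hR k) hx

theorem hasDerivAt_zeta (hw : ∀ k, HasDerivAt (fun s => w s k) (w' k) t)
    (hθ : ∀ k, HasDerivAt (fun s => θ s k) (θ' k) t)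
    (hR : ∀ i j, HasDerivAt (fun s => R s i j) (R' i j) t) (h1 : θ t ⬝ᵥ θ t = 1) (k : Fin 3) :
    HasDerivAt (fun s => ((fFac (w s) (θ s))⁻¹ • (R s *ᵥ (w s + boostW (w s) *ᵥ θ s))) k)
      (zetaDeriv (w t) w' (θ t) θ' (R t) R' k) t := by
  have hf := (fFac_pos (w := w t) h1).ne'
  refine (((hasDerivAt_fFac hw hθ).inv hf).mul
    (hasDerivAt_mulVec hR (hasDerivAt_boost hw hθ) k)).congr_deriv ?_
  simp [zetaDeriv]
  ring

/-- Differentiate `RᵀR = 1`, which needs to hold only near `t`. -/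
theorem transpose_mul_deriv_skew (hR : ∀ i j, HasDerivAt (fun s => R s i j) (R' i j) t)
    (h : ∀ᶠ s in 𝓝 t, (R s)ᵀ * R s = 1) :
    ((R t)ᵀ * R')ᵀ = -((R t)ᵀ * R') := by
  ext i j
  have h1 : HasDerivAt (fun s => ((R s)ᵀ * R s) i j)
      ((fun k => R' k i) ⬝ᵥ (fun k => R t k j) + (fun k => R t k i) ⬝ᵥ (fun k => R' k j)) t :=
    hasDerivAt_dotProduct (a := fun s k => R s k i) (b := fun s k => R s k j)
      (fun k => hR k i) (fun k => hR k j)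
  have h2 : HasDerivAt (fun s => ((R s)ᵀ * R s) i j) 0 t := by
    refine (hasDerivAt_const t ((1 : Matrix (Fin 3) (Fin 3) ℝ) i j)).congr_of_eventuallyEq ?_
    filter_upwards [h] with s hs
    rw [hs]
  have h3 := h1.unique h2
  simp only [Matrix.transpose_apply, Matrix.neg_apply, Matrix.mul_apply]
  simp only [dotProduct] at h3
  rw [show ∑ k, R t k j * R' k i = ∑ k, R' k i * R t k j from
    Finset.sum_congr rfl fun _ _ => mul_comm _ _]
  linarith

end Curves

section Partial

variable {w : ℝ × ℝ → Fin 3 → ℝ} {R : ℝ × ℝ → Matrix (Fin 3) (Fin 3) ℝ} {q : ℝ × ℝ}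

theorem fderiv_eq_partials {g : ℝ × ℝ → ℝ} (hg : DifferentiableAt ℝ g q) (d : ℝ × ℝ) :
    fderiv ℝ g q d = d.1 * deriv (fun z => g (z, q.2)) q.1 + d.2 * deriv (fun r => g (q.1, r)) q.2 := by
  have h1 : HasDerivAt (fun z => g (z, q.2)) (fderiv ℝ g q (1, 0)) q.1 :=
    HasFDerivAt.comp_hasDerivAt q.1 (f := fun z => (z, q.2)) hg.hasFDerivAt
      ((hasDerivAt_id _).prodMk (hasDerivAt_const _ _))
  have h2 : HasDerivAt (fun r => g (q.1, r)) (fderiv ℝ g q (0, 1)) q.2 :=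
    HasFDerivAt.comp_hasDerivAt q.2 (f := fun r => (q.1, r)) hg.hasFDerivAt
      ((hasDerivAt_const _ _).prodMk (hasDerivAt_id _))
  rw [h1.deriv, h2.deriv, ← smul_eq_mul, ← smul_eq_mul, ← map_smul, ← map_smul, ← map_add]
  congr 1
  ext <;> simp

theorem hasDerivAt_w_line (hw : DifferentiableAt ℝ w q) (d : ℝ × ℝ) (k : Fin 3) :
    HasDerivAt (fun s : ℝ => w (q + s • d) k) ((d.1 • wz w q + d.2 • wr w q) k) 0 := by
  have h := (differentiableAt_pi.1 hw k)
  refine (h.hasFDerivAt.hasLineDerivAt d).congr_deriv ?_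
  rw [fderiv_eq_partials h]
  rfl

theorem hasDerivAt_R_line (hR : ∀ i j, DifferentiableAt ℝ (fun q => R q i j) q) (d : ℝ × ℝ)
    (i j : Fin 3) :
    HasDerivAt (fun s : ℝ => R (q + s • d) i j) ((d.1 • Rz R q + d.2 • Rr R q) i j) 0 := by
  refine ((hR i j).hasFDerivAt.hasLineDerivAt d).congr_deriv ?_
  rw [fderiv_eq_partials (hR i j)]
  rfl

theorem skew_partials (hR : ∀ i j, DifferentiableAt ℝ (fun q => R q i j) q)
    (h : ∀ᶠ x in 𝓝 q, (R x)ᵀ * R x = 1) :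
    ((R q)ᵀ * Rz R q)ᵀ = -((R q)ᵀ * Rz R q) ∧ ((R q)ᵀ * Rr R q)ᵀ = -((R q)ᵀ * Rr R q) := by
  have key : ∀ d : ℝ × ℝ, ((R q)ᵀ * (d.1 • Rz R q + d.2 • Rr R q))ᵀ
      = -((R q)ᵀ * (d.1 • Rz R q + d.2 • Rr R q)) := by
    intro d
    have hc : Tendsto (fun s : ℝ => q + s • d) (𝓝 0) (𝓝 q) := by
      have : Continuous fun s : ℝ => q + s • d := by fun_prop
      simpa using this.tendsto 0
    have := transpose_mul_deriv_skew (R := fun s => R (q + s • d)) (hasDerivAt_R_line hR d)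
      (hc.eventually h)
    simpa using this
  constructor
  · simpa using key (1, 0)
  · simpa using key (0, 1)

theorem differentiableAt_fFac (hw : DifferentiableAt ℝ w q) (θ : Fin 3 → ℝ) :
    DifferentiableAt ℝ (fun y : (ℝ × ℝ) × (Fin 3 → ℝ) => fFac (w y.1) y.2) (q, θ) := by
  have hwk : ∀ k, DifferentiableAt ℝ (fun y : (ℝ × ℝ) × (Fin 3 → ℝ) => w y.1 k) (q, θ) :=
    fun k => DifferentiableAt.comp (g := fun q => w q k) (q, θ) (differentiableAt_pi.1 hw k)
      differentiableAt_fst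
  have hθk : ∀ k, DifferentiableAt ℝ (fun y : (ℝ × ℝ) × (Fin 3 → ℝ) => y.2 k) (q, θ) :=
    fun k => by fun_prop
  have h := dotProduct_self_nonneg' (w q)
  simp only [fFac, boostB, dotProduct, Fin.sum_univ_three] at h ⊢
  refine DifferentiableAt.add (DifferentiableAt.sqrt ?_ (by positivity)) ?_
  · fun_prop
  · fun_prop

theorem differentiableAt_boostB (hw : DifferentiableAt ℝ w q) (θ : Fin 3 → ℝ) :
    DifferentiableAt ℝ (fun y : (ℝ × ℝ) × (Fin 3 → ℝ) => boostB (w y.1)) (q, θ) := by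
  have hwk : ∀ k, DifferentiableAt ℝ (fun y : (ℝ × ℝ) × (Fin 3 → ℝ) => w y.1 k) (q, θ) :=
    fun k => DifferentiableAt.comp (g := fun q => w q k) (q, θ) (differentiableAt_pi.1 hw k)
      differentiableAt_fst
  have h := dotProduct_self_nonneg' (w q)
  simp only [boostB, dotProduct, Fin.sum_univ_three] at h ⊢
  refine (DifferentiableAt.sqrt ?_ (by positivity))
  fun_prop

theorem differentiableAt_zeta (hw : DifferentiableAt ℝ w q)
    (hR : ∀ i j, DifferentiableAt ℝ (fun q => R q i j) q) {θ : Fin 3 → ℝ} (hθ : θ ⬝ᵥ θ = 1) :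
    DifferentiableAt ℝ (fun y : (ℝ × ℝ) × (Fin 3 → ℝ) =>
      (fFac (w y.1) y.2)⁻¹ • (R y.1 *ᵥ (w y.1 + boostW (w y.1) *ᵥ y.2))) (q, θ) := by
  have hwk : ∀ k, DifferentiableAt ℝ (fun y : (ℝ × ℝ) × (Fin 3 → ℝ) => w y.1 k) (q, θ) :=
    fun k => DifferentiableAt.comp (g := fun q => w q k) (q, θ) (differentiableAt_pi.1 hw k)
      differentiableAt_fst
  have hRk : ∀ i j, DifferentiableAt ℝ (fun y : (ℝ × ℝ) × (Fin 3 → ℝ) => R y.1 i j) (q, θ) :=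
    fun i j => DifferentiableAt.comp (g := fun q => R q i j) (q, θ) (hR i j) differentiableAt_fst
  have hθk : ∀ k, DifferentiableAt ℝ (fun y : (ℝ × ℝ) × (Fin 3 → ℝ) => y.2 k) (q, θ) :=
    fun k => by fun_prop
  have hf := differentiableAt_fFac hw θ
  have hb := differentiableAt_boostB hw θ
  have hb1 : boostB (w q) + 1 ≠ 0 := by have := boostB_pos (w q); positivity
  have hb2 : DifferentiableAt ℝ (fun y : (ℝ × ℝ) × (Fin 3 → ℝ) => (boostB (w y.1) + 1)⁻¹) (q, θ) :=
    (hb.add_const 1).inv hb1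
  have hfi := hf.inv (fFac_pos (w := w q) hθ).ne'
  refine hfi.smul (differentiableAt_pi.2 fun k => ?_)
  simp only [boostW_mulVec, Matrix.mulVec, dotProduct, Fin.sum_univ_three, Pi.add_apply,
    Pi.smul_apply, smul_eq_mul, div_eq_mul_inv]
  fun_prop

end Partial

end

/-! ### Coordinate differentials and tangent vectors through the ambient space. -/

section

open Filter Topology

/-- `Pt` as a hypersurface in the vector space `(ℝ × ℝ) × ℝ³`. -/
def ambient (x : Pt) : (ℝ × ℝ) × (Fin 3 → ℝ) := (x.1, vec x.2)

theorem contMDiff_ambient : ContMDiff IPt 𝓘(ℝ, (ℝ × ℝ) × (Fin 3 → ℝ)) ∞ ambient :=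
  contMDiff_fst.prodMk_space (contMDiff_vec.comp contMDiff_snd)

theorem mdifferentiableAt_ambient (p : Pt) :
    MDifferentiableAt IPt 𝓘(ℝ, (ℝ × ℝ) × (Fin 3 → ℝ)) ambient p :=
  contMDiff_ambient.mdifferentiable (by simp) p

/-- The differential of the inclusion `ambient`. -/
def ambientDeriv (p : Pt) (ξ : TangentSpace IPt p) : (ℝ × ℝ) × (Fin 3 → ℝ) :=
  mfderiv IPt 𝓘(ℝ, (ℝ × ℝ) × (Fin 3 → ℝ)) ambient p ξ

theorem mfderiv_comp_ambient {F : Type*} [NormedAddCommGroup F] [NormedSpace ℝ F] {p : Pt}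
    {g : (ℝ × ℝ) × (Fin 3 → ℝ) → F} (hg : DifferentiableAt ℝ g (ambient p))
    (ξ : TangentSpace IPt p) :
    mfderiv IPt 𝓘(ℝ, F) (fun x => g (ambient x)) p ξ = fderiv ℝ g (ambient p) (ambientDeriv p ξ) := by
  have h := mfderiv_comp_apply p hg.mdifferentiableAt (mdifferentiableAt_ambient p) ξ
  rw [mfderiv_eq_fderiv] at h
  exact h

theorem dz_eq (p : Pt) (ξ : TangentSpace IPt p) : dz p ξ = (ambientDeriv p ξ).1.1 := by
  have h := mfderiv_comp_ambient (p := p) (g := fun y => y.1.1) (by fun_prop) ξ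
  refine h.trans ?_
  have : HasFDerivAt (fun y : (ℝ × ℝ) × (Fin 3 → ℝ) => y.1.1)
    ((ContinuousLinearMap.fst ℝ ℝ ℝ).comp (ContinuousLinearMap.fst ℝ (ℝ × ℝ) (Fin 3 → ℝ)))
    (ambient p) := hasFDerivAt_fst.comp _ hasFDerivAt_fst
  rw [this.fderiv]
  rfl

theorem dr_eq (p : Pt) (ξ : TangentSpace IPt p) : dr p ξ = (ambientDeriv p ξ).1.2 := by
  have h := mfderiv_comp_ambient (p := p) (g := fun y => y.1.2) (by fun_prop) ξ
  refine h.trans ?_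
  have : HasFDerivAt (fun y : (ℝ × ℝ) × (Fin 3 → ℝ) => y.1.2)
    ((ContinuousLinearMap.snd ℝ ℝ ℝ).comp (ContinuousLinearMap.fst ℝ (ℝ × ℝ) (Fin 3 → ℝ)))
    (ambient p) := hasFDerivAt_snd.comp _ hasFDerivAt_fst
  rw [this.fderiv]
  rfl

theorem dtheta_eq (p : Pt) (ξ : TangentSpace IPt p) : dtheta p ξ = (ambientDeriv p ξ).2 := by
  have h := mfderiv_comp_ambient (p := p) (g := fun y => y.2) (by fun_prop) ξ
  refine h.trans ?_
  rw [fderiv_snd]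
  rfl

theorem ambientDeriv_eq (p : Pt) (ξ : TangentSpace IPt p) :
    ambientDeriv p ξ = ((dz p ξ, dr p ξ), dtheta p ξ) := by
  rw [dz_eq, dr_eq, dtheta_eq]

theorem vec_dot_dtheta (p : Pt) (ξ : TangentSpace IPt p) : vec p.2 ⬝ᵥ dtheta p ξ = 0 := by
  have hd : DifferentiableAt ℝ (fun y : (ℝ × ℝ) × (Fin 3 → ℝ) => y.2 ⬝ᵥ y.2) (ambient p) := by
    simp only [dotProduct, Fin.sum_univ_three]
    fun_prop
  have h := mfderiv_comp_ambient hd ξ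
  have hc : (fun x : Pt => (ambient x).2 ⬝ᵥ (ambient x).2) = fun _ => (1 : ℝ) := by
    ext x; exact vec_dot_self x.2
  rw [hc, mfderiv_const] at h
  have hl := hd.hasFDerivAt.hasLineDerivAt (ambientDeriv p ξ)
  have hx : ∀ k, HasDerivAt (fun s : ℝ => (ambient p + s • ambientDeriv p ξ).2 k)
      (dtheta p ξ k) 0 := by
    intro k
    rw [dtheta_eq]
    simpa using ((hasDerivAt_id (0 : ℝ)).mul_const ((ambientDeriv p ξ).2 k)).const_add
      ((ambient p).2 k)
  have h2 := hasDerivAt_dotProduct hx hx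
  have h3 := hl.unique h2
  rw [← h] at h3
  simp only [zero_smul, add_zero, dotProduct_comm (dtheta p ξ)] at h3
  have h4 : (0 : ℝ) = (ambient p).2 ⬝ᵥ dtheta p ξ + (ambient p).2 ⬝ᵥ dtheta p ξ := h3
  change (ambient p).2 ⬝ᵥ dtheta p ξ = 0
  linarith

theorem mfderiv_vec_eq (θ : S2) (ξ : TangentSpace (𝓡 2) θ) :
    mfderiv (𝓡 2) 𝓘(ℝ, Fin 3 → ℝ) vec θ ξ
      = WithLp.ofLp (mfderiv (𝓡 2) 𝓘(ℝ, EuclideanSpace ℝ (Fin 3))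
        ((↑) : S2 → EuclideanSpace ℝ (Fin 3)) θ ξ) := by
  have := fact_finrank
  have hc : MDifferentiableAt (𝓡 2) 𝓘(ℝ, EuclideanSpace ℝ (Fin 3))
      ((↑) : S2 → EuclideanSpace ℝ (Fin 3)) θ :=
    (contMDiff_coe_sphere (E := EuclideanSpace ℝ (Fin 3)) (m := ∞)).mdifferentiable (by simp) θ
  have hd : DifferentiableAt ℝ (fun x : EuclideanSpace ℝ (Fin 3) => WithLp.ofLp x) θ :=
    (PiLp.contDiff_ofLp (𝕜 := ℝ) (n := ∞) (p := 2)).differentiable (by simp) _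
  have h := mfderiv_comp_apply θ hd.mdifferentiableAt hc ξ
  rw [mfderiv_eq_fderiv] at h
  refine h.trans ?_
  have h2 := (PiLp.continuousLinearEquiv 2 ℝ (fun _ : Fin 3 => ℝ)).hasFDerivAt
    (x := (θ : EuclideanSpace ℝ (Fin 3)))
  have h3 : HasFDerivAt (fun x : EuclideanSpace ℝ (Fin 3) => WithLp.ofLp x)
      (PiLp.continuousLinearEquiv 2 ℝ (fun _ : Fin 3 => ℝ) : _ →L[ℝ] _)
      (θ : EuclideanSpace ℝ (Fin 3)) := h2
  rw [h3.fderiv]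
  rfl

theorem mfderiv_vec_injective (θ : S2) :
    Function.Injective (mfderiv (𝓡 2) 𝓘(ℝ, Fin 3 → ℝ) vec θ) := by
  have := fact_finrank
  intro a b hab
  rw [mfderiv_vec_eq, mfderiv_vec_eq] at hab
  exact injective_mvfderiv_subtypeVal_sphere (E := EuclideanSpace ℝ (Fin 3)) (n := 2) θ
    (WithLp.ofLp_injective 2 hab)

theorem exists_mfderiv_vec (θ : S2) {τ : Fin 3 → ℝ} (hτ : vec θ ⬝ᵥ τ = 0) :
    ∃ ξ, mfderiv (𝓡 2) 𝓘(ℝ, Fin 3 → ℝ) vec θ ξ = τ := by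
  have := fact_finrank
  have hr := range_mvfderiv_subtypeVal (E := EuclideanSpace ℝ (Fin 3)) (n := 2) θ
  have hm : WithLp.toLp 2 τ ∈ (Submodule.span ℝ {(θ : EuclideanSpace ℝ (Fin 3))})ᗮ := by
    rw [Submodule.mem_orthogonal_singleton_iff_inner_right]
    rw [EuclideanSpace.inner_eq_star_dotProduct, dotProduct_comm]
    simp only [star_trivial]
    rwa [dotProduct_comm] at hτ ⊢
  rw [← hr] at hm
  obtain ⟨ξ, hξ⟩ := hm
  refine ⟨ξ, ?_⟩
  rw [mfderiv_vec_eq]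
  exact congrArg WithLp.ofLp hξ

theorem dtheta_apply (p : Pt) (ξ : TangentSpace IPt p) :
    dtheta p ξ = mfderiv (𝓡 2) 𝓘(ℝ, Fin 3 → ℝ) vec p.2 ξ.2 := by
  have h := mfderiv_comp_apply p (contMDiff_vec.mdifferentiable (by simp) p.2)
    (mdifferentiableAt_snd (I := 𝓘(ℝ, ℝ × ℝ)) (I' := 𝓡 2) (x := p)) ξ
  rw [mfderiv_snd] at h
  exact h

theorem dzdr_apply (p : Pt) (ξ : TangentSpace IPt p) : (dz p ξ, dr p ξ) = ξ.1 := by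
  have h1 : (ambientDeriv p ξ).1 = ξ.1 := by
    have h := mfderiv_comp_ambient (p := p) (g := fun y => y.1) (by fun_prop) ξ
    rw [fderiv_fst] at h
    refine Eq.trans (Eq.symm h) ?_
    change mfderiv IPt 𝓘(ℝ, ℝ × ℝ) Prod.fst p ξ = ξ.1
    rw [mfderiv_fst]
    rfl
  rw [dz_eq, dr_eq, ← h1]

theorem ambientDeriv_injective (p : Pt) {ξ : TangentSpace IPt p} (h1 : dz p ξ = 0)
    (h2 : dr p ξ = 0) (h3 : dtheta p ξ = 0) : ξ = 0 := by
  refine Prod.ext ?_ ?_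
  · rw [← dzdr_apply, h1, h2]; rfl
  · rw [dtheta_apply] at h3
    exact mfderiv_vec_injective p.2 (h3.trans (map_zero _).symm)

/-- With this surjectivity an identity between line elements can be tested on arbitrary values of
`dz`, `dr` and angular `dθ`, which is how the parameters are recovered. -/
theorem exists_tangent (p : Pt) (α β : ℝ) {τ : Fin 3 → ℝ} (hτ : vec p.2 ⬝ᵥ τ = 0) :
    ∃ ξ : TangentSpace IPt p, dz p ξ = α ∧ dr p ξ = β ∧ dtheta p ξ = τ := by
  obtain ⟨η, hη⟩ := exists_mfderiv_vec p.2 hτ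
  have h := dzdr_apply p ((α, β), η)
  refine ⟨((α, β), η), congrArg Prod.fst h, congrArg Prod.snd h, ?_⟩
  exact (dtheta_apply p ((α, β), η)).trans hη

end

/-! ### The differential of `Φ`, the pullback metric and its parameters. -/

section

open Filter Topology

theorem hasDerivAt_line_comp {F : Type*} [NormedAddCommGroup F] [NormedSpace ℝ F]
    {g : (ℝ × ℝ) × (Fin 3 → ℝ) → F} {y d : (ℝ × ℝ) × (Fin 3 → ℝ)}
    (hg : DifferentiableAt ℝ g y) {g' : F}
    (h : HasDerivAt (fun s : ℝ => g (y.1 + s • d.1, y.2 + s • d.2)) g' 0) :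
    fderiv ℝ g y d = g' :=
  (hg.hasFDerivAt.hasLineDerivAt d).unique h

theorem hasDerivAt_add_smul (θ τ : Fin 3 → ℝ) (k : Fin 3) :
    HasDerivAt (fun s : ℝ => (θ + s • τ) k) (τ k) 0 := by
  simpa using ((hasDerivAt_id (0 : ℝ)).mul_const (τ k)).const_add (θ k)

section

variable {Ω : Set (ℝ × ℝ)} {w : ℝ × ℝ → Fin 3 → ℝ} {R : ℝ × ℝ → Matrix (Fin 3) (Fin 3) ℝ}

theorem IsSmoothBoostRotation.differentiableAt_w (h : IsSmoothBoostRotation w R Ω) (hΩ : IsOpen Ω)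
    {q : ℝ × ℝ} (hq : q ∈ Ω) : DifferentiableAt ℝ w q :=
  (h.1.differentiableOn (by simp)).differentiableAt (hΩ.mem_nhds hq)

theorem IsSmoothBoostRotation.differentiableAt_R (h : IsSmoothBoostRotation w R Ω) (hΩ : IsOpen Ω)
    {q : ℝ × ℝ} (hq : q ∈ Ω) (i j : Fin 3) : DifferentiableAt ℝ (fun q => R q i j) q :=
  ((h.2.1 i j).differentiableOn (by simp)).differentiableAt (hΩ.mem_nhds hq)

theorem IsSmoothBoostRotation.orthogonal (h : IsSmoothBoostRotation w R Ω) {q : ℝ × ℝ}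
    (hq : q ∈ Ω) : (R q)ᵀ * R q = 1 := by
  have := (Matrix.mem_specialOrthogonalGroup_iff.1 (h.2.2 q hq)).1
  exact (Matrix.mem_orthogonalGroup_iff' _ _).1 this

theorem IsSmoothBoostRotation.skew (h : IsSmoothBoostRotation w R Ω) (hΩ : IsOpen Ω) {q : ℝ × ℝ}
    (hq : q ∈ Ω) :
    ((R q)ᵀ * Rz R q)ᵀ = -((R q)ᵀ * Rz R q) ∧ ((R q)ᵀ * Rr R q)ᵀ = -((R q)ᵀ * Rr R q) :=
  skew_partials (fun i j => h.differentiableAt_R hΩ hq i j) (by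
    filter_upwards [hΩ.mem_nhds hq] with x hx using h.orthogonal hx)

theorem IsSmoothBoostRotation.skew_comb (h : IsSmoothBoostRotation w R Ω) (hΩ : IsOpen Ω)
    {q : ℝ × ℝ} (hq : q ∈ Ω) (α β : ℝ) :
    ((R q)ᵀ * (α • Rz R q + β • Rr R q))ᵀ = -((R q)ᵀ * (α • Rz R q + β • Rr R q)) := by
  rw [mul_add, mul_smul_comm, mul_smul_comm, Matrix.transpose_add, Matrix.transpose_smul,
    Matrix.transpose_smul, (h.skew hΩ hq).1, (h.skew hΩ hq).2]
  module

variable {Φ : Pt → Pt}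

theorem mdifferentiableAt_of_contMDiffOn (hΩ : IsOpen Ω)
    (hΦ : ContMDiffOn IPt IPt ∞ Φ (Ω ×ˢ univ)) {p : Pt} (hp : p ∈ Ω ×ˢ (univ : Set S2)) :
    MDifferentiableAt IPt IPt Φ p :=
  (hΦ.contMDiffAt ((hΩ.prod isOpen_univ).mem_nhds hp)).mdifferentiableAt (by simp)

/-- It reduces the coordinate forms of `dΦ` to Fréchet derivatives of explicit formulas in `(q, θ)`
with `θ` free in `ℝ³`, which can then be computed along lines that leave the sphere. -/
theorem ambientDeriv_mfderiv {p : Pt} (hΦ : MDifferentiableAt IPt IPt Φ p)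
    {F : Type*} [NormedAddCommGroup F] [NormedSpace ℝ F]
    {k : Pt → F} (hk : MDifferentiableAt IPt 𝓘(ℝ, F) k (Φ p))
    {g : (ℝ × ℝ) × (Fin 3 → ℝ) → F} (hg : DifferentiableAt ℝ g (ambient p))
    (he : ∀ᶠ x in 𝓝 p, k (Φ x) = g (ambient x)) (ξ : TangentSpace IPt p) :
    mfderiv IPt 𝓘(ℝ, F) k (Φ p) (mfderiv IPt IPt Φ p ξ) = fderiv ℝ g (ambient p) (ambientDeriv p ξ) := by
  rw [← mfderiv_comp_ambient hg, ← mfderiv_comp_apply p hk hΦ ξ]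
  have : (k ∘ Φ) =ᶠ[𝓝 p] fun x => g (ambient x) := he
  rw [this.mfderiv_eq]
  rfl

theorem dz_mfderiv (hΩ : IsOpen Ω) (hΦ : ContMDiffOn IPt IPt ∞ Φ (Ω ×ˢ univ))
    (hd : IsDescribedBy w R Ω Φ) {p : Pt} (hp : p ∈ Ω ×ˢ (univ : Set S2))
    (ξ : TangentSpace IPt p) : dz (Φ p) (mfderiv IPt IPt Φ p ξ) = dz p ξ := by
  have hk : MDifferentiableAt IPt 𝓘(ℝ, ℝ) (fun x : Pt => x.1.1) (Φ p) :=
    (contDiff_fst.contMDiff.comp contMDiff_fst).mdifferentiable (n := ∞) (by simp) _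
  refine (ambientDeriv_mfderiv (mdifferentiableAt_of_contMDiffOn hΩ hΦ hp) hk
    (g := fun y => y.1.1) (by fun_prop) ?_ ξ).trans (mfderiv_comp_ambient (by fun_prop) ξ).symm
  filter_upwards [(hΩ.prod isOpen_univ).mem_nhds hp] with x hx
  rw [(hd x.1 hx.1 x.2).1]
  rfl

theorem dr_mfderiv (hΩ : IsOpen Ω) (hΦ : ContMDiffOn IPt IPt ∞ Φ (Ω ×ˢ univ))
    (hwR : IsSmoothBoostRotation w R Ω) (hd : IsDescribedBy w R Ω Φ) {p : Pt}
    (hp : p ∈ Ω ×ˢ (univ : Set S2)) (ξ : TangentSpace IPt p) :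
    dr (Φ p) (mfderiv IPt IPt Φ p ξ) = dr p ξ * fFac (w p.1) (vec p.2)
      + p.1.2 * fFacDeriv (w p.1) (dz p ξ • wz w p.1 + dr p ξ • wr w p.1) (vec p.2)
        (dtheta p ξ) := by
  have hk : MDifferentiableAt IPt 𝓘(ℝ, ℝ) (fun x : Pt => x.1.2) (Φ p) :=
    (contDiff_snd.contMDiff.comp contMDiff_fst).mdifferentiable (n := ∞) (by simp) _
  have hw := hwR.differentiableAt_w hΩ hp.1
  have hg : DifferentiableAt ℝ (fun y : (ℝ × ℝ) × (Fin 3 → ℝ) => y.1.2 * fFac (w y.1) y.2)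
      (ambient p) :=
    DifferentiableAt.mul (by fun_prop) (differentiableAt_fFac hw _)
  refine (ambientDeriv_mfderiv (mdifferentiableAt_of_contMDiffOn hΩ hΦ hp) hk hg ?_ ξ).trans ?_
  · filter_upwards [(hΩ.prod isOpen_univ).mem_nhds hp] with x hx
    rw [(hd x.1 hx.1 x.2).1]
    rfl
  · refine hasDerivAt_line_comp hg ?_
    rw [ambientDeriv_eq]
    have h1 := hasDerivAt_fFac (hasDerivAt_w_line hw (dz p ξ, dr p ξ))
      (hasDerivAt_add_smul (vec p.2) (dtheta p ξ))
    have h2 : HasDerivAt (fun s : ℝ => (p.1 + s • (dz p ξ, dr p ξ)).2) (dr p ξ) 0 := by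
      simpa using ((hasDerivAt_id (0 : ℝ)).mul_const (dr p ξ)).const_add p.1.2
    refine (h2.mul h1).congr_deriv ?_
    simp

theorem dtheta_mfderiv (hΩ : IsOpen Ω) (hΦ : ContMDiffOn IPt IPt ∞ Φ (Ω ×ˢ univ))
    (hwR : IsSmoothBoostRotation w R Ω) (hd : IsDescribedBy w R Ω Φ) {p : Pt}
    (hp : p ∈ Ω ×ˢ (univ : Set S2)) (ξ : TangentSpace IPt p) :
    dtheta (Φ p) (mfderiv IPt IPt Φ p ξ) =
      zetaDeriv (w p.1) (dz p ξ • wz w p.1 + dr p ξ • wr w p.1) (vec p.2)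
        (dtheta p ξ) (R p.1) (dz p ξ • Rz R p.1 + dr p ξ • Rr R p.1) := by
  have hk : MDifferentiableAt IPt 𝓘(ℝ, Fin 3 → ℝ) (fun x : Pt => vec x.2) (Φ p) :=
    (contMDiff_vec.comp contMDiff_snd).mdifferentiable (by simp) _
  have hw := hwR.differentiableAt_w hΩ hp.1
  have hR := hwR.differentiableAt_R hΩ hp.1
  have hg := differentiableAt_zeta hw hR (vec_dot_self p.2)
  refine (ambientDeriv_mfderiv (mdifferentiableAt_of_contMDiffOn hΩ hΦ hp) hk hg ?_ ξ).trans ?_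
  · filter_upwards [(hΩ.prod isOpen_univ).mem_nhds hp] with x hx
    exact (hd x.1 hx.1 x.2).2
  · refine hasDerivAt_line_comp hg ?_
    rw [ambientDeriv_eq]
    have h1 := hasDerivAt_zeta (hasDerivAt_w_line hw (dz p ξ, dr p ξ))
      (hasDerivAt_add_smul (vec p.2) (dtheta p ξ)) (hasDerivAt_R_line hR (dz p ξ, dr p ξ))
      (by simpa using vec_dot_self p.2)
    simp only [zero_smul, add_zero] at h1
    exact hasDerivAt_pi.2 h1

theorem gammaPar_eq (U : Pt → ℝ) (Γ : Pt → Fin 3 → ℝ) (p : Pt) :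
    gammaPar w R Φ U Γ p = p.1.2 • (proj (vec p.2) *ᵥ t0 w R p.1)
      + p.1.2 • (vec p.2 ⨯₃ s0 w R p.1)
      + matAinv (w p.1) (vec p.2) *ᵥ ((R p.1)ᵀ *ᵥ Γ (Φ p))
      - U (Φ p) • (proj (vec p.2) *ᵥ w p.1) := by
  rw [gammaPar, matA_inv (vec_dot_self p.2)]

theorem image_dot_Gamma {D : Set Pt} {U : Pt → ℝ} {Γ : Pt → Fin 3 → ℝ}
    (hSF : IsShearFreeNQS D U Γ) (hΦD : MapsTo Φ (Ω ×ˢ univ) D) (hd : IsDescribedBy w R Ω Φ)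
    {p : Pt} (hp : p ∈ Ω ×ˢ (univ : Set S2)) :
    (R p.1 *ᵥ (w p.1 + boostW (w p.1) *ᵥ vec p.2)) ⬝ᵥ Γ (Φ p) = 0 := by
  have h := hSF.angular _ (hΦD hp)
  rw [(hd p.1 hp.1 p.2).2, smul_dotProduct, smul_eq_mul] at h
  exact (mul_eq_zero.1 h).resolve_left (inv_ne_zero (fFac_pos (vec_dot_self p.2)).ne')

theorem vec_dot_betaPar (p : Pt) : vec p.2 ⬝ᵥ betaPar w R p = 0 := by
  rw [betaPar, dotProduct_add, dotProduct_smul, dotProduct_smul, dot_proj (vec_dot_self p.2),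
    dot_self_cross]
  simp

theorem vec_dot_gammaPar {D : Set Pt} {U : Pt → ℝ} {Γ : Pt → Fin 3 → ℝ}
    (hSF : IsShearFreeNQS D U Γ) (hΦD : MapsTo Φ (Ω ×ˢ univ) D) (hd : IsDescribedBy w R Ω Φ)
    {p : Pt} (hp : p ∈ Ω ×ˢ (univ : Set S2)) : vec p.2 ⬝ᵥ gammaPar w R Φ U Γ p = 0 := by
  have hG : (w p.1 + boostW (w p.1) *ᵥ vec p.2) ⬝ᵥ ((R p.1)ᵀ *ᵥ Γ (Φ p)) = 0 := by
    rw [Matrix.dotProduct_mulVec, Matrix.vecMul_transpose, image_dot_Gamma hSF hΦD hd hp]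
  rw [gammaPar_eq, dotProduct_sub, dotProduct_add, dotProduct_add, dotProduct_smul,
    dotProduct_smul, dotProduct_smul, dot_proj (vec_dot_self p.2), dot_proj (vec_dot_self p.2),
    dot_self_cross, (matAinv_of_tangent (vec_dot_self p.2) hG).1]
  simp

theorem pullbackSF_eq (hΩ : IsOpen Ω) (hΦ : ContMDiffOn IPt IPt ∞ Φ (Ω ×ˢ univ))
    (hwR : IsSmoothBoostRotation w R Ω) (hd : IsDescribedBy w R Ω Φ)
    {D : Set Pt} {U V : Pt → ℝ} {Γ : Pt → Fin 3 → ℝ}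
    (hSF : IsShearFreeNQS D U Γ) (hΦD : MapsTo Φ (Ω ×ˢ univ) D)
    {p : Pt} (hp : p ∈ Ω ×ˢ (univ : Set S2)) (ξ : TangentSpace IPt p) :
    pullbackSF Φ U V Γ p ξ =
      (p.1.2 • dtheta p ξ + dr p ξ • betaPar w R p + dz p ξ • gammaPar w R Φ U Γ p)
        ⬝ᵥ (p.1.2 • dtheta p ξ + dr p ξ • betaPar w R p + dz p ξ • gammaPar w R Φ U Γ p)
      - 2 * uPar w R Φ U p * dr p ξ * dz p ξ - 2 * uvPar w R Φ U V Γ p * dz p ξ ^ 2 := by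
  have h := pullback_form (w := w p.1) (w₀ := wz w p.1) (w₁ := wr w p.1) (R := R p.1)
    (R₀ := Rz R p.1) (R₁ := Rr R p.1) (G := Γ (Φ p)) (vec_dot_self p.2) (vec_dot_dtheta p ξ)
    (hwR.orthogonal hp.1) (hwR.skew hΩ hp.1).1 (hwR.skew hΩ hp.1).2
    (image_dot_Gamma hSF hΦD hd hp) (dz p ξ) (dr p ξ) p.1.2 (U (Φ p)) (V (Φ p))
  rw [gammaPar_eq, pullbackSF, nqsForm, dz_mfderiv hΩ hΦ hd hp, dr_mfderiv hΩ hΦ hwR hd hp,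
    dtheta_mfderiv hΩ hΦ hwR hd hp, (hd p.1 hp.1 p.2).1, smul_zero, add_zero]
  exact h

/-- The parameters of a line element `|r dθ + β dr + γ dz|² - 2u dr dz - 2h dz²` are determined by
the line element. -/
theorem nqsForm_params_unique {p : Pt} (hr : 0 < p.1.2) {u h u' v' : ℝ} {β γ β' γ' : Fin 3 → ℝ}
    (hβ : vec p.2 ⬝ᵥ β = 0) (hγ : vec p.2 ⬝ᵥ γ = 0)
    (hβ' : vec p.2 ⬝ᵥ β' = 0) (hγ' : vec p.2 ⬝ᵥ γ' = 0) :
    (∀ ξ : TangentSpace IPt p,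
      (p.1.2 • dtheta p ξ + dr p ξ • β + dz p ξ • γ)
        ⬝ᵥ (p.1.2 • dtheta p ξ + dr p ξ • β + dz p ξ • γ)
      - 2 * u * dr p ξ * dz p ξ - 2 * h * dz p ξ ^ 2 = nqsForm u' v' β' γ' p ξ) ↔
    u' = u ∧ u' * v' = h ∧ β' = β ∧ γ' = γ := by
  constructor
  · intro H
    have key : ∀ (a b : ℝ) (τ : Fin 3 → ℝ), vec p.2 ⬝ᵥ τ = 0 →
        (p.1.2 • τ + b • β + a • γ) ⬝ᵥ (p.1.2 • τ + b • β + a • γ)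
          - 2 * u * b * a - 2 * h * a ^ 2
        = -2 * u' * a * (b + v' * a)
          + (p.1.2 • τ + b • β' + a • γ') ⬝ᵥ (p.1.2 • τ + b • β' + a • γ') := by
      intro a b τ hτ
      obtain ⟨ξ, h1, h2, h3⟩ := exists_tangent p a b hτ
      have := H ξ
      rwa [nqsForm, h1, h2, h3] at this
    -- The vectors `dθ = ±(β' - β)` with `dz = 0`, `dr = 1` are compared: the difference keeps only
    -- the cross term and leaves `r|β' - β|² = 0`. For `γ`, with `dz = 1`, `dr = 0`, the `dz²` terms
    -- cancel in the same way.
    have hββ : β' = β := by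
      have e1 := key 0 1 (β' - β) (by rw [dotProduct_sub, hβ, hβ', sub_zero])
      have e2 := key 0 1 (-(β' - β)) (by rw [dotProduct_neg, dotProduct_sub, hβ, hβ']; simp)
      have e3 : (β' - β) ⬝ᵥ (β' - β) = 0 := by
        simp only [zero_smul, one_smul, add_zero, smul_neg, add_dotProduct, dotProduct_add,
          sub_dotProduct, dotProduct_sub, smul_dotProduct, dotProduct_smul, neg_dotProduct,
          dotProduct_neg, smul_eq_mul, dotProduct_comm β' β] at e1 e2 ⊢
        have : p.1.2 * (β' ⬝ᵥ β' - β ⬝ᵥ β' - (β ⬝ᵥ β' - β ⬝ᵥ β)) = 0 := by linarith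
        exact (mul_eq_zero.1 this).resolve_left hr.ne'
      exact sub_eq_zero.1 (dotProduct_self_eq_zero.1 e3)
    have hγγ : γ' = γ := by
      have e1 := key 1 0 (γ' - γ) (by rw [dotProduct_sub, hγ, hγ', sub_zero])
      have e2 := key 1 0 (-(γ' - γ)) (by rw [dotProduct_neg, dotProduct_sub, hγ, hγ']; simp)
      have e3 : (γ' - γ) ⬝ᵥ (γ' - γ) = 0 := by
        simp only [zero_smul, one_smul, add_zero, smul_neg, add_dotProduct, dotProduct_add,
          sub_dotProduct, dotProduct_sub, smul_dotProduct, dotProduct_smul, neg_dotProduct,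
          dotProduct_neg, smul_eq_mul, dotProduct_comm γ' γ] at e1 e2 ⊢
        have : p.1.2 * (γ' ⬝ᵥ γ' - γ ⬝ᵥ γ' - (γ ⬝ᵥ γ' - γ ⬝ᵥ γ)) = 0 := by linarith
        exact (mul_eq_zero.1 this).resolve_left hr.ne'
      exact sub_eq_zero.1 (dotProduct_self_eq_zero.1 e3)
    subst hββ hγγ
    -- Now the squares agree; `(dz, dr) = (1, 0)` gives `u'v' = h`, and `(1, 1)` then gives `u' =
    -- u`.
    have e1 := key 1 0 0 (by simp)
    have e2 := key 1 1 0 (by simp)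
    refine ⟨by linarith, by linarith, rfl, rfl⟩
  · rintro ⟨rfl, rfl, rfl, rfl⟩ ξ
    rw [nqsForm]
    ring

end

end

/-! ### Smooth choice of the boost and the rotation. -/

section

theorem single_dot_self (j : Fin 3) :
    (Pi.single j 1 : Fin 3 → ℝ) ⬝ᵥ Pi.single j 1 = 1 := by
  simp

/-- The `j`-th point of the standard basis on `S²`. -/
def basisPt (j : Fin 3) : S2 := toS2 (Pi.single j 1) (single_dot_self j)

/-- The antipode of the `j`-th point of the standard basis. -/
def negBasisPt (j : Fin 3) : S2 := toS2 (-Pi.single j 1) (by simp)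

/-- The boost vector attached to a quasi-spherical map, recovered from the times of the images
of `± e_j`. -/
def boostOf (Φ : Pt → Pt) (q : ℝ × ℝ) (j : Fin 3) : ℝ :=
  ((Φ (q, basisPt j)).1.2 - (Φ (q, negBasisPt j)).1.2) / (2 * q.2)

/-- The matrix `R W` recovered from the spatial positions of the images of `± e_j`. -/
def linearPartOf (Φ : Pt → Pt) (q : ℝ × ℝ) : Matrix (Fin 3) (Fin 3) ℝ :=
  Matrix.of fun i j => ((Φ (q, basisPt j)).1.2 * vec (Φ (q, basisPt j)).2 i
    - (Φ (q, negBasisPt j)).1.2 * vec (Φ (q, negBasisPt j)).2 i) / (2 * q.2)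

/-- The rotation attached to a quasi-spherical map. -/
def rotationOf (Φ : Pt → Pt) (q : ℝ × ℝ) : Matrix (Fin 3) (Fin 3) ℝ :=
  linearPartOf Φ q * boostWinv (boostOf Φ q)

variable {Ω : Set (ℝ × ℝ)} {Φ : Pt → Pt}

/-- The even part `b` of `f` cancels in `f(e_j) - f(-e_j) = 2w_j`. -/
theorem boostOf_eq {q : ℝ × ℝ} (hr : 0 < q.2) {w : Fin 3 → ℝ}
    (h : ∀ θ, (Φ (q, θ)).1.2 = q.2 * fFac w (vec θ)) : boostOf Φ q = w := by
  ext j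
  rw [boostOf, h, h, basisPt, negBasisPt, vec_toS2, vec_toS2, fFac, fFac, neg_dotProduct,
    single_one_dotProduct]
  field_simp
  ring

theorem linearPartOf_eq {q : ℝ × ℝ} (hr : 0 < q.2) {w : Fin 3 → ℝ}
    {R : Matrix (Fin 3) (Fin 3) ℝ}
    (h : ∀ θ, (Φ (q, θ)).1.2 = q.2 * fFac w (vec θ))
    (h' : ∀ θ, vec (Φ (q, θ)).2 = (fFac w (vec θ))⁻¹ • (R *ᵥ (w + boostW w *ᵥ vec θ))) :
    linearPartOf Φ q = R * boostW w := by
  ext i j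
  have key : ∀ θ, (Φ (q, θ)).1.2 * vec (Φ (q, θ)).2 i
      = q.2 * ((R *ᵥ w) i + ((R * boostW w) *ᵥ vec θ) i) := by
    intro θ
    have := (fFac_pos (w := w) (vec_dot_self θ)).ne'
    rw [h, h', Matrix.mulVec_add, Matrix.mulVec_mulVec, Pi.smul_apply, Pi.add_apply, smul_eq_mul]
    field_simp
  rw [linearPartOf, Matrix.of_apply, key, key, basisPt, negBasisPt, vec_toS2, vec_toS2,
    Matrix.mulVec_neg, Matrix.mulVec_single_one]
  simp only [Pi.neg_apply, Matrix.col_apply]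
  field_simp
  ring

/-- The boost and rotation that exist for each `q` separately must agree with the explicit
expressions in `Φ`. So no choice is involved, and smoothness of `Φ` passes to both. -/
theorem IsQuasiSpherical.boostOf_rotationOf (hΩr : ∀ q ∈ Ω, 0 < q.2)
    (hqs : IsQuasiSpherical Ω Φ) {q : ℝ × ℝ} (hq : q ∈ Ω) :
    rotationOf Φ q ∈ Matrix.specialOrthogonalGroup (Fin 3) ℝ ∧ ∀ θ : S2,
      (Φ (q, θ)).1.2 = q.2 * fFac (boostOf Φ q) (vec θ) ∧
      vec (Φ (q, θ)).2 = (fFac (boostOf Φ q) (vec θ))⁻¹ •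
        (rotationOf Φ q *ᵥ (boostOf Φ q + boostW (boostOf Φ q) *ᵥ vec θ)) := by
  obtain ⟨w, R, hR, h⟩ := (hqs q hq).2.exists_boost_rotation (hΩr q hq)
  have hw : boostOf Φ q = w := boostOf_eq (hΩr q hq) fun θ => (h θ).1
  have hRR : rotationOf Φ q = R := by
    rw [rotationOf, linearPartOf_eq (hΩr q hq) (fun θ => (h θ).1) (fun θ => (h θ).2), hw,
      mul_assoc, boostW_mul_boostWinv, mul_one]
  rw [hw, hRR]
  exact ⟨hR, h⟩

theorem contDiffOn_comp_section {k : Pt → ℝ} (hk : ContMDiff IPt 𝓘(ℝ, ℝ) ∞ k)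
    (hΦ : ContMDiffOn IPt IPt ∞ Φ (Ω ×ˢ univ)) (θ : S2) :
    ContDiffOn ℝ ∞ (fun q => k (Φ (q, θ))) Ω := by
  rw [← contMDiffOn_iff_contDiffOn]
  have hs : ContMDiff 𝓘(ℝ, ℝ × ℝ) IPt ∞ fun q : ℝ × ℝ => (q, θ) :=
    contMDiff_id.prodMk contMDiff_const
  exact hk.comp_contMDiffOn (hΦ.comp hs.contMDiffOn fun q hq => ⟨hq, trivial⟩)

theorem contMDiff_radius : ContMDiff IPt 𝓘(ℝ, ℝ) ∞ fun x : Pt => x.1.2 :=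
  contDiff_snd.contMDiff.comp contMDiff_fst

theorem contMDiff_position (i : Fin 3) :
    ContMDiff IPt 𝓘(ℝ, ℝ) ∞ fun x : Pt => x.1.2 * vec x.2 i := by
  have h : ContDiff ℝ ∞ fun y : (ℝ × ℝ) × (Fin 3 → ℝ) => y.1.2 * y.2 i := by fun_prop
  exact h.contMDiff.comp contMDiff_ambient

theorem contDiffOn_boostOf (hΩr : ∀ q ∈ Ω, 0 < q.2)
    (hΦ : ContMDiffOn IPt IPt ∞ Φ (Ω ×ˢ univ)) : ContDiffOn ℝ ∞ (boostOf Φ) Ω := by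
  refine contDiffOn_pi.2 fun j => ?_
  exact ((contDiffOn_comp_section contMDiff_radius hΦ _).sub
    (contDiffOn_comp_section contMDiff_radius hΦ _)).div (by fun_prop)
    fun q hq => by have := hΩr q hq; positivity

theorem contDiffOn_linearPartOf (hΩr : ∀ q ∈ Ω, 0 < q.2)
    (hΦ : ContMDiffOn IPt IPt ∞ Φ (Ω ×ˢ univ)) (i j : Fin 3) :
    ContDiffOn ℝ ∞ (fun q => linearPartOf Φ q i j) Ω :=
  ((contDiffOn_comp_section (contMDiff_position i) hΦ _).sub
    (contDiffOn_comp_section (contMDiff_position i) hΦ _)).div (by fun_prop)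
    fun q hq => by have := hΩr q hq; positivity

theorem contDiff_boostB : ContDiff ℝ ∞ boostB := by
  refine ContDiff.sqrt ?_ fun w => ?_
  · simp only [dotProduct, Fin.sum_univ_three]
    fun_prop
  · have := dotProduct_self_nonneg' w
    positivity

theorem contDiff_boostWinv (i j : Fin 3) :
    ContDiff ℝ ∞ fun w : Fin 3 → ℝ => boostWinv w i j := by
  have hb := contDiff_boostB
  have h1 : ∀ w, boostB w * (boostB w + 1) ≠ 0 := fun w => by
    have := boostB_pos w; positivity
  have h2 : ContDiff ℝ ∞ fun w : Fin 3 → ℝ => w i * w j := by fun_prop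
  exact contDiff_const.sub
    ((contDiff_const.div (hb.mul (hb.add contDiff_const)) h1).mul h2)

theorem contDiffOn_rotationOf (hΩr : ∀ q ∈ Ω, 0 < q.2)
    (hΦ : ContMDiffOn IPt IPt ∞ Φ (Ω ×ˢ univ)) (i j : Fin 3) :
    ContDiffOn ℝ ∞ (fun q => rotationOf Φ q i j) Ω := by
  simp only [rotationOf, Matrix.mul_apply]
  exact ContDiffOn.sum fun k _ => (contDiffOn_linearPartOf hΩr hΦ i k).mul
    ((contDiff_boostWinv k j).comp_contDiffOn (contDiffOn_boostOf hΩr hΦ))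

theorem IsQuasiSpherical.isSmoothBoostRotation (hΩr : ∀ q ∈ Ω, 0 < q.2)
    (hΦ : ContMDiffOn IPt IPt ∞ Φ (Ω ×ˢ univ)) (hqs : IsQuasiSpherical Ω Φ) :
    IsSmoothBoostRotation (boostOf Φ) (rotationOf Φ) Ω :=
  ⟨contDiffOn_boostOf hΩr hΦ, contDiffOn_rotationOf hΩr hΦ,
    fun _ hq => (hqs.boostOf_rotationOf hΩr hq).1⟩

theorem IsQuasiSpherical.isDescribedBy (hΩr : ∀ q ∈ Ω, 0 < q.2) (hqs : IsQuasiSpherical Ω Φ) :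
    IsDescribedBy (boostOf Φ) (rotationOf Φ) Ω Φ := by
  intro q hq θ
  have h := (hqs.boostOf_rotationOf hΩr hq).2 θ
  exact ⟨Prod.ext ((hqs q hq).1 θ) h.1, h.2⟩

end

/-! ### The inverse function theorem for smooth maps of manifolds. -/

section

open Filter Topology

section InverseFunction

variable {E : Type*} [NormedAddCommGroup E] [NormedSpace ℝ E] [CompleteSpace E]
  {F : Type*} [NormedAddCommGroup F] [NormedSpace ℝ F]

/-- The inverse function theorem, as a statement about a smooth partial diffeomorphism. -/
theorem exists_partialDiffeomorph_of_fderiv {g : E → F} {O : Set E} (hO : IsOpen O)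
    (hg : ContDiffOn ℝ ∞ g O) {a : E} (ha : a ∈ O) (A : E ≃L[ℝ] F)
    (hA : (A : E →L[ℝ] F) = fderiv ℝ g a) :
    ∃ P : PartialDiffeomorph 𝓘(ℝ, E) 𝓘(ℝ, F) E F ∞,
      a ∈ P.source ∧ P.source ⊆ O ∧ ∀ x, P x = g x := by
  have hga : ContDiffAt ℝ ∞ g a := hg.contDiffAt (hO.mem_nhds ha)
  have hda : HasFDerivAt g (A : E →L[ℝ] F) a := by
    rw [hA]; exact (hga.differentiableAt (by simp)).hasFDerivAt
  let h := hga.toOpenPartialHomeomorph g hda (by simp)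
  have hcont : ContinuousOn (fderiv ℝ g) O := hg.continuousOn_fderiv_of_isOpen hO (by simp)
  -- The source is cut down to points with invertible derivative, an open condition, so that the
  -- local inverse is smooth on its whole target and not only at the image of `a`.
  have hO' : IsOpen (O ∩ fderiv ℝ g ⁻¹' range ((↑) : (E ≃L[ℝ] F) → E →L[ℝ] F)) :=
    hcont.isOpen_inter_preimage hO ContinuousLinearEquiv.isOpen
  let k := h.restrOpen _ hO'
  have hk : ∀ x, k x = g x := fun x => rfl
  refine ⟨⟨k.toPartialEquiv, k.open_source, k.open_target, ?_, ?_⟩, ?_, ?_, hk⟩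
  · exact (hg.mono fun x hx => hx.2.1).contMDiffOn
  · refine ContDiffOn.contMDiffOn fun y hy => ?_
    have hx := k.map_target hy
    obtain ⟨B, hB⟩ := hx.2.2
    have hgx : ContDiffAt ℝ ∞ g (k.symm y) := hg.contDiffAt (hO.mem_nhds hx.2.1)
    refine (k.contDiffAt_symm (f₀' := B) hy ?_ hgx).contDiffWithinAt
    rw [hB]
    exact (hgx.differentiableAt (by simp)).hasFDerivAt
  · exact ⟨hga.mem_toOpenPartialHomeomorph_source hda (by simp), ha, A, hA⟩
  · exact fun x hx => hx.2.1

variable {H : Type*} [TopologicalSpace H] {I : ModelWithCorners ℝ E H} [I.Boundaryless]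
  {M : Type*} [TopologicalSpace M] [ChartedSpace H M] [IsManifold I ∞ M]
  {H' : Type*} [TopologicalSpace H'] {J : ModelWithCorners ℝ F H'} [J.Boundaryless]
  {N : Type*} [TopologicalSpace N] [ChartedSpace H' N] [IsManifold J ∞ N]

/-- An extended chart of a boundaryless manifold is a partial diffeomorphism. -/
def extChartPartialDiffeomorph {E : Type*} [NormedAddCommGroup E] [NormedSpace ℝ E]
    {H : Type*} [TopologicalSpace H] (I : ModelWithCorners ℝ E H) [I.Boundaryless]
    {M : Type*} [TopologicalSpace M] [ChartedSpace H M] [IsManifold I ∞ M] (x : M) :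
    PartialDiffeomorph I 𝓘(ℝ, E) M E ∞ where
  toPartialEquiv := extChartAt I x
  open_source := isOpen_extChartAt_source x
  open_target := isOpen_extChartAt_target x
  contMDiffOn_toFun := by
    rw [extChartAt_source]
    exact contMDiffOn_extChartAt
  contMDiffOn_invFun := contMDiffOn_extChartAt_symm x

/-- The inverse function theorem on manifolds without boundary. -/
theorem isLocalDiffeomorphAt_of_mfderiv {f : M → N} {s : Set M} (hs : IsOpen s)
    (hf : ContMDiffOn I J ∞ f s) {x : M} (hx : x ∈ s) (A : E ≃L[ℝ] F)
    (hA : (A : E →L[ℝ] F) = mfderiv I J f x) : IsLocalDiffeomorphAt I J ∞ f x := by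
  let c := extChartPartialDiffeomorph I x
  let d := extChartPartialDiffeomorph J (f x)
  have hs' : IsOpen (s ∩ f ⁻¹' d.source) := hf.continuousOn.isOpen_inter_preimage hs d.open_source
  have hO : IsOpen (c.target ∩ c.symm ⁻¹' (s ∩ f ⁻¹' d.source)) :=
    c.contMDiffOn_invFun.continuousOn.isOpen_inter_preimage c.open_target hs'
  have hfx : MDifferentiableAt I J f x :=
    (hf.contMDiffAt (hs.mem_nhds hx)).mdifferentiableAt (by simp)
  have hxc : c.symm (c x) = x := c.left_inv (mem_extChartAt_source (I := I) x)
  have hg : ContDiffOn ℝ ∞ (d ∘ f ∘ c.symm) (c.target ∩ c.symm ⁻¹' (s ∩ f ⁻¹' d.source)) := by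
    rw [← contMDiffOn_iff_contDiffOn]
    exact d.contMDiffOn_toFun.comp (hf.comp (c.contMDiffOn_invFun.mono inter_subset_left)
      fun y hy => hy.2.1) fun y hy => hy.2.2
  have ha : c x ∈ c.target ∩ c.symm ⁻¹' (s ∩ f ⁻¹' d.source) := by
    refine ⟨mem_extChartAt_target (I := I) x, ?_⟩
    rw [mem_preimage, hxc]
    exact ⟨hx, mem_extChartAt_source (I := J) (f x)⟩
  obtain ⟨P, hP1, hP2, hP3⟩ := exists_partialDiffeomorph_of_fderiv hO hg ha A (by
    rw [hA, hfx.mfderiv, I.range_eq_univ, fderivWithin_univ]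
    rfl)
  refine ⟨(c.trans P).trans d.symm, ?_, ?_⟩
  · refine ⟨⟨mem_extChartAt_source (I := I) x, hP1⟩, ?_⟩
    change P (c x) ∈ d.target
    rw [hP3]
    change d (f (c.symm (c x))) ∈ d.target
    rw [hxc]
    exact mem_extChartAt_target (I := J) (f x)
  · rintro y ⟨⟨hy1, hy2⟩, hy3⟩
    have hy := hP2 hy2
    have e : c.symm (c y) = y := c.left_inv hy1
    have hfy : f (c.symm (c y)) ∈ d.source := hy.2.2
    rw [e] at hfy
    change f y = d.symm (P (c y))
    rw [hP3]
    change f y = d.symm (d (f (c.symm (c y))))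
    rw [e]
    exact (d.left_inv hfy).symm

end InverseFunction

end

/-! ### The diffeomorphism criterion. -/

section

open Filter Topology

theorem abs_dotProduct_le_len {θ : Fin 3 → ℝ} (hθ : θ ⬝ᵥ θ = 1) (x : Fin 3 → ℝ) :
    |θ ⬝ᵥ x| ≤ len x := by
  refine Real.abs_le_sqrt ?_
  have h := dotProduct_self_nonneg' (x - (θ ⬝ᵥ x) • θ)
  simp only [sub_dotProduct, dotProduct_sub, smul_dotProduct, dotProduct_smul, smul_eq_mul, hθ,
    dotProduct_comm x θ] at h
  nlinarith

theorem one_add_mul_dot_pos {r : ℝ} (hr : 0 < r) {θ x : Fin 3 → ℝ} (hθ : θ ⬝ᵥ θ = 1)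
    (h : r * len x < 1) : 0 < 1 + r * (θ ⬝ᵥ x) := by
  have h1 := (abs_le.1 (abs_dotProduct_le_len hθ x)).1
  nlinarith

variable {Ω : Set (ℝ × ℝ)} {w : ℝ × ℝ → Fin 3 → ℝ} {R : ℝ × ℝ → Matrix (Fin 3) (Fin 3) ℝ}
  {Φ : Pt → Pt}

theorem uPar_pos (hΩr : ∀ q ∈ Ω, 0 < q.2) {D : Set Pt} {U : Pt → ℝ} {Γ : Pt → Fin 3 → ℝ}
    (hSF : IsShearFreeNQS D U Γ) (hΦD : MapsTo Φ (Ω ×ˢ univ) D)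
    (ht : ∀ q ∈ Ω, q.2 * len (t1 w R q) < 1) {p : Pt} (hp : p ∈ Ω ×ˢ (univ : Set S2)) :
    0 < uPar w R Φ U p :=
  mul_pos (mul_pos (hSF.U_pos _ (hΦD hp)) (fFac_pos (vec_dot_self p.2)))
    (one_add_mul_dot_pos (hΩr _ hp.1) (vec_dot_self p.2) (ht _ hp.1))

/-- Along a ray of the light cone, the logarithmic derivative of `f` is `θ ⬝ t`. -/
theorem fFacDeriv_of_zetaDeriv_eq_zero {w w' θ τ : Fin 3 → ℝ} {R R' : Matrix (Fin 3) (Fin 3) ℝ}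
    (hθ : θ ⬝ᵥ θ = 1) (hR : Rᵀ * R = 1) (hR' : (Rᵀ * R')ᵀ = -(Rᵀ * R'))
    (h : zetaDeriv w w' θ τ R R' = 0) :
    fFacDeriv w w' θ τ = fFac w θ * (θ ⬝ᵥ vecT w w' R R') ∧ angularRate w w' θ τ R R' = 0 := by
  have h0 : angularRate w w' θ τ R R' = 0 := by
    rw [← matAinv_mulVec_zetaDeriv hθ hR hR', h]
    simp
  refine ⟨?_, h0⟩
  rw [fFacDeriv_eq hR hR', h0]
  simp

/-- For `ξ` in the kernel, `dz = 0` because `Φ` preserves `z`. Vanishing of `dζ` kills the angular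
rate, so `0 = dρ = f(1 + r θᵀt₁)dr` and `dr = 0`. The angular rate is then `dθ` itself. -/
theorem mfderiv_eq_zero (hΩ : IsOpen Ω) (hΩr : ∀ q ∈ Ω, 0 < q.2)
    (hΦ : ContMDiffOn IPt IPt ∞ Φ (Ω ×ˢ univ))
    (hwR : IsSmoothBoostRotation w R Ω) (hd : IsDescribedBy w R Ω Φ)
    (ht : ∀ q ∈ Ω, q.2 * len (t1 w R q) < 1) {p : Pt} (hp : p ∈ Ω ×ˢ (univ : Set S2))
    {ξ : TangentSpace IPt p} (hξ : mfderiv IPt IPt Φ p ξ = 0) : ξ = 0 := by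
  have hz := dz_mfderiv hΩ hΦ hd hp ξ
  have hr := dr_mfderiv hΩ hΦ hwR hd hp ξ
  have hζ := dtheta_mfderiv hΩ hΦ hwR hd hp ξ
  have e1 : dz (Φ p) (mfderiv IPt IPt Φ p ξ) = 0 := by rw [hξ]; exact map_zero _
  have e2 : dr (Φ p) (mfderiv IPt IPt Φ p ξ) = 0 := by rw [hξ]; exact map_zero _
  have e3 : dtheta (Φ p) (mfderiv IPt IPt Φ p ξ) = 0 := by rw [hξ]; exact map_zero _
  rw [e1] at hz
  rw [e2] at hr
  rw [e3] at hζ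
  have hf := fFac_pos (w := w p.1) (vec_dot_self p.2)
  obtain ⟨k1, k2⟩ := fFacDeriv_of_zetaDeriv_eq_zero (vec_dot_self p.2) (hwR.orthogonal hp.1)
    (hwR.skew_comb hΩ hp.1 _ _) hζ.symm
  rw [k1, vecT_lin, ← hz] at hr
  have hr0 : dr p ξ = 0 := by
    have h1 := one_add_mul_dot_pos (hΩr _ hp.1) (vec_dot_self p.2) (ht _ hp.1)
    have h2 : dr p ξ * (fFac (w p.1) (vec p.2) * (1 + p.1.2 * (vec p.2 ⬝ᵥ t1 w R p.1))) = 0 := by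
      rw [zero_smul, zero_add, dotProduct_smul, smul_eq_mul] at hr
      rw [t1]
      linear_combination -hr
    exact (mul_eq_zero.1 h2).resolve_right (mul_pos hf h1).ne'
  have hθ0 : dtheta p ξ = 0 := by
    rw [angularRate, vecT_lin, vecS_lin, ← hz, hr0] at k2
    simpa using k2
  exact ambientDeriv_injective p hz.symm hr0 hθ0

theorem isLocalDiffeomorphOn_of_lt (hΩ : IsOpen Ω) (hΩr : ∀ q ∈ Ω, 0 < q.2)
    (hΦ : ContMDiffOn IPt IPt ∞ Φ (Ω ×ˢ univ))
    (hwR : IsSmoothBoostRotation w R Ω) (hd : IsDescribedBy w R Ω Φ)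
    (ht : ∀ q ∈ Ω, q.2 * len (t1 w R q) < 1) :
    IsLocalDiffeomorphOn IPt IPt ∞ Φ (Ω ×ˢ univ) := by
  have := fact_finrank
  rintro ⟨p, hp⟩
  let L : ((ℝ × ℝ) × EuclideanSpace ℝ (Fin 2)) →L[ℝ] ((ℝ × ℝ) × EuclideanSpace ℝ (Fin 2)) :=
    mfderiv IPt IPt Φ p
  -- Both tangent spaces are the same finite-dimensional model space, so injectivity makes the
  -- differential an isomorphism.
  have hL : Function.Injective L.toLinearMap := by
    refine (injective_iff_map_eq_zero L.toLinearMap).2 fun ξ hξ => ?_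
    exact mfderiv_eq_zero (p := p) (ξ := ξ) hΩ hΩr hΦ hwR hd ht hp hξ
  exact isLocalDiffeomorphAt_of_mfderiv (hΩ.prod isOpen_univ) hΦ hp
    (LinearEquiv.ofInjectiveEndo L.toLinearMap hL).toContinuousLinearEquiv
    (ContinuousLinearMap.ext fun _ => rfl)

/-! ### Injectivity -/

/-- The action of a boost on the directions of the light cone. -/
def boostDir (w θ : Fin 3 → ℝ) : Fin 3 → ℝ := (fFac w θ)⁻¹ • (w + boostW w *ᵥ θ)

theorem boostB_neg (w : Fin 3 → ℝ) : boostB (-w) = boostB w := by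
  simp [boostB]

theorem boostW_neg (w : Fin 3 → ℝ) : boostW (-w) = boostW w := by
  ext i j
  simp [boostW, boostB_neg, Matrix.vecMulVec_apply]

theorem boostDir_dot_self {w θ : Fin 3 → ℝ} (hθ : θ ⬝ᵥ θ = 1) :
    boostDir w θ ⬝ᵥ boostDir w θ = 1 := by
  have hf := (fFac_pos (w := w) hθ).ne'
  rw [boostDir, smul_dotProduct, dotProduct_smul, boost_dot_self hθ, smul_eq_mul, smul_eq_mul]
  field_simp

/-- The boosts with parameters `w` and `-w` are inverse Lorentz transformations; accordingly their
factors `f` are reciprocal, which is `h1`. -/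
theorem boostDir_neg_boostDir {w θ : Fin 3 → ℝ} (hθ : θ ⬝ᵥ θ = 1) :
    boostDir (-w) (boostDir w θ) = θ := by
  have hf := (fFac_pos (w := w) hθ).ne'
  have hb := dotProduct_self_eq w
  have h1 : fFac (-w) (boostDir w θ) = (fFac w θ)⁻¹ := by
    have : (boostW w *ᵥ θ) ⬝ᵥ w = boostB w * (θ ⬝ᵥ w) := by
      rw [dotProduct_comm, Matrix.dotProduct_mulVec, ← Matrix.mulVec_transpose, boostW_transpose,
        boostW_mulVec_self, smul_dotProduct, dotProduct_comm, smul_eq_mul]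
    rw [fFac, boostB_neg, boostDir, smul_dotProduct, add_dotProduct, dotProduct_neg,
      dotProduct_neg, this, smul_eq_mul, hb]
    field_simp
    rw [fFac]
    ring
  rw [boostDir, h1, inv_inv, boostW_neg, boostDir, Matrix.mulVec_smul, Matrix.mulVec_add,
    Matrix.mulVec_mulVec, boostW_mul_self, boostW_mulVec_self, Matrix.add_mulVec,
    Matrix.one_mulVec, Matrix.vecMulVec_mulVec, smul_add, smul_smul, mul_inv_cancel₀ hf, one_smul]
  ext i
  simp [fFac, dotProduct_comm w θ]
  ring

theorem boostDir_boostDir_neg {w n : Fin 3 → ℝ} (hn : n ⬝ᵥ n = 1) :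
    boostDir w (boostDir (-w) n) = n := by
  simpa using boostDir_neg_boostDir (w := -w) hn

/-- Along a fixed ray `ζ` of the light cone, the radial coordinate of the image is an increasing
function of `r`. -/
theorem strictMonoOn_radius (hΩ : IsOpen Ω) (hΩr : ∀ q ∈ Ω, 0 < q.2)
    (hwR : IsSmoothBoostRotation w R Ω) (ht : ∀ q ∈ Ω, q.2 * len (t1 w R q) < 1) {z : ℝ}
    (hz : {r : ℝ | (z, r) ∈ Ω}.OrdConnected) {ζ : Fin 3 → ℝ} (hζ : ζ ⬝ᵥ ζ = 1) :
    StrictMonoOn (fun r : ℝ => r * fFac (w (z, r)) (boostDir (-w (z, r)) ((R (z, r))ᵀ *ᵥ ζ)))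
      {r : ℝ | (z, r) ∈ Ω} := by
  have key : ∀ r : ℝ, (z, r) ∈ Ω → ∃ c : ℝ, 0 < c ∧
      HasDerivAt (fun r : ℝ => r * fFac (w (z, r)) (boostDir (-w (z, r)) ((R (z, r))ᵀ *ᵥ ζ)))
        c r := by
    intro r hr
    have hc : DifferentiableAt ℝ (fun r : ℝ => ((z, r) : ℝ × ℝ)) r := by fun_prop
    have hw : ∀ k, HasDerivAt (fun r => w (z, r) k) (wr w (z, r) k) r := fun k =>
      (((differentiableAt_pi.1 (hwR.differentiableAt_w hΩ hr) k).comp r hc).hasDerivAt :)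
    have hR : ∀ i j, HasDerivAt (fun r => R (z, r) i j) (Rr R (z, r) i j) r := fun i j =>
      ((hwR.differentiableAt_R hΩ hr i j).comp r hc).hasDerivAt
    have hO : ∀ s, (z, s) ∈ Ω → ((R (z, s))ᵀ *ᵥ ζ) ⬝ᵥ ((R (z, s))ᵀ *ᵥ ζ) = 1 := fun s hs => by
      rw [dot_transpose_mulVec (hwR.orthogonal hs), hζ]
    have hn : ∀ k, HasDerivAt (fun r => ((R (z, r))ᵀ *ᵥ ζ) k)
        ((((Rr R (z, r))ᵀ *ᵥ ζ) + (R (z, r))ᵀ *ᵥ (0 : Fin 3 → ℝ)) k) r :=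
      hasDerivAt_mulVec (R := fun r => (R (z, r))ᵀ) (fun i j => hR j i)
        (fun k => hasDerivAt_const r (ζ k))
    -- The preimage direction `θ(r)` of `ζ` is itself a boosted unit vector, with parameter `-w` and
    -- trivial rotation, so the derivative formula for `ζ` applies to it.
    have hθ := hasDerivAt_zeta (w := fun r => -w (z, r)) (w' := -wr w (z, r)) (R := fun _ => 1)
      (R' := 0) (fun k => (hw k).neg) hn (fun i j => hasDerivAt_const r _) (hO r hr)
    simp only [Matrix.one_mulVec] at hθ
    have hθ1 : boostDir (-w (z, r)) ((R (z, r))ᵀ *ᵥ ζ) ⬝ᵥ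
        boostDir (-w (z, r)) ((R (z, r))ᵀ *ᵥ ζ) = 1 := boostDir_dot_self (hO r hr)
    have hζ0 := hasDerivAt_zeta hw hθ hR hθ1
    have hev : ∀ᶠ s in 𝓝 r, (z, s) ∈ Ω :=
      hc.continuousAt.preimage_mem_nhds (hΩ.mem_nhds hr)
    have hf := hasDerivAt_fFac hw hθ
    set θ' := zetaDeriv (-w (z, r)) (-wr w (z, r)) ((R (z, r))ᵀ *ᵥ ζ)
      (((Rr R (z, r))ᵀ *ᵥ ζ) + (R (z, r))ᵀ *ᵥ (0 : Fin 3 → ℝ)) 1 0 with hθ'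
    -- By construction the image direction of `θ(r)` is constantly `ζ`. Hence `df/dr = f θᵀt₁` and
    -- `d(rf)/dr = f(1 + r θᵀt₁) > 0`.
    have hzero : zetaDeriv (w (z, r)) (wr w (z, r)) (boostDir (-w (z, r)) ((R (z, r))ᵀ *ᵥ ζ))
        θ' (R (z, r)) (Rr R (z, r)) = 0 := by
      ext k
      refine (hζ0 k).unique ((hasDerivAt_const r (ζ k)).congr_of_eventuallyEq ?_)
      filter_upwards [hev] with s hs
      have := boostDir_boostDir_neg (w := w (z, s)) (hO s hs)
      rw [← Matrix.mulVec_smul]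
      change (R (z, s) *ᵥ (boostDir (w (z, s)) (boostDir (-w (z, s)) ((R (z, s))ᵀ *ᵥ ζ)))) k = ζ k
      rw [this, Matrix.mulVec_mulVec, mul_eq_one_comm.1 (hwR.orthogonal hs), Matrix.one_mulVec]
    obtain ⟨e, -⟩ := fFacDeriv_of_zetaDeriv_eq_zero hθ1 (hwR.orthogonal hr) (hwR.skew hΩ hr).2
      hzero
    have h1 := one_add_mul_dot_pos (hΩr _ hr) hθ1 (ht _ hr)
    refine ⟨_, mul_pos (fFac_pos (w := w (z, r)) hθ1) h1,
      ((hasDerivAt_id r).mul hf).congr_deriv ?_⟩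
    change 1 * _ + r * fFacDeriv (w (z, r)) (wr w (z, r))
      (boostDir (-w (z, r)) ((R (z, r))ᵀ *ᵥ ζ)) θ' = _
    rw [e, t1]
    simp only [boostDir]
    ring
  -- Only here do the slices have to be intervals: a positive derivative does not compare values
  -- across a gap.
  refine strictMonoOn_of_deriv_pos hz.convex (fun r hr => ?_) fun r hr => ?_
  · obtain ⟨c, -, h⟩ := key r hr
    exact h.continuousAt.continuousWithinAt
  · obtain ⟨c, hc, h⟩ := key r (interior_subset (s := {r : ℝ | (z, r) ∈ Ω}) hr)
    rwa [h.deriv]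

/-- An image point determines `z` and the ray `ζ`; strict monotonicity of the radius along that ray
determines `r`, and the inverse boost and rotation then recover `θ`. -/
theorem injOn_of_lt (hΩ : IsOpen Ω) (hΩr : ∀ q ∈ Ω, 0 < q.2)
    (hwR : IsSmoothBoostRotation w R Ω) (hd : IsDescribedBy w R Ω Φ)
    (ht : ∀ q ∈ Ω, q.2 * len (t1 w R q) < 1)
    (hz : ∀ z : ℝ, {r : ℝ | (z, r) ∈ Ω}.OrdConnected) : InjOn Φ (Ω ×ˢ univ) := by
  have key : ∀ q ∈ Ω, ∀ θ : S2,
      vec θ = boostDir (-w q) ((R q)ᵀ *ᵥ vec (Φ (q, θ)).2) := by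
    intro q hq θ
    rw [(hd q hq θ).2, ← Matrix.mulVec_smul, Matrix.mulVec_mulVec, hwR.orthogonal hq,
      Matrix.one_mulVec]
    exact (boostDir_neg_boostDir (vec_dot_self θ)).symm
  rintro ⟨⟨z, r⟩, θ⟩ ⟨hp, -⟩ ⟨⟨z', r'⟩, θ'⟩ ⟨hp', -⟩ h
  have a := (hd _ hp θ).1
  have a' := (hd _ hp' θ').1
  have b := key _ hp θ
  have b' := key _ hp' θ'
  rw [← h] at a' b'
  rw [a] at a'
  obtain rfl : z = z' := congrArg Prod.fst a'
  have hr : r * fFac (w (z, r)) (vec θ) = r' * fFac (w (z, r')) (vec θ') := congrArg Prod.snd a'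
  rw [b, b'] at hr
  obtain rfl : r = r' :=
    (strictMonoOn_radius hΩ hΩr hwR ht (hz z) (vec_dot_self _)).injOn hp hp' hr
  rw [← b'] at b
  rw [vec_injective b]

/-- By injectivity the global inverse coincides with each local inverse on the part of its target
that is mapped into `S`, and it inherits smoothness there. -/
theorem isDiffeoOntoOpen_of_injOn {S : Set Pt} (hS : IsOpen S)
    (hΦ : IsLocalDiffeomorphOn IPt IPt ∞ Φ S) (hinj : InjOn Φ S) : IsDiffeoOntoOpen Φ S := by
  have : Nonempty Pt := ⟨(0, basisPt 0)⟩
  have hΨ : LeftInvOn (Function.invFunOn Φ S) Φ S := hinj.leftInvOn_invFunOn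
  have key : ∀ p ∈ S, ∃ T : Set Pt, IsOpen T ∧ Φ p ∈ T ∧ T ⊆ Φ '' S ∧
      ContMDiffOn IPt IPt ∞ (Function.invFunOn Φ S) T := by
    intro p hp
    obtain ⟨P, hpP, hP⟩ := hΦ ⟨p, hp⟩
    have hT : ∀ y ∈ P.target ∩ P.invFun ⁻¹' S, Φ (P.invFun y) = y := fun y hy => by
      exact (hP (P.map_target hy.1)).trans (P.right_inv hy.1)
    refine ⟨P.target ∩ P.invFun ⁻¹' S,
      P.contMDiffOn_invFun.continuousOn.isOpen_inter_preimage P.open_target hS, ?_, ?_, ?_⟩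
    · have e : Φ p = P p := hP hpP
      have e' : P.invFun (P p) = p := P.left_inv hpP
      rw [e]
      exact ⟨P.map_source hpP, by rw [mem_preimage, e']; exact hp⟩
    · exact fun y hy => ⟨_, hy.2, hT y hy⟩
    · refine (P.contMDiffOn_invFun.mono inter_subset_left).congr fun y hy => ?_
      have := hΨ hy.2
      rwa [hT y hy] at this
  refine ⟨hΦ.contMDiffOn, ?_, Function.invFunOn Φ S, ?_, hΨ⟩
  · rw [isOpen_iff_mem_nhds]
    rintro _ ⟨p, hp, rfl⟩
    obtain ⟨T, h1, h2, h3, -⟩ := key p hp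
    exact Filter.mem_of_superset (h1.mem_nhds h2) h3
  · rintro _ ⟨p, hp, rfl⟩
    obtain ⟨T, h1, h2, -, h4⟩ := key p hp
    exact (h4.contMDiffAt (h1.mem_nhds h2)).contMDiffWithinAt

end

end NQS

end

/-! ### Assembly of the proposition. -/

theorem proposition5
    (Ω : Set (ℝ × ℝ)) (hΩ : IsOpen Ω) (hΩr : ∀ q ∈ Ω, 0 < q.2)
    (D : Set NQS.Pt) (U V : NQS.Pt → ℝ) (Γ : NQS.Pt → Fin 3 → ℝ)
    (hSF : NQS.IsShearFreeNQS D U Γ)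
    (Φ : NQS.Pt → NQS.Pt)
    (hΦ : ContMDiffOn NQS.IPt NQS.IPt ∞ Φ (Ω ×ˢ univ))
    (hΦD : MapsTo Φ (Ω ×ˢ univ) D)
    (hqs : NQS.IsQuasiSpherical Ω Φ) :
    ∃ (w : ℝ × ℝ → Fin 3 → ℝ) (R : ℝ × ℝ → Matrix (Fin 3) (Fin 3) ℝ),
      -- boost and rotation functions describing the map
      NQS.IsSmoothBoostRotation w R Ω ∧
      NQS.IsDescribedBy w R Ω Φ ∧
      -- the explicit pullback metric, with angular vectors beta and gamma
      (∀ p ∈ Ω ×ˢ (univ : Set NQS.S2),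
        NQS.vec p.2 ⬝ᵥ NQS.betaPar w R p = 0 ∧
        NQS.vec p.2 ⬝ᵥ NQS.gammaPar w R Φ U Γ p = 0 ∧
        ∀ ξ : TangentSpace NQS.IPt p,
          NQS.pullbackSF Φ U V Γ p ξ =
            (p.1.2 • NQS.dtheta p ξ + NQS.dr p ξ • NQS.betaPar w R p
                + NQS.dz p ξ • NQS.gammaPar w R Φ U Γ p)
              ⬝ᵥ (p.1.2 • NQS.dtheta p ξ + NQS.dr p ξ • NQS.betaPar w R p
                + NQS.dz p ξ • NQS.gammaPar w R Φ U Γ p)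
            - 2 * NQS.uPar w R Φ U p * NQS.dr p ξ * NQS.dz p ξ
            - 2 * NQS.uvPar w R Φ U V Γ p * NQS.dz p ξ ^ 2) ∧
      -- the NQS parameters of the pullback metric are exactly the ones given by the formulas
      (∀ p ∈ Ω ×ˢ (univ : Set NQS.S2), ∀ (u v : ℝ) (β γ : Fin 3 → ℝ),
        NQS.vec p.2 ⬝ᵥ β = 0 → NQS.vec p.2 ⬝ᵥ γ = 0 →
        ((∀ ξ : TangentSpace NQS.IPt p,
            NQS.pullbackSF Φ U V Γ p ξ = NQS.nqsForm u v β γ p ξ) ↔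
          u = NQS.uPar w R Φ U p ∧ u * v = NQS.uvPar w R Φ U V Γ p ∧
          β = NQS.betaPar w R p ∧ γ = NQS.gammaPar w R Φ U Γ p)) ∧
      -- the diffeomorphism criterion
      ((∀ q ∈ Ω, q.2 * NQS.len (NQS.t1 w R q) < 1) →
        (∀ p ∈ Ω ×ˢ (univ : Set NQS.S2), 0 < NQS.uPar w R Φ U p) ∧
        IsLocalDiffeomorphOn NQS.IPt NQS.IPt ∞ Φ (Ω ×ˢ univ) ∧
        ((∀ z : ℝ, {r : ℝ | (z, r) ∈ Ω}.OrdConnected) →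
          NQS.IsDiffeoOntoOpen Φ (Ω ×ˢ univ))) := by

  have hwR := hqs.isSmoothBoostRotation hΩr hΦ
  have hd := hqs.isDescribedBy hΩr
  refine ⟨_, _, hwR, hd, fun p hp => ⟨NQS.vec_dot_betaPar p, NQS.vec_dot_gammaPar hSF hΦD hd hp,
    NQS.pullbackSF_eq hΩ hΦ hwR hd hSF hΦD hp⟩, fun p hp u v β γ hβ hγ => ?_, fun ht => ⟨fun p hp =>
      NQS.uPar_pos hΩr hSF hΦD ht hp, NQS.isLocalDiffeomorphOn_of_lt hΩ hΩr hΦ hwR hd ht, fun hz =>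
      NQS.isDiffeoOntoOpen_of_injOn (hΩ.prod isOpen_univ)
        (NQS.isLocalDiffeomorphOn_of_lt hΩ hΩr hΦ hwR hd ht)
        (NQS.injOn_of_lt hΩ hΩr hwR hd ht hz)⟩⟩
  simp only [NQS.pullbackSF_eq hΩ hΦ hwR hd hSF hΦD hp]
  exact NQS.nqsForm_params_unique (hΩr _ hp.1) (NQS.vec_dot_betaPar p)
    (NQS.vec_dot_gammaPar hSF hΦD hd hp) hβ hγ
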